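/- Let $h,r>0$ and let $$X=\{\rho\in W^{1,1}(-h,h):\ \rho>0,\ \rho(-h)=\rho(h)=r\},$$ where $\rho$ is identified with its continuous representative on $[-h,h]$ and $\rho>0$ is meant on all of $[-h,h]$. For $c>0$ let $$\mathcal F_c(\rho)=\int_{-h}^{h}\Big(\rho+\frac c\rho\Big)\sqrt{1+(\rho')^2}\,dx,\qquad \rho\in X.$$ Let $\Xi$ be the unique positive solution of $\Xi\tanh\frac1\Xi+\operatorname{sech}^2\frac1\Xi=\Xi$, put $\omega=\frac{1}{\Xi\cosh(1/\Xi)}$, and assume $\frac hr\le\omega$. Then the equation $r=\Pi\cosh\frac h\Pi$ has exactly two positive solutions $\Pi_0>\Pi_1$; let $\rho_0(x)=\Pi_0\cosh\frac{x}{\Pi_0}$ be the stable catenary. For every $c>0$ the functional $\mathcal F_c$ has a unique minimizer $\rho_c\in X$. Moreover: a) If $0<c<r^2$, the equation $$\cosh\frac{2h}{E}=\frac{2r^2-E^2+2c}{E\sqrt{E^2-4c}}\qquad(E^2>4c)$$ has exactly one solution $E>\Pi_0$, and with this $E$ $$\rho_c(x)=\sqrt{\tfrac E2\sqrt{E^2-4c}\,\cosh\tfrac{2x}{E}+\tfrac{E^2}{2}-c}\qquad\text{for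 }x\in[-h,h].$$ In this case $\rho_c\in C^\infty([-h,h])$, it is even and strictly convex, and $\rho_0<\rho_c<r$ on $(-h,h)$. b) If $c=r^2$, then $\rho_c(x)=r$ for all $x\in[-h,h]$. c) If $c>r^2$, the equation $$\cosh\frac{2h}{E}=\frac{-2r^2+E^2-2c}{E\sqrt{E^2-4c}}\qquad(E\neq0,\ E^2>4c)$$ has exactly one real solution $E$, it is positive, and with this $E$ $$\rho_c(x)=\sqrt{-\tfrac E2\sqrt{E^2-4c}\,\cosh\tfrac{2x}{E}+\tfrac{E^2}{2}-c}\qquad\text{for }x\in[-h,h].$$ In this case $\rho_c\in C^\infty([-h,h])$, it is even and strictly concave, and $r<\rho_c<\rho_\infty$ on $(-h,h)$, where $\rho_\infty(x)=\sqrt{h^2+r^2-x^2}$. Moreover $\rho_c\to\rho_\infty$ uniformly on $[-h,h]$ as $c\to+\infty$. Finally, $\rho_{c_1}<\rho_{c_2}$ on $(-h,h)$ whenever $0<c_1<c_2$. -/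

import Mathlib

open Set Filter Topology MeasureTheory

noncomputable section

/-- The substitution `t = 1 / Ξ` turns the equation for `Ξ` into `2 t = 1 + exp (-2 t)`. -/
theorem xi_equation_iff (t : ℝ) (ht : 0 < t) :
    ((1 / t) * Real.tanh (1 / (1 / t)) + (1 / Real.cosh (1 / (1 / t))) ^ 2 = 1 / t) ↔
      2 * t = 1 + Real.exp (-(2 * t)) := by
  have hc : 0 < Real.cosh t := Real.cosh_pos t
  have e1 : Real.exp t ≠ 0 := (Real.exp_pos t).ne'
  have h2 : Real.exp (-(2 * t)) = Real.exp (-t) * Real.exp (-t) := by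
    rw [← Real.exp_add]; congr 1; ring
  have h3 : Real.exp t * Real.exp (-t) = 1 := by
    rw [← Real.exp_add]; simp
  have key : Real.cosh t * Real.cosh t - Real.sinh t * Real.cosh t
      = (1 + Real.exp (-(2 * t))) / 2 := by
    rw [Real.cosh_eq, Real.sinh_eq, h2]
    linear_combination (1 / 2) * h3
  rw [one_div_one_div, Real.tanh_eq_sinh_div_cosh]
  have hh : (1 / t * (Real.sinh t / Real.cosh t) + (1 / Real.cosh t) ^ 2 = 1 / t) ↔
      (Real.sinh t * Real.cosh t + t = Real.cosh t * Real.cosh t) := by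
    field_simp
  rw [hh]
  constructor <;> intro h <;> linarith

/-- The equation `Ξ tanh (1/Ξ) + sech² (1/Ξ) = Ξ` has exactly one positive solution. -/
theorem existsUnique_xi : ∃! Ξ : ℝ, 0 < Ξ ∧
    Ξ * Real.tanh (1 / Ξ) + (1 / Real.cosh (1 / Ξ)) ^ 2 = Ξ := by
  have hex : ∃ t ∈ Icc (0 : ℝ) 1, 2 * t - (1 + Real.exp (-(2 * t))) = 0 := by
    have hcont : ContinuousOn (fun t : ℝ => 2 * t - (1 + Real.exp (-(2 * t)))) (Icc 0 1) := by
      fun_prop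
    have hle : Real.exp (-(2 * (1 : ℝ))) ≤ 1 := by
      rw [Real.exp_le_one_iff]; norm_num
    exact intermediate_value_Icc (zero_le_one) hcont
      ⟨by norm_num, by linarith⟩
  obtain ⟨t, ht, hte⟩ := hex
  have htp : 0 < t := by
    have := Real.exp_pos (-(2 * t)); linarith
  refine ⟨1 / t, ⟨by positivity, (xi_equation_iff t htp).2 (by linarith)⟩, ?_⟩
  rintro X ⟨hX, hXe⟩
  have hs : 0 < 1 / X := by positivity
  have hse := (xi_equation_iff (1 / X) hs).1 (by simpa only [one_div_one_div] using hXe)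
  have : 1 / X = t := by
    rcases lt_trichotomy (1 / X) t with hlt | heq | hgt
    · have := Real.exp_lt_exp.2 (show -(2 * t) < -(2 * (1 / X)) by linarith)
      linarith
    · exact heq
    · have := Real.exp_lt_exp.2 (show -(2 * (1 / X)) < -(2 * t) by linarith)
      linarith
  rw [← this, one_div_one_div]

/-- The unique positive solution `Ξ` of `Ξ tanh (1/Ξ) + sech² (1/Ξ) = Ξ`. -/
def xiConst : ℝ := existsUnique_xi.choose

/-- The threshold `ω = 1 / (Ξ cosh (1/Ξ))`. -/
def omegaConst : ℝ := 1 / (xiConst * Real.cosh (1 / xiConst))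

/-- `g` is a weak derivative of `u` on the open interval `(a, b)`. -/
def IsWeakDeriv (a b : ℝ) (u g : ℝ → ℝ) : Prop :=
  ∀ φ : ℝ → ℝ, ContDiff ℝ (⊤ : ℕ∞) φ → HasCompactSupport φ → tsupport φ ⊆ Ioo a b →
    ∫ x in Ioo a b, u x * deriv φ x = - ∫ x in Ioo a b, g x * φ x

/-- `u` belongs to the Sobolev space `W^{1,1}(a, b)`. -/
def MemW11 (a b : ℝ) (u : ℝ → ℝ) : Prop :=
  IntegrableOn u (Ioo a b) ∧ ∃ g : ℝ → ℝ, IntegrableOn g (Ioo a b) ∧ IsWeakDeriv a b u g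

open Classical in
/-- The integrable weak derivative of `u ∈ W^{1,1}(a, b)`; it is determined up to a null set
(and is set to `0` if `u` is not in `W^{1,1}(a, b)`). -/
def weakDeriv (a b : ℝ) (u : ℝ → ℝ) : ℝ → ℝ :=
  if hu : ∃ g : ℝ → ℝ, IntegrableOn g (Ioo a b) ∧ IsWeakDeriv a b u g then hu.choose else 0

/-- The admissible class `X = {ρ ∈ W^{1,1}(-h, h) : ρ > 0, ρ(-h) = ρ(h) = r}`.  An element of
`W^{1,1}(-h, h)` is represented by its continuous representative on `[-h, h]`, so that positivity
and boundary values are meant pointwise; values outside `[-h, h]` are irrelevant. -/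
def admissible (h r : ℝ) : Set (ℝ → ℝ) :=
  {ρ | MemW11 (-h) h ρ ∧ ContinuousOn ρ (Icc (-h) h) ∧ (∀ x ∈ Icc (-h) h, 0 < ρ x) ∧
    ρ (-h) = r ∧ ρ h = r}

/-- The energy `F_c(ρ) = ∫_{-h}^{h} (ρ + c / ρ) √(1 + (ρ')²) dx`, with `ρ'` the weak derivative. -/
def energy (h c : ℝ) (ρ : ℝ → ℝ) : ℝ :=
  ∫ x in Ioo (-h) h, (ρ x + c / ρ x) * √(1 + (weakDeriv (-h) h ρ x) ^ 2)

/-- `ρ` minimizes `F_c` over `X`. -/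
def IsMinimizer (h r c : ℝ) (ρ : ℝ → ℝ) : Prop :=
  ρ ∈ admissible h r ∧ ∀ σ ∈ admissible h r, energy h c ρ ≤ energy h c σ

/-- `E` solves `cosh (2h/E) = (2r² - E² + 2c) / (E √(E² - 4c))`, the right-hand side being
defined, i.e. `E ≠ 0` and `E² > 4c`. -/
def SolvesConvexEq (h r c E : ℝ) : Prop :=
  E ≠ 0 ∧ 4 * c < E ^ 2 ∧
    Real.cosh (2 * h / E) = (2 * r ^ 2 - E ^ 2 + 2 * c) / (E * √(E ^ 2 - 4 * c))

/-- `E` solves `cosh (2h/E) = (-2r² + E² - 2c) / (E √(E² - 4c))`, the right-hand side being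
defined, i.e. `E ≠ 0` and `E² > 4c`. -/
def SolvesConcaveEq (h r c E : ℝ) : Prop :=
  E ≠ 0 ∧ 4 * c < E ^ 2 ∧
    Real.cosh (2 * h / E) = (-2 * r ^ 2 + E ^ 2 - 2 * c) / (E * √(E ^ 2 - 4 * c))

/-- The convex profile with constant `E`. -/
def convexProfile (c E x : ℝ) : ℝ :=
  √(E / 2 * √(E ^ 2 - 4 * c) * Real.cosh (2 * x / E) + E ^ 2 / 2 - c)

/-- The concave profile with constant `E`. -/
def concaveProfile (c E x : ℝ) : ℝ :=
  √(-(E / 2) * √(E ^ 2 - 4 * c) * Real.cosh (2 * x / E) + E ^ 2 / 2 - c)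

/-- The circular arc `ρ_∞(x) = √(h² + r² - x²)`. -/
def circleArc (h r x : ℝ) : ℝ := √(h ^ 2 + r ^ 2 - x ^ 2)

end

/-! Write `f y = y + c / y`. The integrand does not depend on `x`, so along an extremal `f ρ / √(1 +
ρ'²)` is a constant `E`. A suitable affine function `v` of `ρ²` then satisfies `v' = ±(2 / E) √(v² -
1)`, which is where the hyperbolic cosines come from.

Minimality is proved by calibration, without any compactness argument. If `f y ≥ E ≥ 0` and `s =
±1`, Cauchy-Schwarz gives `f y √(1 + p²) ≥ E + s p √(f y² - E²)`, and equality forces `E p = s √(f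
y² - E²)`. Integrated along an admissible `σ`, with `s` changing sign at a point `x₀`, this bounds
the energy below by `2 h E + 2 ε ∫_{σ x₀}^r √(f² - E²)` (`le_energy`).

The level `E` is adapted to the curve. Let `ε = 1` if `√c < r` and `ε = -1` if `r < √c`. Take `x₀` a
minimum point of `σ` in the first case and a maximum point in the second, and `E = f (σ x₀)`, or the
least value `2 √c` of `f` if `σ x₀` lies beyond `√c`. The bound is then at least `energyBound h r c
ε E` for some `E` in `[2 √c, f r]` (`exists_energyBound_le`), and the variational problem has become
the minimization of a function of one variable. Its derivative is `2 h` minus the width of the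
extremal at level `E`, so its critical points solve the boundary equation, and there the profile
attains the bound. For a second minimizer equality holds throughout: it has the same level and
solves the first-order equation a.e., which integrates to the same profile
(`IsExtremal.isMinimizer_profile`).

It remains to find the strict minimum of the bound. For `c < r²`, above `max P₀ (2 √c)` the boundary
equation is monotone in `E`, so the bound falls and then rises. Below `P₀` the case `c = 0` serves
for comparison: there the bound rises up to `P₁` and falls from `P₁` to `P₀`, so the rival of the
stable catenary is `E = 0`, with value `r²` (two discs), and `h / r ≤ ω` says exactly that the
catenary is no worse. For `c > r²` uniqueness of `E` is read off in the variables `p = f r / E` and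
`s = 2 h / E`. For `c = r²` the inequality `f ≥ 2 r` suffices.

The shape statements rest on `ρ² = r² - ε A (cosh (2h/E) - cosh (2x/E))` with `A = E √(E² - 4c) /
2`. Two values of `c` are compared through the height of the vertex on the convex branch and through
the slope at the endpoint on the concave one. -/

/-! ### Weak derivatives and absolute continuity -/

/-- Integration by parts: the a.e. derivative of an absolutely continuous function is a weak
derivative. -/
theorem AbsolutelyContinuousOnInterval.isWeakDeriv_deriv {a b : ℝ} (hab : a ≤ b) {f : ℝ → ℝ}
    (hf : AbsolutelyContinuousOnInterval f a b) : IsWeakDeriv a b f (deriv f) := by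
  intro φ hφ _ hs
  have hφac : AbsolutelyContinuousOnInterval φ a b :=
    (hφ.of_le (by exact_mod_cast le_top)).contDiffOn.absolutelyContinuousOnInterval
  have ha : φ a = 0 := image_eq_zero_of_notMem_tsupport fun h => lt_irrefl _ (hs h).1
  have hb : φ b = 0 := image_eq_zero_of_notMem_tsupport fun h => lt_irrefl _ (hs h).2
  have := hf.integral_mul_deriv_eq_deriv_mul hφac
  rw [ha, hb, intervalIntegral.integral_of_le hab, intervalIntegral.integral_of_le hab,
    integral_Ioc_eq_integral_Ioo, integral_Ioc_eq_integral_Ioo] at this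
  rw [this]; ring

theorem IsWeakDeriv.congr {a b : ℝ} {u g g' : ℝ → ℝ} (h : IsWeakDeriv a b u g)
    (hg : ∀ᵐ x ∂(volume.restrict (Ioo a b)), g x = g' x) : IsWeakDeriv a b u g' := by
  intro φ h1 h2 h3
  rw [h φ h1 h2 h3]
  congr 1
  apply integral_congr_ae
  filter_upwards [hg] with x hx
  rw [hx]

/-- Weak derivatives are unique up to null sets. -/
theorem IsWeakDeriv.ae_eq {a b : ℝ} {u g g' : ℝ → ℝ} (h : IsWeakDeriv a b u g)
    (h' : IsWeakDeriv a b u g') (hg : IntegrableOn g (Ioo a b))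
    (hg' : IntegrableOn g' (Ioo a b)) :
    ∀ᵐ x ∂(volume.restrict (Ioo a b)), g x = g' x := by
  rw [ae_restrict_iff' measurableSet_Ioo]
  have hint : IntegrableOn (fun x => g x - g' x) (Ioo a b) := hg.sub hg'
  have := isOpen_Ioo.ae_eq_zero_of_integral_contDiff_smul_eq_zero (μ := volume)
    (f := fun x => g x - g' x) (U := Ioo a b) hint.locallyIntegrableOn ?_
  · filter_upwards [this] with x hx hxm
    linarith [hx hxm]
  · intro φ h1 h2 h3
    have e1 := h φ h1 h2 h3
    have e2 := h' φ h1 h2 h3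
    have hb : ∃ C, ∀ x, ‖φ x‖ ≤ C := h1.continuous.bounded_above_of_compact_support h2
    obtain ⟨C, hC⟩ := hb
    have i1 : IntegrableOn (fun x => g x * φ x) (Ioo a b) :=
      hg.mul_bdd (c := C) h1.continuous.aestronglyMeasurable (Eventually.of_forall hC)
    have i2 : IntegrableOn (fun x => g' x * φ x) (Ioo a b) :=
      hg'.mul_bdd (c := C) h1.continuous.aestronglyMeasurable (Eventually.of_forall hC)
    have e3 : ∫ x in Ioo a b, (g x * φ x - g' x * φ x) = 0 := by
      rw [integral_sub i1 i2]; linarith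
    rw [← setIntegral_eq_integral_of_forall_compl_eq_zero (s := Ioo a b)]
    · rw [← e3]; congr 1; ext x; simp only [smul_eq_mul]; ring
    · intro x hx
      rw [image_eq_zero_of_notMem_tsupport (fun hh => hx (h3 hh))]; simp

/-- Every test function of mean zero on an interval is the derivative of a test function. -/
theorem exists_contDiff_deriv_eq_of_integral_eq_zero {a b : ℝ} {θ : ℝ → ℝ}
    (hθ : ContDiff ℝ (⊤ : ℕ∞) θ) (hc : HasCompactSupport θ) (hs : tsupport θ ⊆ Ioo a b)
    (h0 : ∫ x, θ x = 0) :
    ∃ φ : ℝ → ℝ, ContDiff ℝ (⊤ : ℕ∞) φ ∧ HasCompactSupport φ ∧ tsupport φ ⊆ Ioo a b ∧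
      deriv φ = θ := by
  rcases (tsupport θ).eq_empty_or_nonempty with he | hne
  · have : θ = 0 := tsupport_eq_empty_iff.1 he
    exact ⟨0, contDiff_const, HasCompactSupport.zero, by simp, by rw [this]; ext; simp⟩
  have hK : IsCompact (tsupport θ) := hc
  obtain ⟨p, hp⟩ := hK.exists_isLeast hne
  obtain ⟨q, hq⟩ := hK.exists_isGreatest hne
  have hder : ∀ x, HasDerivAt (fun x => ∫ t in a..x, θ t) (θ x) x := fun x =>
    intervalIntegral.integral_hasDerivAt_right (hθ.continuous.intervalIntegrable _ _)
      (hθ.continuous.stronglyMeasurableAtFilter _ _) hθ.continuous.continuousAt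
  have hd : deriv (fun x => ∫ t in a..x, θ t) = θ := funext fun x => (hder x).deriv
  have hpq : p ≤ q := hp.2 hq.1
  -- The primitive vanishes left of the least point `p` of the support of `θ`, and right of its
  -- greatest point `q` because the whole integral of `θ` is zero.
  have hsupp : Function.support (fun x => ∫ t in a..x, θ t) ⊆ Icc p q := by
    intro x hx
    by_contra hn
    apply hx
    rcases lt_or_ge x p with hlt | hge
    · have hap : a < p := (hs hp.1).1
      apply intervalIntegral.integral_zero_ae
      refine Eventually.of_forall fun t ht => ?_
      apply image_eq_zero_of_notMem_tsupport
      intro hmem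
      have h1 := hp.2 hmem
      have h2 : t ≤ max a x := ht.2
      have := max_lt hap hlt
      linarith
    · have hqx : q < x := by
        by_contra hh
        exact hn ⟨hge, not_lt.1 hh⟩
      have hax : a ≤ x := by linarith [(hs hp.1).1]
      change ∫ t in a..x, θ t = 0
      rw [intervalIntegral.integral_of_le hax, setIntegral_eq_integral_of_forall_compl_eq_zero, h0]
      intro t ht
      apply image_eq_zero_of_notMem_tsupport
      intro hmem
      exact ht ⟨(hs hmem).1, by linarith [hq.2 hmem]⟩
  have hts : tsupport (fun x => ∫ t in a..x, θ t) ⊆ Icc p q :=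
    closure_minimal hsupp isClosed_Icc
  refine ⟨fun x => ∫ t in a..x, θ t, ?_, ?_, ?_, hd⟩
  · rw [contDiff_infty_iff_deriv]
    refine ⟨fun x => (hder x).differentiableAt, ?_⟩
    rw [hd]; exact hθ
  · exact isCompact_Icc.of_isClosed_subset (isClosed_tsupport _) hts
  · exact hts.trans fun x hx => ⟨(hs hp.1).1.trans_le hx.1, hx.2.trans_lt (hs hq.1).2⟩

/-- The lemma of du Bois-Reymond. -/
theorem IsWeakDeriv.ae_const {a b : ℝ} (hab : a < b) {v : ℝ → ℝ} (hv : IntegrableOn v (Ioo a b))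
    (h : IsWeakDeriv a b v 0) : ∃ C, ∀ᵐ x ∂(volume.restrict (Ioo a b)), v x = C := by
  set m := (a + b) / 2 with hm
  let B : ContDiffBump m := ⟨(b - a) / 8, (b - a) / 4, by linarith, by linarith⟩
  set η : ℝ → ℝ := B.normed volume with hη
  have hη1 : ContDiff ℝ (⊤ : ℕ∞) η := B.contDiff_normed
  have hη2 : HasCompactSupport η := B.hasCompactSupport_normed
  have hη3 : tsupport η ⊆ Ioo a b := by
    rw [hη, B.tsupport_normed_eq, Real.closedBall_eq_Icc]
    intro x hx
    have h1 : m - (b - a) / 4 ≤ x := hx.1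
    have h2 : x ≤ m + (b - a) / 4 := hx.2
    constructor <;> linarith
  have hη4 : ∫ x, η x = 1 := B.integral_normed
  set C := ∫ x in Ioo a b, v x * η x
  refine ⟨C, ?_⟩
  rw [ae_restrict_iff' measurableSet_Ioo]
  have hint : IntegrableOn (fun x => v x - C) (Ioo a b) := hv.sub (by simp)
  have := isOpen_Ioo.ae_eq_zero_of_integral_contDiff_smul_eq_zero (μ := volume)
    (f := fun x => v x - C) (U := Ioo a b) hint.locallyIntegrableOn ?_
  · filter_upwards [this] with x hx hxm
    linarith [hx hxm]
  · intro ψ h1 h2 h3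
    set I := ∫ x, ψ x with hI
    have iψ : Integrable ψ := h1.continuous.integrable_of_hasCompactSupport h2
    have iη : Integrable η := hη1.continuous.integrable_of_hasCompactSupport hη2
    -- Subtracting `I η` from `ψ` makes the mean zero, so the result is the derivative of a test
    -- function and the hypothesis applies to it.
    obtain ⟨φ, f1, f2, f3, f4⟩ := exists_contDiff_deriv_eq_of_integral_eq_zero (a := a) (b := b)
      (θ := fun x => ψ x - I * η x) (h1.sub (contDiff_const.mul hη1))
      (h2.sub hη2.mul_left)
      ((tsupport_sub _ _).trans (union_subset h3 ((tsupport_mul_subset_right).trans hη3)))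
      (by rw [integral_sub iψ (iη.const_mul I), integral_const_mul, hη4]; ring)
    have e := h φ f1 f2 f3
    rw [f4] at e
    simp only [Pi.zero_apply, zero_mul, integral_zero, neg_zero] at e
    obtain ⟨D, hD⟩ := h1.continuous.bounded_above_of_compact_support h2
    obtain ⟨D', hD'⟩ := hη1.continuous.bounded_above_of_compact_support hη2
    have i1 : IntegrableOn (fun x => v x * ψ x) (Ioo a b) :=
      hv.mul_bdd (c := D) h1.continuous.aestronglyMeasurable (Eventually.of_forall hD)
    have i2 : IntegrableOn (fun x => v x * η x) (Ioo a b) :=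
      hv.mul_bdd (c := D') hη1.continuous.aestronglyMeasurable (Eventually.of_forall hD')
    have e1 : ∫ x in Ioo a b, v x * ψ x = I * C := by
      have : ∫ x in Ioo a b, (v x * ψ x - I * (v x * η x)) = 0 := by
        rw [← e]; congr 1; ext x; ring
      rw [integral_sub i1 (i2.const_mul I), integral_const_mul] at this
      linarith
    have e2 : ∫ x in Ioo a b, ψ x = I := by
      rw [hI]
      apply setIntegral_eq_integral_of_forall_compl_eq_zero
      intro x hx
      exact image_eq_zero_of_notMem_tsupport (fun hh => hx (h3 hh))
    rw [← setIntegral_eq_integral_of_forall_compl_eq_zero (s := Ioo a b)]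
    · have : ∫ x in Ioo a b, (v x * ψ x - C * ψ x) = 0 := by
        rw [integral_sub i1 (iψ.integrableOn.const_mul C), integral_const_mul, e1, e2]; ring
      rw [← this]; congr 1; ext x; simp only [smul_eq_mul]; ring
    · intro x hx
      rw [image_eq_zero_of_notMem_tsupport (fun hh => hx (h3 hh))]; simp

theorem MemW11.weakDeriv_spec {a b : ℝ} {u : ℝ → ℝ} (hu : MemW11 a b u) :
    IntegrableOn (weakDeriv a b u) (Ioo a b) ∧ IsWeakDeriv a b u (weakDeriv a b u) := by
  have h := hu.2
  rw [weakDeriv, dif_pos h]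
  exact h.choose_spec

theorem IntegrableOn.intervalIntegrable_of_Ioo {a b : ℝ} (hab : a ≤ b) {g : ℝ → ℝ}
    (hg : IntegrableOn g (Ioo a b)) : IntervalIntegrable g volume a b :=
  (intervalIntegrable_iff_integrableOn_Ioo_of_le hab).2 hg

/-- The continuous representative of a `W^{1,1}` function is the primitive of its weak
derivative. -/
theorem MemW11.eq_add_integral {a b : ℝ} (hab : a < b) {u : ℝ → ℝ} (hu : MemW11 a b u)
    (hc : ContinuousOn u (Icc a b)) {x : ℝ} (hx : x ∈ Icc a b) :
    u x = u a + ∫ t in a..x, weakDeriv a b u t := by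
  obtain ⟨hgi, hgw⟩ := hu.weakDeriv_spec
  set g := weakDeriv a b u
  have hgi' := IntegrableOn.intervalIntegrable_of_Ioo hab.le hgi
  have hGac := hgi'.absolutelyContinuousOnInterval_intervalIntegral
    (c := a) (by simp)
  set G : ℝ → ℝ := fun x => ∫ t in a..x, g t with hG
  have hGc : ContinuousOn G (Icc a b) := by
    have := hGac.continuousOn
    rwa [uIcc_of_le hab.le] at this
  have hGw : IsWeakDeriv a b G g := by
    refine (hGac.isWeakDeriv_deriv hab.le).congr ?_
    rw [ae_restrict_iff' measurableSet_Ioo]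
    filter_upwards [hgi'.ae_hasDerivAt_integral] with x hx hxm
    exact (hx (by rw [uIcc_of_le hab.le]; exact Ioo_subset_Icc_self hxm) a (by simp)).deriv
  have hGi : IntegrableOn G (Ioo a b) :=
    (hGc.integrableOn_compact isCompact_Icc).mono_set Ioo_subset_Icc_self
  have hvw : IsWeakDeriv a b (fun x => u x - G x) 0 := by
    intro φ h1 h2 h3
    obtain ⟨D, hD⟩ := (h1.continuous_deriv (by simp)).bounded_above_of_compact_support
      h2.deriv
    have i1 : IntegrableOn (fun x => u x * deriv φ x) (Ioo a b) :=
      hu.1.mul_bdd (c := D) (h1.continuous_deriv (by simp)).aestronglyMeasurable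
        (Eventually.of_forall hD)
    have i2 : IntegrableOn (fun x => G x * deriv φ x) (Ioo a b) :=
      hGi.mul_bdd (c := D) (h1.continuous_deriv (by simp)).aestronglyMeasurable
        (Eventually.of_forall hD)
    simp only [sub_mul, Pi.zero_apply, zero_mul, integral_zero, neg_zero]
    rw [integral_sub i1 i2, hgw φ h1 h2 h3, hGw φ h1 h2 h3]
    ring
  obtain ⟨C, hC⟩ := IsWeakDeriv.ae_const hab (hu.1.sub hGi) hvw
  have hEq : EqOn (fun x => u x - G x) (fun _ => C) (Ioo a b) :=
    Measure.eqOn_Ioo_of_ae_eq volume hC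
      ((hc.sub hGc).mono Ioo_subset_Icc_self) continuousOn_const
  have hEq' : EqOn (fun x => u x - G x) (fun _ => C) (Icc a b) :=
    hEq.of_subset_closure (hc.sub hGc) continuousOn_const Ioo_subset_Icc_self
      (by rw [closure_Ioo hab.ne])
  have e1 : u x - G x = C := hEq' hx
  have e2 : u a - G a = C := hEq' (left_mem_Icc.2 hab.le)
  have e3 : G a = 0 := by simp [hG]
  change u x = u a + G x
  linarith

theorem MemW11.absolutelyContinuousOnInterval {a b : ℝ} (hab : a < b) {u : ℝ → ℝ}
    (hu : MemW11 a b u) (hc : ContinuousOn u (Icc a b)) :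
    AbsolutelyContinuousOnInterval u a b := by
  have h := (IntegrableOn.intervalIntegrable_of_Ioo hab.le
    hu.weakDeriv_spec.1).absolutelyContinuousOnInterval_intervalIntegral (c := a) (by simp)
  rw [absolutelyContinuousOnInterval_iff] at h ⊢
  intro ε hε
  obtain ⟨δ, hδ, H⟩ := h ε hε
  refine ⟨δ, hδ, fun E hE hl => ?_⟩
  refine lt_of_eq_of_lt ?_ (H E hE hl)
  refine Finset.sum_congr rfl fun i hi => ?_
  have := hE.1 i hi
  rw [uIcc_of_le hab.le] at this
  rw [hu.eq_add_integral hab hc this.1, hu.eq_add_integral hab hc this.2, dist_add_left]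

/-- The weak derivative agrees almost everywhere with the pointwise derivative. -/
theorem MemW11.ae_hasDerivAt {a b : ℝ} (hab : a < b) {u : ℝ → ℝ}
    (hu : MemW11 a b u) (hc : ContinuousOn u (Icc a b)) :
    ∀ᵐ x ∂(volume.restrict (Ioo a b)), HasDerivAt u (weakDeriv a b u x) x := by
  have hi := IntegrableOn.intervalIntegrable_of_Ioo hab.le hu.weakDeriv_spec.1
  rw [ae_restrict_iff' measurableSet_Ioo]
  filter_upwards [hi.ae_hasDerivAt_integral] with x hx hxm
  have h1 := hx (by rw [uIcc_of_le hab.le]; exact Ioo_subset_Icc_self hxm) a (by simp)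
  refine (h1.const_add (u a)).congr_of_eventuallyEq ?_
  filter_upwards [Ioo_mem_nhds hxm.1 hxm.2] with y hy
  exact hu.eq_add_integral hab hc (Ioo_subset_Icc_self hy)

/-- A continuous function on `[a, b]` with an integrable derivative on `(a, b)` is in
`W^{1,1}(a, b)`, and its weak derivative is the classical one. -/
theorem memW11_of_contDiffOn {a b : ℝ} (hab : a < b) {u : ℝ → ℝ}
    (hu : ContDiffOn ℝ 1 u (Icc a b)) :
    MemW11 a b u ∧ ∀ᵐ x ∂(volume.restrict (Ioo a b)), weakDeriv a b u x = deriv u x := by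
  have hac : AbsolutelyContinuousOnInterval u a b := by
    apply ContDiffOn.absolutelyContinuousOnInterval
    rwa [uIcc_of_le hab.le]
  have hw := hac.isWeakDeriv_deriv hab.le
  have hi : IntegrableOn (deriv u) (Ioo a b) :=
    (intervalIntegrable_iff_integrableOn_Ioo_of_le hab.le).1 hac.intervalIntegrable_deriv
  have hm : MemW11 a b u :=
    ⟨(hu.continuousOn.integrableOn_compact isCompact_Icc).mono_set Ioo_subset_Icc_self,
      deriv u, hi, hw⟩
  exact ⟨hm, hm.weakDeriv_spec.2.ae_eq hw hm.weakDeriv_spec.1 hi⟩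

/-! ### Change of variables along absolutely continuous functions -/

theorem AbsolutelyContinuousOnInterval.lipschitz_comp {a b K : ℝ} {u W : ℝ → ℝ} (hK : 0 ≤ K)
    (hW : ∀ x y, |W x - W y| ≤ K * |x - y|) (hu : AbsolutelyContinuousOnInterval u a b) :
    AbsolutelyContinuousOnInterval (fun x => W (u x)) a b := by
  rw [absolutelyContinuousOnInterval_iff] at hu ⊢
  intro ε hε
  -- `K + 1` instead of `K` covers `K = 0` without a case distinction.
  obtain ⟨δ, hδ, H⟩ := hu (ε / (K + 1)) (by positivity)
  refine ⟨δ, hδ, fun E hE hl => ?_⟩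
  have h1 := H E hE hl
  calc _ ≤ ∑ i ∈ Finset.range E.1, (K + 1) * dist (u (E.2 i).1) (u (E.2 i).2) := by
        refine Finset.sum_le_sum fun i _ => ?_
        rw [Real.dist_eq, Real.dist_eq]
        have := hW (u (E.2 i).1) (u (E.2 i).2)
        nlinarith [abs_nonneg (u (E.2 i).1 - u (E.2 i).2)]
    _ = (K + 1) * ∑ i ∈ Finset.range E.1, dist (u (E.2 i).1) (u (E.2 i).2) := by
        rw [Finset.mul_sum]
    _ < (K + 1) * (ε / (K + 1)) := by gcongr
    _ = ε := by field_simp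

/-- Change of variables along an absolutely continuous function. -/
theorem AbsolutelyContinuousOnInterval.integral_comp_mul_deriv {a b l L : ℝ} {u w : ℝ → ℝ}
    (hab : a ≤ b) (hlL : l ≤ L) (hu : AbsolutelyContinuousOnInterval u a b)
    (hm : ∀ x ∈ Icc a b, u x ∈ Icc l L) (hw : ContinuousOn w (Icc l L)) :
    ∫ x in a..b, w (u x) * deriv u x = ∫ y in (u a)..(u b), w y := by
  -- Extended by constants, `w` is continuous and bounded on the whole line. Its primitive is then
  -- globally Lipschitz, so composing it with `u` preserves absolute continuity.
  set v : ℝ → ℝ := IccExtend hlL ((Icc l L).domRestrict w) with hv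
  have hvc : Continuous v := (continuousOn_iff_continuous_domRestrict.1 hw).Icc_extend'
  have hvw : ∀ y ∈ Icc l L, v y = w y := fun y hy => by
    rw [hv, IccExtend_of_mem _ _ hy]; rfl
  obtain ⟨K, hK⟩ : ∃ K, ∀ y, ‖v y‖ ≤ K := by
    obtain ⟨K, hK⟩ := isCompact_Icc.exists_bound_of_continuousOn hw
    refine ⟨K, fun y => ?_⟩
    have : v y = w (projIcc l L hlL y) := rfl
    rw [this]
    exact hK _ (projIcc l L hlL y).2
  have hder : ∀ y, HasDerivAt (fun y => ∫ t in l..y, v t) (v y) y := fun y =>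
    intervalIntegral.integral_hasDerivAt_right (hvc.intervalIntegrable _ _)
      (hvc.stronglyMeasurableAtFilter _ _) hvc.continuousAt
  have hac : AbsolutelyContinuousOnInterval (fun x => ∫ t in l..(u x), v t) a b := by
    refine hu.lipschitz_comp (W := fun y => ∫ t in l..y, v t) (K := K)
      ((norm_nonneg _).trans (hK 0)) fun x y => ?_
    rw [intervalIntegral.integral_interval_sub_left (hvc.intervalIntegrable _ _)
      (hvc.intervalIntegrable _ _)]
    simpa using intervalIntegral.norm_integral_le_of_norm_le_const (a := y) (b := x)
      (fun t _ => hK t)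
  have h1 := hac.integral_deriv_eq_sub
  rw [intervalIntegral.integral_interval_sub_left (hvc.intervalIntegrable _ _)
      (hvc.intervalIntegrable _ _)] at h1
  have h2 : ∫ y in (u a)..(u b), w y = ∫ y in (u a)..(u b), v y := by
    apply intervalIntegral.integral_congr
    intro y hy
    exact (hvw y ((ordConnected_Icc.uIcc_subset (hm a (left_mem_Icc.2 hab))
      (hm b (right_mem_Icc.2 hab))) hy)).symm
  rw [h2, ← h1]
  apply intervalIntegral.integral_congr_ae
  filter_upwards [hu.ae_differentiableAt] with x hx hxm
  have hxm' : x ∈ Icc a b := by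
    rw [uIoc_of_le hab] at hxm; exact Ioc_subset_Icc_self hxm
  have hd := (hx (by rwa [uIcc_of_le hab])).hasDerivAt
  have hcomp : HasDerivAt (fun x => ∫ t in l..(u x), v t) (v (u x) * deriv u x) x :=
    (hder (u x)).comp x hd
  rw [hcomp.deriv, hvw _ (hm x hxm')]

/-! ### The calibration inequality and its equality case -/

/-- The slope function `√(f² - E²)` of the calibration with constant `E`, for the conformal factor
`f y = y + c / y`. -/
noncomputable def calSlope (c E y : ℝ) : ℝ := √((y + c / y) ^ 2 - E ^ 2)

theorem continuousOn_calSlope (c E : ℝ) : ContinuousOn (calSlope c E) (Ioi 0) := by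
  unfold calSlope
  have : ContinuousOn (fun y : ℝ => c / y) (Ioi 0) :=
    continuousOn_const.div continuousOn_id fun y hy => (ne_of_gt hy)
  fun_prop

/-- The amount by which the energy density exceeds the calibration. -/
noncomputable def defect (c E s y p : ℝ) : ℝ :=
  (y + c / y) * √(1 + p ^ 2) - E - s * (calSlope c E y * p)

/-- Cauchy-Schwarz for `(E, s w)` and `(1, p)`, where `E² + w² = f²`: the difference of the squares
of the two sides is `(E p - s w)²`. -/
theorem defect_nonneg {c E s y p : ℝ} (hE : 0 ≤ E) (hs : s ^ 2 = 1) (hf : E ≤ y + c / y) :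
    0 ≤ defect c E s y p := by
  have hw : (calSlope c E y) ^ 2 = (y + c / y) ^ 2 - E ^ 2 :=
    Real.sq_sqrt (by nlinarith)
  have hp : (√(1 + p ^ 2)) ^ 2 = 1 + p ^ 2 := Real.sq_sqrt (by positivity)
  set w := calSlope c E y
  unfold defect
  have : E + s * (w * p) ≤ (y + c / y) * √(1 + p ^ 2) := by
    apply le_of_sq_le_sq _ (mul_nonneg (hE.trans hf) (Real.sqrt_nonneg _))
    rw [mul_pow, hp]
    have : (y + c / y) ^ 2 * (1 + p ^ 2) - (E + s * (w * p)) ^ 2 = (E * p - s * w) ^ 2 := by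
      linear_combination (-(1 + p ^ 2)) * hw - (w ^ 2 * p ^ 2 + w ^ 2) * hs
    nlinarith [sq_nonneg (E * p - s * w)]
  linarith

theorem eq_of_defect_eq_zero {c E s y p : ℝ} (hE : 0 ≤ E) (hs : s ^ 2 = 1)
    (hf : E ≤ y + c / y) (h0 : defect c E s y p = 0) : E * p = s * calSlope c E y := by
  have hw : (calSlope c E y) ^ 2 = (y + c / y) ^ 2 - E ^ 2 :=
    Real.sq_sqrt (by nlinarith)
  have hp : (√(1 + p ^ 2)) ^ 2 = 1 + p ^ 2 := Real.sq_sqrt (by positivity)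
  unfold defect at h0
  set w := calSlope c E y
  have h1 : (y + c / y) * √(1 + p ^ 2) = E + s * (w * p) := by linarith
  have h2 : (y + c / y) ^ 2 * (1 + p ^ 2) = (E + s * (w * p)) ^ 2 := by
    rw [← h1, mul_pow, hp]
  have : (E * p - s * w) ^ 2 = 0 := by
    linear_combination h2 + (1 + p ^ 2) * hw + (w ^ 2 * p ^ 2 + w ^ 2) * hs
  have := pow_eq_zero_iff (two_ne_zero) |>.1 this
  linarith

theorem defect_eq_zero {c E s y p : ℝ} (hE : 0 < E) (hs : s ^ 2 = 1)
    (hf : E ≤ y + c / y) (hp : E * p = s * calSlope c E y) : defect c E s y p = 0 := by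
  have hw : (calSlope c E y) ^ 2 = (y + c / y) ^ 2 - E ^ 2 :=
    Real.sq_sqrt (by nlinarith)
  unfold defect
  generalize calSlope c E y = w at *
  generalize y + c / y = F at *
  have h1 : √(1 + p ^ 2) = F / E := by
    rw [show 1 + p ^ 2 = (F / E) ^ 2 by
      field_simp
      linear_combination (E * p + s * w) * hp + hw + w ^ 2 * hs]
    exact Real.sqrt_sq (by have := hE.trans_le hf; positivity)
  have h2 : p = s * w / E := by field_simp; linarith
  rw [h1, h2]
  field_simp
  linear_combination (-1) * hw - w ^ 2 * hs

theorem admissible.exists_bounds {h r : ℝ} (hh : 0 < h) {σ : ℝ → ℝ} (hσ : σ ∈ admissible h r) :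
    ∃ l L, 0 < l ∧ l ≤ L ∧ ∀ x ∈ Icc (-h) h, σ x ∈ Icc l L := by
  obtain ⟨-, hc, hp, -, -⟩ := hσ
  have hne : (Icc (-h) h).Nonempty := nonempty_Icc.2 (by linarith)
  obtain ⟨p, hpm, hpl⟩ := isCompact_Icc.exists_isMinOn hne hc
  obtain ⟨q, hqm, hql⟩ := isCompact_Icc.exists_isMaxOn hne hc
  exact ⟨σ p, σ q, hp p hpm, hpl hqm, fun x hx => ⟨hpl hx, hql hx⟩⟩

/-- The energy is the sum of the calibration bound and the integral of the defect. -/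
theorem energy_eq_add_integral_defect {h r c E ε x₀ : ℝ} (hh : 0 < h) {σ : ℝ → ℝ}
    (hσ : σ ∈ admissible h r) (hx₀ : x₀ ∈ Icc (-h) h) :
    IntegrableOn (fun x => defect c E (ε * if x₀ ≤ x then 1 else -1) (σ x) (weakDeriv (-h) h σ x))
      (Ioo (-h) h) ∧
    energy h c σ = 2 * h * E + 2 * ε * (∫ y in (σ x₀)..r, calSlope c E y) +
      ∫ x in Ioo (-h) h,
        defect c E (ε * if x₀ ≤ x then 1 else -1) (σ x) (weakDeriv (-h) h σ x) := by
  have hab : -h < h := by linarith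
  obtain ⟨l, L, hl, hlL, hb⟩ := admissible.exists_bounds hh hσ
  obtain ⟨hW, hc, hpos, hr1, hr2⟩ := hσ
  set g := weakDeriv (-h) h σ with hg
  have hgi := hW.weakDeriv_spec.1
  have hac := hW.absolutelyContinuousOnInterval hab hc
  have hwc : ContinuousOn (calSlope c E) (Icc l L) :=
    (continuousOn_calSlope c E).mono fun y hy => hl.trans_le hy.1
  have hwσ : ContinuousOn (fun x => calSlope c E (σ x)) (Icc (-h) h) :=
    hwc.comp hc hb
  have hfσ : ContinuousOn (fun x => σ x + c / σ x) (Icc (-h) h) :=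
    hc.add (continuousOn_const.div hc fun x hx => (hpos x hx).ne')
  -- integrability
  have i1 : IntegrableOn (fun x => (σ x + c / σ x) * √(1 + g x ^ 2)) (Ioo (-h) h) := by
    obtain ⟨K, hK⟩ := isCompact_Icc.exists_bound_of_continuousOn hfσ
    have hs : IntegrableOn (fun x => √(1 + g x ^ 2)) (Ioo (-h) h) := by
      refine Integrable.mono' (g := fun x => 1 + |g x|) ?_ ?_ ?_
      · exact (integrableOn_const (by simp)).add hgi.abs
      · exact (Real.continuous_sqrt.comp (by fun_prop : Continuous fun t : ℝ =>
          1 + t ^ 2)).comp_aestronglyMeasurable hgi.aestronglyMeasurable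
      · refine Eventually.of_forall fun x => ?_
        rw [Real.norm_eq_abs, abs_of_nonneg (Real.sqrt_nonneg _)]
        rw [Real.sqrt_le_left (by positivity)]
        nlinarith [abs_nonneg (g x), sq_abs (g x)]
    refine Integrable.bdd_mul (c := K) hs
      ((hfσ.mono Ioo_subset_Icc_self).aestronglyMeasurable measurableSet_Ioo) ?_
    rw [ae_restrict_iff' measurableSet_Ioo]
    exact Eventually.of_forall fun x hx => hK x (Ioo_subset_Icc_self hx)
  have i2 : IntegrableOn (fun x => calSlope c E (σ x) * g x) (Ioo (-h) h) := by
    obtain ⟨K, hK⟩ := isCompact_Icc.exists_bound_of_continuousOn hwσ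
    refine Integrable.bdd_mul (c := K) hgi
      ((hwσ.mono Ioo_subset_Icc_self).aestronglyMeasurable measurableSet_Ioo) ?_
    rw [ae_restrict_iff' measurableSet_Ioo]
    exact Eventually.of_forall fun x hx => hK x (Ioo_subset_Icc_self hx)
  have i3 : IntegrableOn (fun x => (ε * if x₀ ≤ x then 1 else -1) *
      (calSlope c E (σ x) * g x)) (Ioo (-h) h) := by
    refine Integrable.bdd_mul (c := |ε|) i2 ?_ ?_
    · refine Measurable.aestronglyMeasurable ?_
      exact measurable_const.mul (Measurable.ite measurableSet_Ici measurable_const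
        measurable_const)
    · refine Eventually.of_forall fun x => ?_
      rw [Real.norm_eq_abs, abs_mul]
      split_ifs <;> simp
  -- the calibration integral
  have hcal : ∀ p q, -h ≤ p → p ≤ q → q ≤ h →
      ∫ x in p..q, calSlope c E (σ x) * g x = ∫ y in (σ p)..(σ q), calSlope c E y := by
    intro p q hp hpq hq
    have hsub : Icc p q ⊆ Icc (-h) h := Icc_subset_Icc hp hq
    have hac' : AbsolutelyContinuousOnInterval σ p q := hac.mono (by
      rw [uIcc_of_le hpq, uIcc_of_le hab.le]; exact hsub)
    rw [← hac'.integral_comp_mul_deriv hpq hlL (fun x hx => hb x (hsub hx)) hwc]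
    have hae := hW.ae_hasDerivAt hab hc
    rw [ae_restrict_iff' measurableSet_Ioo] at hae
    apply intervalIntegral.integral_congr_ae
    have h1 : ∀ᵐ x : ℝ, x ≠ h := by simp [ae_iff]
    filter_upwards [hae, h1] with x hx hxh hxm
    rw [uIoc_of_le hpq] at hxm
    have hx1 : -h < x := by linarith [hxm.1]
    have hx2 : x < h := lt_of_le_of_ne (hxm.2.trans hq) hxh
    rw [(hx ⟨hx1, hx2⟩).deriv]
  have hwint : ∀ p ∈ Icc l L, ∀ q ∈ Icc l L, IntervalIntegrable (calSlope c E) volume p q :=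
    fun p hp q hq => (hwc.mono (ordConnected_Icc.uIcc_subset hp hq)).intervalIntegrable
  -- The sign change at `x₀` makes the two halves add up: since `σ (±h) = r`, each contributes `ε
  -- ∫_{σ x₀}^r`.
  have e3 : ∫ x in Ioo (-h) h, (ε * if x₀ ≤ x then 1 else -1) * (calSlope c E (σ x) * g x) =
      2 * ε * ∫ y in (σ x₀)..r, calSlope c E y := by
    have hii : ∀ {F : ℝ → ℝ}, IntegrableOn F (Ioo (-h) h) → ∀ p q, -h ≤ p → p ≤ q → q ≤ h →
        IntervalIntegrable F volume p q := fun hF p q hp hpq hq =>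
      (IntegrableOn.intervalIntegrable_of_Ioo hpq (hF.mono_set (Ioo_subset_Ioo hp hq)))
    rw [← integral_Ioc_eq_integral_Ioo, ← intervalIntegral.integral_of_le hab.le,
      ← intervalIntegral.integral_add_adjacent_intervals (b := x₀)
        (hii i3 _ _ le_rfl hx₀.1 hx₀.2) (hii i3 _ _ hx₀.1 hx₀.2 le_rfl)]
    have a1 : ∫ x in (-h)..x₀, (ε * if x₀ ≤ x then 1 else -1) * (calSlope c E (σ x) * g x) =
        ∫ x in (-h)..x₀, (-ε) * (calSlope c E (σ x) * g x) := by
      apply intervalIntegral.integral_congr_ae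
      have h1 : ∀ᵐ x : ℝ, x ≠ x₀ := by simp [ae_iff]
      filter_upwards [h1] with x hx hxm
      rw [uIoc_of_le hx₀.1] at hxm
      rw [if_neg (not_le.2 (lt_of_le_of_ne hxm.2 hx))]; ring
    have a2 : ∫ x in x₀..h, (ε * if x₀ ≤ x then 1 else -1) * (calSlope c E (σ x) * g x) =
        ∫ x in x₀..h, ε * (calSlope c E (σ x) * g x) := by
      apply intervalIntegral.integral_congr
      intro x hxm
      rw [uIcc_of_le hx₀.2] at hxm
      simp only [if_pos hxm.1]; ring
    rw [a1, a2, intervalIntegral.integral_const_mul, intervalIntegral.integral_const_mul,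
      hcal _ _ le_rfl hx₀.1 hx₀.2, hcal _ _ hx₀.1 hx₀.2 le_rfl, hr1, hr2,
      intervalIntegral.integral_symm (σ x₀) r]
    ring
  have hconst : ∫ x in Ioo (-h) h, E = 2 * h * E := by
    simp only [integral_const, MeasurableSet.univ, measureReal_restrict_apply, univ_inter,
      smul_eq_mul, Real.volume_real_Ioo_of_le hab.le]
    ring
  have iE : IntegrableOn (fun _ : ℝ => E) (Ioo (-h) h) := integrableOn_const (by simp)
  refine ⟨(i1.sub iE).sub i3, ?_⟩
  have : ∫ x in Ioo (-h) h, defect c E (ε * if x₀ ≤ x then 1 else -1) (σ x) (g x) =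
      energy h c σ - 2 * h * E - 2 * ε * ∫ y in (σ x₀)..r, calSlope c E y := by
    unfold defect
    have q1 := integral_sub (i1.sub iE) i3
    have q2 := integral_sub i1 iE
    simp only [Pi.sub_apply] at q1
    rw [q1, q2, e3, hconst]
    rfl
  rw [this]; ring

theorem sign_sq {ε x₀ : ℝ} (hε : ε ^ 2 = 1) (x : ℝ) :
    (ε * if x₀ ≤ x then (1 : ℝ) else -1) ^ 2 = 1 := by
  split_ifs <;> simp [hε]

/-- The calibration bound. -/
theorem le_energy {h r c E ε x₀ : ℝ} (hh : 0 < h) (hE : 0 ≤ E) (hε : ε ^ 2 = 1) {σ : ℝ → ℝ}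
    (hσ : σ ∈ admissible h r) (hx₀ : x₀ ∈ Icc (-h) h)
    (hf : ∀ x ∈ Icc (-h) h, E ≤ σ x + c / σ x) :
    2 * h * E + 2 * ε * (∫ y in (σ x₀)..r, calSlope c E y) ≤ energy h c σ := by
  rw [(energy_eq_add_integral_defect (E := E) (ε := ε) hh hσ hx₀).2]
  have := setIntegral_nonneg (μ := volume) measurableSet_Ioo (f := fun x => defect c E
    (ε * if x₀ ≤ x then 1 else -1) (σ x) (weakDeriv (-h) h σ x)) fun x hx =>
      defect_nonneg hE (sign_sq hε x) (hf x (Ioo_subset_Icc_self hx))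
  linarith

/-- In the equality case of the calibration bound the curve is an integral curve. -/
theorem ae_eq_of_energy_eq {h r c E ε x₀ : ℝ} (hh : 0 < h) (hE : 0 ≤ E) (hε : ε ^ 2 = 1)
    {σ : ℝ → ℝ} (hσ : σ ∈ admissible h r) (hx₀ : x₀ ∈ Icc (-h) h)
    (hf : ∀ x ∈ Icc (-h) h, E ≤ σ x + c / σ x)
    (heq : energy h c σ = 2 * h * E + 2 * ε * (∫ y in (σ x₀)..r, calSlope c E y)) :
    ∀ᵐ x ∂(volume.restrict (Ioo (-h) h)),
      E * weakDeriv (-h) h σ x = (ε * if x₀ ≤ x then 1 else -1) * calSlope c E (σ x) := by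
  obtain ⟨hi, he⟩ := energy_eq_add_integral_defect (c := c) (E := E) (ε := ε) hh hσ hx₀
  have h0 : ∫ x in Ioo (-h) h,
      defect c E (ε * if x₀ ≤ x then 1 else -1) (σ x) (weakDeriv (-h) h σ x) = 0 := by linarith
  have hnn : ∀ x ∈ Ioo (-h) h, 0 ≤
      defect c E (ε * if x₀ ≤ x then 1 else -1) (σ x) (weakDeriv (-h) h σ x) := fun x hx =>
    defect_nonneg hE (sign_sq hε x) (hf x (Ioo_subset_Icc_self hx))
  have hae := (setIntegral_eq_zero_iff_of_nonneg_ae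
    (by rw [EventuallyLE, ae_restrict_iff' measurableSet_Ioo]; exact Eventually.of_forall hnn)
      hi).1 h0
  filter_upwards [hae, ae_restrict_mem measurableSet_Ioo] with x hx hxm
  exact eq_of_defect_eq_zero hE (sign_sq hε x) (hf x (Ioo_subset_Icc_self hxm)) hx

/-- An integral curve attains the calibration bound. -/
theorem energy_eq_of_ae_eq {h r c E ε x₀ : ℝ} (hh : 0 < h) (hE : 0 < E) (hε : ε ^ 2 = 1)
    {σ : ℝ → ℝ} (hσ : σ ∈ admissible h r) (hx₀ : x₀ ∈ Icc (-h) h)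
    (hf : ∀ x ∈ Icc (-h) h, E ≤ σ x + c / σ x)
    (hae : ∀ᵐ x ∂(volume.restrict (Ioo (-h) h)),
      E * weakDeriv (-h) h σ x = (ε * if x₀ ≤ x then 1 else -1) * calSlope c E (σ x)) :
    energy h c σ = 2 * h * E + 2 * ε * (∫ y in (σ x₀)..r, calSlope c E y) := by
  rw [(energy_eq_add_integral_defect (E := E) (ε := ε) hh hσ hx₀).2, add_eq_left]
  apply integral_eq_zero_of_ae
  filter_upwards [hae, ae_restrict_mem measurableSet_Ioo] with x hx hxm
  exact defect_eq_zero hE (sign_sq hε x) (hf x (Ioo_subset_Icc_self hxm)) hx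

/-! ### Closed form and derivative of the slope integral -/

/-- An antiderivative (in `u`) of `√(u² - 2 B u + c²) / (2 u)`. -/
noncomputable def slopePrimitive (c B u : ℝ) : ℝ :=
  (√(u ^ 2 - 2 * B * u + c ^ 2) - B * Real.log (u - B + √(u ^ 2 - 2 * B * u + c ^ 2))
    - c * Real.log (c ^ 2 - B * u + c * √(u ^ 2 - 2 * B * u + c ^ 2)) + c * Real.log u) / 2

/-- Multiplied by their conjugates in `S`, the two expressions become `B² - c²` and `(B² - c²) u²`.
Nonvanishing is all that is needed, since `Real.log` is `log |·|`; this lets one formula serve both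
branches. -/
theorem slopePrimitive_log_args_ne_zero {c B u S : ℝ} (hB : c ^ 2 < B ^ 2) (hu : 0 < u)
    (hS : S ^ 2 = u ^ 2 - 2 * B * u + c ^ 2) :
    u - B + S ≠ 0 ∧ c ^ 2 - B * u + c * S ≠ 0 := by
  constructor
  · intro h0
    have : B ^ 2 - c ^ 2 = 0 := by linear_combination (u - B - S) * h0 + hS
    linarith
  · intro h0
    have : (B ^ 2 - c ^ 2) * u ^ 2 = 0 := by
      linear_combination (c ^ 2 - B * u - c * S) * h0 + c ^ 2 * hS
    have h2 : 0 < (B ^ 2 - c ^ 2) * u ^ 2 := mul_pos (by linarith) (by positivity)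
    linarith

theorem hasDerivAt_slopePrimitive_right {c B u : ℝ} (hB : c ^ 2 < B ^ 2) (hu : 0 < u)
    (hQ : 0 < u ^ 2 - 2 * B * u + c ^ 2) :
    HasDerivAt (slopePrimitive c B) (√(u ^ 2 - 2 * B * u + c ^ 2) / (2 * u)) u := by
  have hS : √(u ^ 2 - 2 * B * u + c ^ 2) ^ 2 = u ^ 2 - 2 * B * u + c ^ 2 := Real.sq_sqrt hQ.le
  have hSp : 0 < √(u ^ 2 - 2 * B * u + c ^ 2) := Real.sqrt_pos.2 hQ
  obtain ⟨n1, n2⟩ := slopePrimitive_log_args_ne_zero hB hu hS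
  have dQ : HasDerivAt (fun u => u ^ 2 - 2 * B * u + c ^ 2) (2 * u - 2 * B) u := by
    have := (((hasDerivAt_id u).pow 2).sub ((hasDerivAt_id u).const_mul (2 * B))).add_const (c ^ 2)
    refine this.congr_deriv ?_
    simp
  have dS := dQ.sqrt hQ.ne'
  have d1 := (((hasDerivAt_id u).sub_const B).add dS).log n1
  have d2 := ((((hasDerivAt_id u).const_mul B).const_sub (c ^ 2)).add (dS.const_mul c)).log n2
  have d3 := (hasDerivAt_id u).log hu.ne'
  refine ((((dS.sub (d1.const_mul B)).sub (d2.const_mul c)).add (d3.const_mul c)).div_const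
    2).congr_deriv ?_
  simp only [id, Pi.add_apply]
  generalize √(u ^ 2 - 2 * B * u + c ^ 2) = S at *
  have e1 : (1 + (2 * u - 2 * B) / (2 * S)) / (u - B + S) = 1 / S := by
    field_simp
    ring
  have e2 : (-(B * 1) + c * ((2 * u - 2 * B) / (2 * S))) / (c ^ 2 - B * u + c * S) =
      (S - c) / (u * S) := by
    rw [div_eq_div_iff n2 (by positivity)]
    field_simp
    linear_combination (-c) * hS
  rw [e1, e2]
  field_simp
  linear_combination (-1) * hS

/-- The parameter is differentiated in the closed form, because the derivative of the integrand
`√(f² - E²)` in `E` is singular at the vertex, where `f = E`. -/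
theorem hasDerivAt_slopePrimitive_left {c B u : ℝ} (hB : c ^ 2 < B ^ 2) (hu : 0 < u)
    (hQ : 0 < u ^ 2 - 2 * B * u + c ^ 2) :
    HasDerivAt (fun B => slopePrimitive c B u)
      ((-Real.log (u - B + √(u ^ 2 - 2 * B * u + c ^ 2)) - B * (B + c) / (B ^ 2 - c ^ 2)) / 2)
      B := by
  have hS : √(u ^ 2 - 2 * B * u + c ^ 2) ^ 2 = u ^ 2 - 2 * B * u + c ^ 2 := Real.sq_sqrt hQ.le
  have hSp : 0 < √(u ^ 2 - 2 * B * u + c ^ 2) := Real.sqrt_pos.2 hQ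
  obtain ⟨n1, n2⟩ := slopePrimitive_log_args_ne_zero hB hu hS
  have hA : 0 < B ^ 2 - c ^ 2 := by linarith
  have dQ : HasDerivAt (fun B => u ^ 2 - 2 * B * u + c ^ 2) (-2 * u) B := by
    have := ((((hasDerivAt_id B).const_mul 2).mul_const u).const_sub (u ^ 2)).add_const (c ^ 2)
    refine this.congr_deriv ?_
    simp
  have dS := dQ.sqrt hQ.ne'
  have d1 := (((hasDerivAt_id B).const_sub u).add dS).log n1
  have d2 := ((((hasDerivAt_id B).mul_const u).const_sub (c ^ 2)).add (dS.const_mul c)).log n2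
  refine ((((dS.sub ((hasDerivAt_id B).mul d1)).sub (d2.const_mul c)).add_const
    (c * Real.log u)).div_const 2).congr_deriv ?_
  simp only [id, Pi.add_apply]
  generalize √(u ^ 2 - 2 * B * u + c ^ 2) = S at *
  generalize Real.log (u - B + S) = l
  have e1 : (-1 + -2 * u / (2 * S)) / (u - B + S) =
      -((-B * S + B * u - c ^ 2) / (S * (B ^ 2 - c ^ 2))) := by
    rw [← neg_div, div_eq_div_iff n1 (by positivity)]
    field_simp
    linear_combination (-B) * hS
  have e2 : (-(1 * u) + c * (-2 * u / (2 * S))) / (c ^ 2 - B * u + c * S) =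
      -((-B * S - c * u + B * c) / (S * (B ^ 2 - c ^ 2))) := by
    rw [← neg_div, div_eq_div_iff n2 (by positivity)]
    field_simp
    linear_combination (-B * c) * hS
  rw [e1, e2]
  field_simp
  ring

/-- The vertical part `∫ √(f² - E²)` of the calibration bound, between `√c` and `r`. -/
noncomputable def slopeIntegral (c r E : ℝ) : ℝ := ∫ y in (√c)..r, calSlope c E y

/-- The derivative formula holds only for `2 √c < E < f r`; continuity carries the resulting
monotonicity to the closed intervals. The value `c = 0` is needed for the catenary. -/
theorem continuous_slopeIntegral {c r : ℝ} (hc : 0 ≤ c) (hr : 0 < r) :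
    Continuous (slopeIntegral c r) := by
  have hf : ContinuousOn (fun y => y + c / y) (uIcc √c r) := by
    rcases hc.eq_or_lt with rfl | hc
    · simp only [zero_div, add_zero]; exact continuousOn_id
    · refine continuousOn_id.add (continuousOn_const.div continuousOn_id fun y hy => ?_)
      have : 0 < min √c r := lt_min (Real.sqrt_pos.2 hc) hr
      exact (this.trans_le hy.1).ne'
  unfold slopeIntegral
  apply intervalIntegral.continuous_of_dominated_interval
    (bound := fun y => |y + c / y|)
  · intro E
    refine (ContinuousOn.mono ?_ uIoc_subset_uIcc).aestronglyMeasurable measurableSet_uIoc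
    unfold calSlope
    exact ((hf.pow 2).sub continuousOn_const).sqrt
  · intro E
    refine Eventually.of_forall fun y _ => ?_
    rw [Real.norm_eq_abs, calSlope, abs_of_nonneg (Real.sqrt_nonneg _), ← Real.sqrt_sq_eq_abs]
    exact Real.sqrt_le_sqrt (by nlinarith)
  · exact hf.abs.intervalIntegrable
  · refine Eventually.of_forall fun y _ => ?_
    unfold calSlope
    fun_prop

/-- With `u = y²` and `B = E² / 2 - c` the slope becomes the integrand of which `slopePrimitive` is
an antiderivative. -/
theorem calSlope_eq_div {c E y : ℝ} (hy : 0 < y) :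
    calSlope c E y =
      √((y ^ 2) ^ 2 - 2 * (E ^ 2 / 2 - c) * y ^ 2 + c ^ 2) / y := by
  rw [calSlope, show (y + c / y) ^ 2 - E ^ 2 =
    ((y ^ 2) ^ 2 - 2 * (E ^ 2 / 2 - c) * y ^ 2 + c ^ 2) / y ^ 2 by field_simp; ring]
  rw [Real.sqrt_div' _ (by positivity), Real.sqrt_sq hy.le]

theorem calSlope_eq_zero_of_between {c m n y : ℝ} (hy : 0 ≤ y) (hm : 0 < m) (hn : 0 ≤ n)
    (hmn : m * n = c) (hyc : y = 0 → c = 0) (h : (y - m) * (y - n) ≤ 0) :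
    calSlope c (m + n) y = 0 := by
  apply Real.sqrt_eq_zero_of_nonpos
  rcases hy.eq_or_lt with h0 | hy
  · rw [← h0, hyc h0.symm]
    simp
    positivity
  · have h1 : y + c / y ≤ m + n := by
      rw [← hmn]
      rw [← sub_nonpos, show y + m * n / y - (m + n) = (y - m) * (y - n) / y by field_simp; ring]
      exact div_nonpos_of_nonpos_of_nonneg h hy.le
    have h2 : 0 ≤ y + c / y := by rw [← hmn]; positivity
    nlinarith

/-- The points `m` and `n` of level `E = m + n` lie on opposite sides of `√c`, and between them `f ≤
E`, so the radicand is nonpositive and `Real.sqrt` returns `0`. Hence the slope integral may start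
at the fixed point `√c` although effectively it starts at the vertex `m`. -/
theorem calSlope_eq_zero_of_mem_uIcc {c m n y ε : ℝ} (hm : 0 < m) (hn : 0 ≤ n)
    (hmn : m * n = c) (hε : ε = 1 ∨ ε = -1) (h1 : 0 ≤ ε * (m - n)) (hy : y ∈ uIcc √c m) :
    calSlope c (m + n) y = 0 := by
  have hc : 0 ≤ c := by rw [← hmn]; positivity
  have hsc : √c ^ 2 = c := Real.sq_sqrt hc
  have hsc0 : 0 ≤ √c := Real.sqrt_nonneg c
  obtain ⟨a1, a2, a3⟩ : 0 ≤ y ∧ (y = 0 → c = 0) ∧ (y - m) * (y - n) ≤ 0 := by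
    rcases hε with rfl | rfl
    · have hnm : n ≤ m := by linarith
      have hcm : √c ≤ m := by
        rw [Real.sqrt_le_left hm.le]; nlinarith
      have hcn : n ≤ √c := by
        apply Real.le_sqrt_of_sq_le; nlinarith
      rw [uIcc_of_le hcm] at hy
      refine ⟨hsc0.trans hy.1, fun h0 => ?_, ?_⟩
      · have : √c = 0 := le_antisymm (h0 ▸ hy.1) hsc0
        rw [← hsc, this]; simp
      · exact mul_nonpos_of_nonpos_of_nonneg (by linarith [hy.2]) (by linarith [hy.1])
    · have hnm : m ≤ n := by linarith
      have hcm : m ≤ √c := by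
        apply Real.le_sqrt_of_sq_le; nlinarith
      have hcn : √c ≤ n := by
        rw [Real.sqrt_le_left hn]; nlinarith
      rw [uIcc_of_ge hcm] at hy
      refine ⟨hm.le.trans hy.1, fun h0 => ?_, ?_⟩
      · linarith [hy.1]
      · exact mul_nonpos_of_nonneg_of_nonpos (by linarith [hy.1]) (by linarith [hy.2])
  exact calSlope_eq_zero_of_between a1 hm hn hmn a2 a3

/-- Closed form of the slope integral in terms of the vertex `m`. -/
theorem slopeIntegral_eq_of_vertex {c r m n ε : ℝ} (hr : 0 < r) (hm : 0 < m) (hn : 0 ≤ n)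
    (hmn : m * n = c) (hε : ε = 1 ∨ ε = -1) (h1 : 0 < ε * (m - n)) (h2 : 0 < ε * (r - m)) :
    slopeIntegral c r (m + n) =
      slopePrimitive c ((m + n) ^ 2 / 2 - c) (r ^ 2) +
        ((m + n) ^ 2 / 2 - c + c) * (Real.log (((m + n) ^ 2 / 2 - c) ^ 2 - c ^ 2) / 2) / 2 := by
  have hc : 0 ≤ c := by rw [← hmn]; positivity
  set B := (m + n) ^ 2 / 2 - c with hBdef
  have hB : B = (m ^ 2 + n ^ 2) / 2 := by rw [hBdef, ← hmn]; ring
  have hmn2 : m ^ 2 ≠ n ^ 2 := by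
    intro h
    have : (m - n) * (m + n) = 0 := by linear_combination h
    rcases mul_eq_zero.1 this with h | h
    · rw [h] at h1; simp at h1
    · linarith
  have hBc : B ^ 2 - c ^ 2 = ((m ^ 2 - n ^ 2) / 2) ^ 2 := by rw [hB, ← hmn]; ring
  have hBc' : c ^ 2 < B ^ 2 := by
    have : 0 < ((m ^ 2 - n ^ 2) / 2) ^ 2 := by
      have := sub_ne_zero.2 hmn2
      positivity
    linarith
  have hQ : ∀ u, u ^ 2 - 2 * B * u + c ^ 2 = (u - m ^ 2) * (u - n ^ 2) := fun u => by
    rw [hB, ← hmn]; ring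
  have hz0 : ∀ y ∈ uIcc √c m, calSlope c (m + n) y = 0 := fun y hy =>
    calSlope_eq_zero_of_mem_uIcc hm hn hmn hε h1.le hy
  have hz : ∫ y in (√c)..m, calSlope c (m + n) y = 0 := by
    rw [intervalIntegral.integral_congr (g := fun _ => (0 : ℝ)) hz0]
    simp
  have hzi : IntervalIntegrable (calSlope c (m + n)) volume √c m :=
    IntervalIntegrable.congr (f := fun _ => (0 : ℝ))
      (fun y hy => (hz0 y (uIoc_subset_uIcc hy)).symm) intervalIntegrable_const
  have hpos : ∀ y ∈ uIcc m r, 0 < y := fun y hy => (lt_min hm hr).trans_le hy.1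
  have hcc : ContinuousOn (calSlope c (m + n)) (uIcc m r) :=
    (continuousOn_calSlope c _).mono hpos
  have hQpos : ∀ y ∈ Ioo (min m r) (max m r), 0 < (y ^ 2 - m ^ 2) * (y ^ 2 - n ^ 2) := by
    intro y hy
    rcases hε with rfl | rfl
    · have hmr : m ≤ r := by linarith
      rw [min_eq_left hmr, max_eq_right hmr] at hy
      have h3 : n < y := by linarith [hy.1]
      have h4 := hy.1
      exact mul_pos (by nlinarith) (by nlinarith)
    · have hmr : r ≤ m := by linarith
      rw [min_eq_right hmr, max_eq_left hmr] at hy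
      have h3 : y < n := by linarith [hy.2]
      have h4 := hy.2
      have h5 : 0 < y := hr.trans hy.1
      exact mul_pos_of_neg_of_neg (by nlinarith) (by nlinarith)
  have hQnn : ∀ y ∈ uIcc m r, 0 ≤ (y ^ 2 - m ^ 2) * (y ^ 2 - n ^ 2) := by
    intro y hy
    have hsub : uIcc m r = closure (Ioo (min m r) (max m r)) := by
      rw [closure_Ioo, uIcc]
      intro h
      rcases hε with rfl | rfl
      · rw [min_eq_left (by linarith), max_eq_right (by linarith)] at h; linarith
      · rw [min_eq_right (by linarith), max_eq_left (by linarith)] at h; linarith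
    rw [hsub] at hy
    have hcl : IsClosed {y : ℝ | 0 ≤ (y ^ 2 - m ^ 2) * (y ^ 2 - n ^ 2)} :=
      isClosed_le continuous_const (by fun_prop)
    exact closure_minimal (fun y hy => (hQpos y hy).le) hcl hy
  have hftc : ∫ y in m..r, calSlope c (m + n) y =
      slopePrimitive c B (r ^ 2) - slopePrimitive c B (m ^ 2) := by
    apply intervalIntegral.integral_eq_sub_of_hasDeriv_right
      (f := fun y => slopePrimitive c B (y ^ 2))
    · have hsq : ContinuousOn (fun y : ℝ => √((y ^ 2) ^ 2 - 2 * B * (y ^ 2) + c ^ 2))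
          (uIcc m r) := by fun_prop
      have hne : ∀ y ∈ uIcc m r, _ := fun y hy => slopePrimitive_log_args_ne_zero
        (u := y ^ 2) hBc' (pow_pos (hpos y hy) 2)
        (Real.sq_sqrt (by rw [hQ]; exact hQnn y hy))
      have hl1 : ContinuousOn (fun y : ℝ => Real.log (y ^ 2 - B +
          √((y ^ 2) ^ 2 - 2 * B * (y ^ 2) + c ^ 2))) (uIcc m r) :=
        ContinuousOn.log (by fun_prop) fun y hy => (hne y hy).1
      have hl2 : ContinuousOn (fun y : ℝ => Real.log (c ^ 2 - B * y ^ 2 +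
          c * √((y ^ 2) ^ 2 - 2 * B * (y ^ 2) + c ^ 2))) (uIcc m r) :=
        ContinuousOn.log (by fun_prop) fun y hy => (hne y hy).2
      have hl3 : ContinuousOn (fun y : ℝ => Real.log (y ^ 2)) (uIcc m r) :=
        ContinuousOn.log (by fun_prop) fun y hy => (pow_pos (hpos y hy) 2).ne'
      unfold slopePrimitive
      exact ((((hsq.sub (hl1.const_mul B)).sub (hl2.const_mul c)).add (hl3.const_mul c)).div_const
        2)
    · intro y hy
      have hyp : 0 < y := hpos y (Ioo_subset_Icc_self hy)
      have hd := hasDerivAt_slopePrimitive_right (c := c) (B := B) (u := y ^ 2) hBc'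
        (pow_pos hyp 2) (by rw [hQ]; exact hQpos y hy)
      have hcomp : HasDerivAt (fun y => slopePrimitive c B (y ^ 2)) _ y :=
        HasDerivAt.comp (h := fun y : ℝ => y ^ 2) y hd (hasDerivAt_pow 2 y)
      refine HasDerivAt.hasDerivWithinAt (hcomp.congr_deriv ?_)
      rw [calSlope_eq_div hyp, ← hBdef]
      field_simp
      norm_num
      ring
    · exact hcc.intervalIntegrable
  -- At `u = m²` the root vanishes and the logarithms reduce to `log |(m² - n²) / 2|`, up to a term
  -- `c log m²` that cancels.
  have hvert : slopePrimitive c B (m ^ 2) =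
      -((B + c) * (Real.log (B ^ 2 - c ^ 2) / 2) / 2) := by
    have e0 : √((m ^ 2) ^ 2 - 2 * B * m ^ 2 + c ^ 2) = 0 := by rw [hQ]; simp
    have e1 : m ^ 2 - B + 0 = (m ^ 2 - n ^ 2) / 2 := by rw [hB]; ring
    have e2 : c ^ 2 - B * m ^ 2 + c * 0 = -((m ^ 2 - n ^ 2) / 2 * m ^ 2) := by
      rw [hB, ← hmn]; ring
    have hne := div_ne_zero (sub_ne_zero.2 hmn2) (two_ne_zero (α := ℝ))
    rw [slopePrimitive, e0, e1, e2, hBc, Real.log_neg_eq_log, Real.log_mul hne (by positivity),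
      show Real.log (((m ^ 2 - n ^ 2) / 2) ^ 2) = 2 * Real.log ((m ^ 2 - n ^ 2) / 2) by simp]
    ring
  rw [slopeIntegral, ← intervalIntegral.integral_add_adjacent_intervals hzi
    hcc.intervalIntegrable, hz, hftc, hvert]
  ring

/-- Vertex parametrization: for `2 √c < E < f r` the level `f = E` is attained at exactly one
point strictly between `√c` and `r`. -/
theorem exists_vertex {c r E ε : ℝ} (hc : 0 ≤ c) (hr : 0 < r) (hε : ε = 1 ∨ ε = -1)
    (hεr : 0 < ε * (r - √c)) (hE : 2 * √c < E) (hEr : E < r + c / r) :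
    ∃ m n, 0 < m ∧ 0 ≤ n ∧ m * n = c ∧ m + n = E ∧ ε * (m - n) = √(E ^ 2 - 4 * c) ∧
      0 < ε * (m - n) ∧ 0 < ε * (r - m) := by
  have hsc : √c ^ 2 = c := Real.sq_sqrt hc
  have hsc0 : 0 ≤ √c := Real.sqrt_nonneg c
  have hE0 : 0 < E := by linarith
  have hD : 0 < E ^ 2 - 4 * c := by nlinarith
  have hR := Real.sq_sqrt hD.le
  have hRp := Real.sqrt_pos.2 hD
  set R := √(E ^ 2 - 4 * c)
  have hRE : R ≤ E := by apply le_of_sq_le_sq _ hE0.le; linarith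
  -- `f y = E` is the quadratic `(y - m) (y - n) = 0`, and `E < f r` places `r` outside its roots.
  -- The vertex is the larger root for `ε = 1` and the smaller one for `ε = -1`.
  have hfac : ∀ m n, m * n = c → m + n = E → 0 < (r - m) * (r - n) := by
    intro m n h1 h2
    have : (r - m) * (r - n) = r * (r + c / r - E) := by
      field_simp
      linear_combination h1 - r * h2
    rw [this]
    exact mul_pos hr (by linarith)
  rcases hε with rfl | rfl
  · have h0 : 0 < (E + R) / 2 := by linarith
    have h1 : 0 ≤ (E - R) / 2 := by linarith
    have h2 : (E + R) / 2 * ((E - R) / 2) = c := by linear_combination (-1 / 4) * hR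
    refine ⟨(E + R) / 2, (E - R) / 2, h0, h1, h2, by ring, by ring, by linarith, ?_⟩
    have h3 := hfac _ _ h2 (by ring)
    have h4 : (E - R) / 2 ≤ √c := Real.le_sqrt_of_sq_le (by nlinarith)
    have h5 : 0 < r - (E - R) / 2 := by linarith
    have := pos_of_mul_pos_left h3 h5.le
    linarith
  · have hcpos : 0 < c := by
      rcases hc.eq_or_lt with h | h
      · rw [← h] at hεr; simp at hεr; linarith
      · exact h
    have hRE' : R < E := lt_of_pow_lt_pow_left₀ 2 hE0.le (by linarith)
    have h0 : 0 < (E - R) / 2 := by linarith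
    have h1 : 0 ≤ (E + R) / 2 := by linarith
    have h2 : (E - R) / 2 * ((E + R) / 2) = c := by linear_combination (-1 / 4) * hR
    refine ⟨(E - R) / 2, (E + R) / 2, h0, h1, h2, by ring, by ring, by linarith, ?_⟩
    have h3 := hfac _ _ h2 (by ring)
    have h4 : √c ≤ (E + R) / 2 := by rw [Real.sqrt_le_left h1]; nlinarith
    have h5 : r - (E + R) / 2 < 0 := by linarith
    nlinarith

/-- The derivative of the slope integral is minus the half-width of the extremal. -/
theorem hasDerivAt_slopeIntegral {c r E ε : ℝ} (hc : 0 ≤ c) (hr : 0 < r) (hε : ε = 1 ∨ ε = -1)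
    (hεr : 0 < ε * (r - √c)) (hE : 2 * √c < E) (hEr : E < r + c / r) :
    HasDerivAt (slopeIntegral c r) (-(ε * (E / 2 *
      Real.arcosh (ε * (2 * r ^ 2 - E ^ 2 + 2 * c) / (E * √(E ^ 2 - 4 * c)))))) E := by
  have hev : slopeIntegral c r =ᶠ[𝓝 E] fun E => slopePrimitive c (E ^ 2 / 2 - c) (r ^ 2) +
        (E ^ 2 / 2 - c + c) * (Real.log ((E ^ 2 / 2 - c) ^ 2 - c ^ 2) / 2) / 2 := by
    filter_upwards [Ioo_mem_nhds hE hEr] with E' hE'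
    obtain ⟨m, n, h1, h2, h3, h4, -, h5, h6⟩ := exists_vertex hc hr hε hεr hE'.1 hE'.2
    rw [← h4]
    exact slopeIntegral_eq_of_vertex hr h1 h2 h3 hε h5 h6
  refine HasDerivAt.congr_of_eventuallyEq ?_ hev
  obtain ⟨m, n, hm, hn, hmn, hmnE, hRe, h5, h6⟩ := exists_vertex hc hr hε hεr hE hEr
  have hE0 : 0 < E := by linarith [Real.sqrt_nonneg c]
  set B := E ^ 2 / 2 - c with hBdef
  set R := √(E ^ 2 - 4 * c) with hRdef
  have hRp : 0 < R := hRe ▸ h5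
  have hB : B = (m ^ 2 + n ^ 2) / 2 := by rw [hBdef, ← hmn, ← hmnE]; ring
  have hA : 0 < E * R / 2 := by positivity
  have hAe : E * R / 2 = ε * ((m ^ 2 - n ^ 2) / 2) := by rw [← hRe, ← hmnE]; ring
  have hε2 : ε ^ 2 = 1 := by rcases hε with rfl | rfl <;> norm_num
  have hBc : B ^ 2 - c ^ 2 = (E * R / 2) ^ 2 := by
    rw [hAe, mul_pow, hε2, hB, ← hmn]; ring
  have hBc' : c ^ 2 < B ^ 2 := by
    have : 0 < (E * R / 2) ^ 2 := by positivity
    linarith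
  have hQe : (r ^ 2) ^ 2 - 2 * B * r ^ 2 + c ^ 2 = (r ^ 2 - m ^ 2) * (r ^ 2 - n ^ 2) := by
    rw [hB, ← hmn]; ring
  have hord : 0 < ε * (r ^ 2 - m ^ 2) ∧ 0 < ε * (m ^ 2 - n ^ 2) := by
    constructor
    · have : ε * (r ^ 2 - m ^ 2) = ε * (r - m) * (r + m) := by ring
      rw [this]; positivity
    · have : ε * (m ^ 2 - n ^ 2) = ε * (m - n) * (m + n) := by ring
      rw [this]; positivity
  have hQ : 0 < (r ^ 2) ^ 2 - 2 * B * r ^ 2 + c ^ 2 := by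
    rw [hQe]
    have : (r ^ 2 - m ^ 2) * (r ^ 2 - n ^ 2) =
        (ε * (r ^ 2 - m ^ 2)) * (ε * (r ^ 2 - m ^ 2) + ε * (m ^ 2 - n ^ 2)) := by
      linear_combination (-(r ^ 2 - m ^ 2) * (r ^ 2 - n ^ 2)) * hε2
    rw [this]
    exact mul_pos hord.1 (by linarith [hord.1, hord.2])
  have dB : HasDerivAt (fun E : ℝ => E ^ 2 / 2 - c) E E := by
    refine (((hasDerivAt_id E).pow 2).div_const 2).sub_const c |>.congr_deriv ?_
    simp
  have d1 := (hasDerivAt_slopePrimitive_left (c := c) (B := B) (u := r ^ 2) hBc' (by positivity)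
    hQ).comp E dB
  have dlog : HasDerivAt (fun B : ℝ => (B + c) * (Real.log (B ^ 2 - c ^ 2) / 2) / 2)
      ((Real.log (B ^ 2 - c ^ 2) / 2 + B * (B + c) / (B ^ 2 - c ^ 2)) / 2) B := by
    have q1 : HasDerivAt (fun B : ℝ => B ^ 2 - c ^ 2) (2 * B) B := by
      refine (((hasDerivAt_id B).pow 2).sub_const (c ^ 2)).congr_deriv ?_
      simp
    have q2 := q1.log (by linarith : B ^ 2 - c ^ 2 ≠ 0)
    refine ((((hasDerivAt_id B).add_const c).mul (q2.div_const 2)).div_const 2).congr_deriv ?_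
    have : B ^ 2 - c ^ 2 ≠ 0 := by linarith
    simp only [id]
    field_simp
  have d2 := dlog.comp E dB
  refine (d1.add d2).congr_deriv ?_
  have hS := Real.sq_sqrt hQ.le
  have hSp := Real.sqrt_pos.2 hQ
  set S := √((r ^ 2) ^ 2 - 2 * B * r ^ 2 + c ^ 2)
  set q := ε * (2 * r ^ 2 - E ^ 2 + 2 * c) / (E * R) with hq
  have hqe : q = ε * (r ^ 2 - B) / (E * R / 2) := by
    rw [hq, hBdef]; field_simp; ring
  have hqs : √(q ^ 2 - 1) = S / (E * R / 2) := by
    rw [show q ^ 2 - 1 = (S / (E * R / 2)) ^ 2 by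
      rw [hqe, div_pow, div_pow _ (E * R / 2), hS, mul_pow, hε2, eq_div_iff (by positivity),
        sub_mul, div_mul_cancel₀ _ (by positivity), ← hBc]
      ring]
    exact Real.sqrt_sq (by positivity)
  have hlogA : Real.log (B ^ 2 - c ^ 2) / 2 = Real.log (E * R / 2) := by
    rw [hBc, Real.log_pow]; push_cast; ring
  -- The rational terms of `d1` and `d2` cancel, and only a difference of logarithms is left, which
  -- is an `arcosh`. For `ε = -1` the argument of the logarithm is the negative of the conjugate,
  -- whence the sign.
  have key : Real.log (r ^ 2 - B + S) = Real.log (E * R / 2) + ε * Real.arcosh q := by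
    have hposq : 0 < ε * (r ^ 2 - B) := by
      have : ε * (r ^ 2 - B) = ε * (r ^ 2 - m ^ 2) + ε * (m ^ 2 - n ^ 2) / 2 := by rw [hB]; ring
      rw [this]; linarith [hord.1, hord.2]
    have hX : ε * (r ^ 2 - B) + S ≠ 0 := by positivity
    rw [Real.arcosh, hqs, hqe, ← add_div, Real.log_div hX hA.ne']
    rcases hε with rfl | rfl
    · simp only [one_mul]; ring
    · have h1 : Real.log (-1 * (r ^ 2 - B) + S) + Real.log (-1 * (r ^ 2 - B) - S) =
          2 * Real.log (E * R / 2) := by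
        rw [← Real.log_mul]
        · rw [show (-1 * (r ^ 2 - B) + S) * (-1 * (r ^ 2 - B) - S) = (E * R / 2) ^ 2 by
            rw [← hBc]; linear_combination (-1) * hS, Real.log_pow]
          push_cast; ring
        · have : 0 < -1 * (r ^ 2 - B) + S := by linarith
          exact this.ne'
        · have := (slopePrimitive_log_args_ne_zero (u := r ^ 2) hBc' (by positivity) hS).1
          intro h0; apply this; linarith
      have h2 : Real.log (r ^ 2 - B + S) = Real.log (-1 * (r ^ 2 - B) - S) := by
        rw [← Real.log_neg_eq_log]; congr 1; ring
      rw [h2]; linarith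
  rw [key, hlogA]
  ring

/-! ### Hyperbolic inequalities -/

theorem Real.cosh_two_mul_eq (x : ℝ) : Real.cosh (2 * x) = 2 * Real.cosh x ^ 2 - 1 := by
  rw [Real.cosh_two_mul, Real.sinh_sq]; ring

theorem Real.cosh_eq_one_add_two_mul_sinh_sq (x : ℝ) :
    Real.cosh x = 1 + 2 * Real.sinh (x / 2) ^ 2 := by
  have := Real.cosh_two_mul_eq (x / 2)
  rw [show 2 * (x / 2) = x by ring, Real.cosh_sq] at this
  rw [this]; ring

theorem Real.one_add_sq_div_two_le_cosh {x : ℝ} (hx : 0 ≤ x) : 1 + x ^ 2 / 2 ≤ Real.cosh x := by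
  rw [Real.cosh_eq_one_add_two_mul_sinh_sq]
  have h := Real.self_le_sinh_iff.2 (by linarith : 0 ≤ x / 2)
  nlinarith

theorem Real.sinh_lt_mul_cosh {s : ℝ} (hs : 0 < s) : Real.sinh s < s * Real.cosh s := by
  have hmono : StrictMonoOn (fun s => s * Real.cosh s - Real.sinh s) (Ici 0) := by
    apply strictMonoOn_of_deriv_pos (convex_Ici 0)
    · exact ((continuous_id.mul Real.continuous_cosh).sub Real.continuous_sinh).continuousOn
    · intro x hx
      rw [interior_Ici] at hx
      have hd : HasDerivAt (fun s => s * Real.cosh s - Real.sinh s)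
          (1 * Real.cosh x + x * Real.sinh x - Real.cosh x) x :=
        ((hasDerivAt_id x).mul (Real.hasDerivAt_cosh x)).sub (Real.hasDerivAt_sinh x)
      rw [hd.deriv]
      have : 0 < x * Real.sinh x := mul_pos hx (Real.sinh_pos_iff.2 hx)
      linarith
  have := hmono (self_mem_Ici) (mem_Ici.2 hs.le) hs
  simpa using this

/-- `s ↦ s coth s` is increasing. -/
theorem Real.monotoneOn_mul_cosh_div_sinh :
    MonotoneOn (fun s => s * Real.cosh s / Real.sinh s) (Ioi 0) := by
  have hd : ∀ x ∈ Ioi (0 : ℝ), HasDerivAt (fun s => s * Real.cosh s / Real.sinh s)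
      (((1 * Real.cosh x + x * Real.sinh x) * Real.sinh x - x * Real.cosh x * Real.cosh x) /
        Real.sinh x ^ 2) x := fun x hx =>
    ((hasDerivAt_id x).mul (Real.hasDerivAt_cosh x)).div (Real.hasDerivAt_sinh x)
      (Real.sinh_pos_iff.2 hx).ne'
  apply monotoneOn_of_deriv_nonneg (convex_Ioi 0)
  · exact fun x hx => (hd x hx).continuousAt.continuousWithinAt
  · rw [interior_Ioi]
    exact fun x hx => (hd x hx).differentiableAt.differentiableWithinAt
  · rw [interior_Ioi]
    intro x hx
    rw [(hd x hx).deriv]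
    apply div_nonneg _ (sq_nonneg _)
    -- The numerator equals `sinh x cosh x - x`.
    have h1 := Real.cosh_sq x
    have h2 := Real.self_le_sinh_iff.2 (le_of_lt (mem_Ioi.1 hx))
    have h3 := Real.one_le_cosh x
    have h4 : 0 < x := hx
    nlinarith

/-- The quotient `sinh (a z) / sinh (b z)` is nondecreasing: the numerator of its derivative
vanishes at `0` and has derivative `(a² - b²) sinh (a z) sinh (b z)`. Both comparisons of cosines
below come from this. -/
theorem Real.sinh_mul_sinh_le {a b x y : ℝ} (hb : 0 ≤ b) (hab : b ≤ a) (hx : 0 ≤ x)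
    (hxy : x ≤ y) :
    Real.sinh (a * x) * Real.sinh (b * y) ≤ Real.sinh (a * y) * Real.sinh (b * x) := by
  rcases hb.eq_or_lt with rfl | hb
  · simp
  rcases hx.eq_or_lt with rfl | hx
  · simp
  have ha : 0 < a := hb.trans_le hab
  have hder : ∀ (k : ℝ) (x : ℝ), HasDerivAt (fun x => Real.sinh (k * x)) (Real.cosh (k * x) * k) x :=
    fun k x => by
      have := (Real.hasDerivAt_sinh (k * x)).comp x ((hasDerivAt_id x).const_mul k)
      simpa using! this
  have hderc : ∀ (k : ℝ) (x : ℝ), HasDerivAt (fun x => Real.cosh (k * x)) (Real.sinh (k * x) * k) x :=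
    fun k x => by
      have := (Real.hasDerivAt_cosh (k * x)).comp x ((hasDerivAt_id x).const_mul k)
      simpa using! this
  have hsp : ∀ {k x : ℝ}, 0 < k → 0 < x → 0 < Real.sinh (k * x) := fun hk hx =>
    Real.sinh_pos_iff.2 (mul_pos hk hx)
  have hM : ∀ z, 0 ≤ z → 0 ≤ a * Real.cosh (a * z) * Real.sinh (b * z) -
      b * Real.sinh (a * z) * Real.cosh (b * z) := by
    have hm : MonotoneOn (fun z => a * Real.cosh (a * z) * Real.sinh (b * z) -
        b * Real.sinh (a * z) * Real.cosh (b * z)) (Ici 0) := by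
      have hd : ∀ z, HasDerivAt (fun z => a * Real.cosh (a * z) * Real.sinh (b * z) -
        b * Real.sinh (a * z) * Real.cosh (b * z)) ((a ^ 2 - b ^ 2) *
          (Real.sinh (a * z) * Real.sinh (b * z))) z := fun z => by
        refine ((((hderc a z).const_mul a).mul (hder b z)).sub
          (((hder a z).const_mul b).mul (hderc b z))).congr_deriv ?_
        ring
      apply monotoneOn_of_deriv_nonneg (convex_Ici 0)
      · exact fun z _ => (hd z).continuousAt.continuousWithinAt
      · exact fun z _ => (hd z).differentiableAt.differentiableWithinAt
      · rw [interior_Ici]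
        intro z hz
        rw [(hd z).deriv]
        exact mul_nonneg (by nlinarith) (mul_pos (hsp ha hz) (hsp hb hz)).le
    intro z hz
    have := hm self_mem_Ici (mem_Ici.2 hz) hz
    simpa using this
  have hq : MonotoneOn (fun z => Real.sinh (a * z) / Real.sinh (b * z)) (Ioi 0) := by
    have hd : ∀ z ∈ Ioi (0 : ℝ), HasDerivAt (fun z => Real.sinh (a * z) / Real.sinh (b * z))
        ((Real.cosh (a * z) * a * Real.sinh (b * z) - Real.sinh (a * z) * (Real.cosh (b * z) * b)) /
          Real.sinh (b * z) ^ 2) z := fun z hz => (hder a z).div (hder b z) (hsp hb hz).ne'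
    apply monotoneOn_of_deriv_nonneg (convex_Ioi 0)
    · exact fun z hz => (hd z hz).continuousAt.continuousWithinAt
    · rw [interior_Ioi]
      exact fun z hz => (hd z hz).differentiableAt.differentiableWithinAt
    · rw [interior_Ioi]
      intro z hz
      rw [(hd z hz).deriv]
      refine div_nonneg ?_ (sq_nonneg _)
      have := hM z (le_of_lt hz)
      linarith
  have := hq (mem_Ioi.2 hx) (mem_Ioi.2 (hx.trans_le hxy)) hxy
  have h1 := hsp hb hx
  have h2 := hsp hb (hx.trans_le hxy)
  simp only at this
  rwa [div_le_div_iff₀ h1 h2] at this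

/-- Comparison of `cosh (d h) - cosh (d x)` for two frequencies, normalized at the origin. -/
theorem Real.cosh_sub_cosh_comparison_origin {d₁ d₂ h x : ℝ} (hd₂ : 0 ≤ d₂) (hd : d₂ ≤ d₁)
    (hx : 0 ≤ x) (hxh : x ≤ h) :
    (Real.cosh (d₂ * h) - Real.cosh (d₂ * x)) * (Real.cosh (d₁ * h) - 1) ≤
      (Real.cosh (d₁ * h) - Real.cosh (d₁ * x)) * (Real.cosh (d₂ * h) - 1) := by
  -- Since `cosh y = 1 + 2 sinh² (y / 2)`, the claim is the square of this inequality at half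
  -- arguments, after cancellation of the common terms.
  have key := Real.sinh_mul_sinh_le (a := d₁) (b := d₂) (x := x / 2) (y := h / 2) hd₂ hd
    (by linarith) (by linarith)
  have h0 : 0 ≤ Real.sinh (d₁ * (x / 2)) * Real.sinh (d₂ * (h / 2)) := by
    apply mul_nonneg <;> rw [Real.sinh_nonneg_iff] <;>
    first | exact mul_nonneg (hd₂.trans hd) (by linarith) | exact mul_nonneg hd₂ (by linarith)
  have hsq := pow_le_pow_left₀ h0 key 2
  rw [Real.cosh_eq_one_add_two_mul_sinh_sq (d₁ * h), Real.cosh_eq_one_add_two_mul_sinh_sq (d₂ * h),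
    Real.cosh_eq_one_add_two_mul_sinh_sq (d₁ * x), Real.cosh_eq_one_add_two_mul_sinh_sq (d₂ * x),
    mul_div_assoc, mul_div_assoc, mul_div_assoc, mul_div_assoc]
  rw [mul_pow, mul_pow] at hsq
  nlinarith

/-- Comparison of `cosh (d h) - cosh (d x)` for two frequencies, normalized at `h`. -/
theorem Real.cosh_sub_cosh_comparison_end {d₁ d₂ h x : ℝ} (hd₂ : 0 ≤ d₂) (hd : d₂ ≤ d₁)
    (hx : 0 ≤ x) (hxh : x ≤ h) :
    (Real.cosh (d₁ * h) - Real.cosh (d₁ * x)) * (d₂ * Real.sinh (d₂ * h)) ≤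
      (Real.cosh (d₂ * h) - Real.cosh (d₂ * x)) * (d₁ * Real.sinh (d₁ * h)) := by
  -- The difference of the two sides vanishes at `x = h` and decreases in `x`, so it is nonnegative
  -- before `h`.
  set D : ℝ → ℝ := fun x => (Real.cosh (d₂ * h) - Real.cosh (d₂ * x)) * (d₁ * Real.sinh (d₁ * h)) -
    (Real.cosh (d₁ * h) - Real.cosh (d₁ * x)) * (d₂ * Real.sinh (d₂ * h)) with hD
  have hderc : ∀ (k : ℝ) (x : ℝ), HasDerivAt (fun x => Real.cosh (k * x)) (Real.sinh (k * x) * k) x :=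
    fun k x => by
      have := (Real.hasDerivAt_cosh (k * x)).comp x ((hasDerivAt_id x).const_mul k)
      simpa using! this
  have hd' : ∀ z, HasDerivAt D (d₁ * d₂ * (Real.sinh (d₁ * z) * Real.sinh (d₂ * h) -
      Real.sinh (d₁ * h) * Real.sinh (d₂ * z))) z := fun z => by
    refine ((((hderc d₂ z).const_sub _).mul_const _).sub
      (((hderc d₁ z).const_sub _).mul_const _)).congr_deriv ?_
    ring
  have hanti : AntitoneOn D (Icc 0 h) := by
    apply antitoneOn_of_deriv_nonpos (convex_Icc 0 h)
    · exact fun z _ => (hd' z).continuousAt.continuousWithinAt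
    · exact fun z _ => (hd' z).differentiableAt.differentiableWithinAt
    · rw [interior_Icc]
      intro z hz
      rw [(hd' z).deriv]
      have := Real.sinh_mul_sinh_le hd₂ hd hz.1.le hz.2.le
      exact mul_nonpos_of_nonneg_of_nonpos (mul_nonneg (hd₂.trans hd) hd₂) (by linarith)
  have := hanti ⟨hx, hxh⟩ ⟨hx.trans hxh, le_rfl⟩ hxh
  simp only [hD, sub_self, zero_mul] at this
  linarith

/-! ### The threshold `ω` -/

theorem inv_xiConst_spec : 0 < 1 / xiConst ∧
    2 * (1 / xiConst) = 1 + Real.exp (-(2 * (1 / xiConst))) := by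
  obtain ⟨h0, h1⟩ := existsUnique_xi.choose_spec.1
  have hp : 0 < 1 / xiConst := one_div_pos.2 h0
  refine ⟨hp, (xi_equation_iff _ hp).1 ?_⟩
  simp only [one_div_one_div]
  exact h1

theorem omegaConst_eq : omegaConst = (1 / xiConst) / Real.cosh (1 / xiConst) := by
  rw [omegaConst, ← div_div]

theorem inv_xiConst_lt_one : 1 / xiConst < 1 := by
  obtain ⟨h0, h1⟩ := inv_xiConst_spec
  have : Real.exp (-(2 * (1 / xiConst))) < 1 := by
    rw [Real.exp_lt_one_iff]; linarith
  linarith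

/-- `t ≤ 1/Ξ` is equivalent to the stability inequality used for catenaries. -/
theorem add_sinh_mul_cosh_le_cosh_sq {t : ℝ} (ht : t ≤ 1 / xiConst) :
    t + Real.sinh t * Real.cosh t ≤ Real.cosh t ^ 2 := by
  obtain ⟨h0, h1⟩ := inv_xiConst_spec
  have h2 : Real.exp (-(2 * (1 / xiConst))) ≤ Real.exp (-(2 * t)) :=
    Real.exp_le_exp.2 (by linarith)
  have h3 : Real.exp (-(2 * t)) = Real.exp (-t) * Real.exp (-t) := by
    rw [← Real.exp_add]; congr 1; ring
  have h4 : Real.exp t * Real.exp (-t) = 1 := by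
    rw [← Real.exp_add]; simp
  have key : Real.cosh t * Real.cosh t - Real.sinh t * Real.cosh t
      = (1 + Real.exp (-(2 * t))) / 2 := by
    rw [Real.cosh_eq, Real.sinh_eq, h3]
    linear_combination (1 / 2) * h4
  nlinarith

/-! ### The two catenaries -/

theorem strictConvexOn_cosh_sub_mul (k : ℝ) :
    StrictConvexOn ℝ univ (fun t => Real.cosh t - k * t) := by
  apply strictConvexOn_univ_of_deriv2_pos
  · fun_prop
  · intro x
    have h1 : deriv (fun t => Real.cosh t - k * t) = fun t => Real.sinh t - k := by
      ext t
      have := (Real.hasDerivAt_cosh t).sub ((hasDerivAt_id t).const_mul k)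
      simpa using! this.deriv
    rw [Function.iterate_succ, Function.iterate_one, Function.comp, h1]
    have := (Real.hasDerivAt_sinh x).sub_const k
    rw [this.deriv]
    exact Real.cosh_pos x

theorem StrictConvexOn.lt_max_of_between {f : ℝ → ℝ} (hf : StrictConvexOn ℝ univ f) {a b c : ℝ}
    (hab : a < b) (hbc : b < c) : f b < max (f a) (f c) := by
  refine hf.lt_on_openSegment (mem_univ a) (mem_univ c) (hab.trans hbc).ne ?_
  rw [openSegment_eq_Ioo (hab.trans hbc)]
  exact ⟨hab, hbc⟩

/-- With `t = h / P` and `k = r / h` the catenary equation reads `cosh t = k t`. The hypothesis says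
that `cosh t ≤ k t` at `t = 1 / Ξ`, which puts the smaller root to the left of `1 / Ξ`; the
stability of the catenary depends on this location. -/
theorem exists_catenary_roots {k : ℝ} (hk : 1 / k ≤ omegaConst) (hk0 : 0 < k) :
    ∃ t₀ t₁, 0 < t₀ ∧ t₀ ≤ 1 / xiConst ∧ t₀ < t₁ ∧ Real.cosh t₀ - k * t₀ = 0 ∧
      Real.cosh t₁ - k * t₁ = 0 := by
  obtain ⟨hξ0, -⟩ := inv_xiConst_spec
  have hξ1 := inv_xiConst_lt_one
  set ξ := 1 / xiConst with hξ
  have hcξ := Real.cosh_pos ξ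
  have hkξ : Real.cosh ξ - k * ξ ≤ 0 := by
    rw [omegaConst_eq, div_le_div_iff₀ hk0 hcξ] at hk
    linarith
  have hcont : Continuous (fun t => Real.cosh t - k * t) := by fun_prop
  -- On `[0, 1]` the function `cosh t - t cosh 1` decreases to `0`, so `ξ cosh 1 < cosh ξ ≤ k ξ`.
  have hk1 : Real.cosh 1 - k * 1 < 0 := by
    have hanti : StrictAntiOn (fun t => Real.cosh t - t * Real.cosh 1) (Icc 0 1) := by
      apply strictAntiOn_of_deriv_neg (convex_Icc 0 1)
      · fun_prop
      · rw [interior_Icc]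
        intro x hx
        have hd : HasDerivAt (fun t => Real.cosh t - t * Real.cosh 1)
            (Real.sinh x - 1 * Real.cosh 1) x :=
          (Real.hasDerivAt_cosh x).sub ((hasDerivAt_id x).mul_const _)
        rw [hd.deriv]
        have h1 := Real.sinh_lt_sinh.2 hx.2
        have h2 := Real.sinh_lt_cosh 1
        linarith
    have := hanti ⟨hξ0.le, hξ1.le⟩ ⟨zero_le_one, le_rfl⟩ hξ1
    simp only [one_mul, sub_self] at this
    have : ξ * Real.cosh 1 < ξ * k := by linarith
    have := lt_of_mul_lt_mul_left this hξ0.le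
    linarith
  have hk1' : 1 < k := by linarith [Real.one_le_cosh 1]
  obtain ⟨t₀, ht₀, e₀⟩ := intermediate_value_Icc' hξ0.le hcont.continuousOn
    (show (0 : ℝ) ∈ Icc (Real.cosh ξ - k * ξ) (Real.cosh 0 - k * 0) from ⟨hkξ, by simp⟩)
  -- The endpoint `2 k` is large enough because `cosh (2 k) ≥ 1 + 2 k²`.
  have hT : 0 ≤ Real.cosh (2 * k) - k * (2 * k) := by
    have := Real.one_add_sq_div_two_le_cosh (by linarith : 0 ≤ 2 * k)
    nlinarith
  obtain ⟨t₁, ht₁, e₁⟩ := intermediate_value_Icc (by linarith : (1 : ℝ) ≤ 2 * k)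
    hcont.continuousOn (show (0 : ℝ) ∈ Icc (Real.cosh 1 - k * 1) (Real.cosh (2 * k) - k * (2 * k))
      from ⟨hk1.le, hT⟩)
  simp only at e₀ e₁
  refine ⟨t₀, t₁, lt_of_le_of_ne ht₀.1 ?_, ht₀.2, by linarith [ht₀.2, ht₁.1], e₀, e₁⟩
  rintro rfl
  simp at e₀

/-- The stable catenary parameter `P₀`, the unstable one `P₁`, and the properties used below. -/
theorem exists_catenaries {h r : ℝ} (hh : 0 < h) (hr : 0 < r) (hω : h / r ≤ omegaConst) :
    ∃ P₀ P₁ : ℝ, 0 < P₁ ∧ P₁ < P₀ ∧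
      (∀ P : ℝ, 0 < P → (r = P * Real.cosh (h / P) ↔ P = P₀ ∨ P = P₁)) ∧
      h / P₀ ≤ 1 / xiConst ∧ (∀ P, P₁ < P → P < P₀ → P * Real.cosh (h / P) < r) ∧
      (∀ P, 0 < P → P < P₁ → r < P * Real.cosh (h / P)) := by
  have hk : 0 < r / h := by positivity
  obtain ⟨t₀, t₁, h0, hξ, h01, e0, e1⟩ := exists_catenary_roots (k := r / h)
    (by rwa [one_div_div]) hk
  have hcv := strictConvexOn_cosh_sub_mul (r / h)
  have h1 : 0 < t₁ := h0.trans h01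
  have hrel : ∀ P : ℝ, 0 < P → P * Real.cosh (h / P) - r =
      P * (Real.cosh (h / P) - r / h * (h / P)) := fun P hP => by field_simp
  refine ⟨h / t₀, h / t₁, by positivity, by gcongr, ?_, by rwa [div_div_cancel₀ hh.ne'], ?_, ?_⟩
  · intro P hP
    have hiff : r = P * Real.cosh (h / P) ↔ Real.cosh (h / P) - r / h * (h / P) = 0 := by
      have := hrel P hP
      constructor
      · intro h'
        have h2 : P * (Real.cosh (h / P) - r / h * (h / P)) = 0 := by linarith
        exact (mul_eq_zero.1 h2).resolve_left hP.ne'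
      · intro h'; rw [h'] at this; linarith
    have hinv : ∀ t, 0 < t → (P = h / t ↔ h / P = t) := fun t ht => by
      rw [eq_div_iff ht.ne', div_eq_iff hP.ne', mul_comm, eq_comm]
    rw [hiff, hinv t₀ h0, hinv t₁ h1]
    constructor
    · intro h2
      by_contra hn
      push Not at hn
      obtain ⟨n0, n1⟩ := hn
      set t := h / P
      rcases lt_or_gt_of_ne n0 with hl | hl
      · have := hcv.lt_max_of_between hl h01
        simp only [h2, e0, e1, max_self, lt_irrefl] at this
      · rcases lt_or_gt_of_ne n1 with hl' | hl'
        · have := hcv.lt_max_of_between hl hl'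
          simp only [h2, e0, e1, max_self, lt_irrefl] at this
        · have := hcv.lt_max_of_between h01 hl'
          simp only [h2, e0, e1, max_self, lt_irrefl] at this
    · rintro (h' | h') <;> rw [h'] <;> assumption
  · intro P hP1 hP0
    have hP : 0 < P := lt_trans (by positivity) hP1
    have a1 : t₀ < h / P := by rwa [lt_div_comm₀ h0 hP]
    have a2 : h / P < t₁ := by rwa [div_lt_comm₀ hP h1]
    have := hcv.lt_max_of_between a1 a2
    simp only [e0, e1, max_self] at this
    have h3 := hrel P hP
    nlinarith
  · intro P hP hP1
    have a2 : t₁ < h / P := by rwa [lt_div_comm₀ h1 hP]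
    have := hcv.lt_max_of_between h01 a2
    simp only [e0, e1, lt_max_iff, lt_irrefl, false_or] at this
    have h3 := hrel P hP
    nlinarith

/-! ### The calibration bound as a function of the level -/

/-- The calibration bound `2 h E + 2 |∫_{√c}^r √(f² - E²)|` as a function of the constant `E`;
`ε = 1` if `√c < r` and `ε = -1` if `r < √c`. -/
noncomputable def energyBound (h r c ε E : ℝ) : ℝ := 2 * h * E + 2 * ε * slopeIntegral c r E

theorem continuous_energyBound {h r c ε : ℝ} (hc : 0 ≤ c) (hr : 0 < r) :
    Continuous (energyBound h r c ε) :=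
  (continuous_const.mul continuous_id).add
    (continuous_const.mul (continuous_slopeIntegral hc hr))

theorem hasDerivAt_energyBound {h c r E ε : ℝ} (hc : 0 ≤ c) (hr : 0 < r) (hε : ε = 1 ∨ ε = -1)
    (hεr : 0 < ε * (r - √c)) (hE : 2 * √c < E) (hEr : E < r + c / r) :
    HasDerivAt (energyBound h r c ε) (2 * h - E *
      Real.arcosh (ε * (2 * r ^ 2 - E ^ 2 + 2 * c) / (E * √(E ^ 2 - 4 * c)))) E := by
  have hε2 : ε ^ 2 = 1 := by rcases hε with rfl | rfl <;> norm_num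
  refine (((hasDerivAt_id E).const_mul (2 * h)).add
    ((hasDerivAt_slopeIntegral hc hr hε hεr hE hEr).const_mul (2 * ε))).congr_deriv ?_
  linear_combination (-(E * Real.arcosh (ε * (2 * r ^ 2 - E ^ 2 + 2 * c) /
    (E * √(E ^ 2 - 4 * c))))) * hε2

theorem sqrt_sq_sub_pos {c E : ℝ} (hc : 0 ≤ c) (hE : 2 * √c < E) :
    0 < E ∧ 0 < √(E ^ 2 - 4 * c) ∧ 4 * c < E ^ 2 := by
  have hsc : √c ^ 2 = c := Real.sq_sqrt hc
  have hsc0 : 0 ≤ √c := Real.sqrt_nonneg c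
  have : 4 * c < E ^ 2 := by nlinarith
  exact ⟨by linarith, Real.sqrt_pos.2 (by linarith), this⟩

/-- Since `arcosh` is increasing, the derivative is negative where the width of the extremal exceeds
`2 h`, that is, where `cosh (2h/E)` falls short of the right-hand side of the boundary equation. -/
theorem deriv_energyBound_neg {h c r E ε : ℝ} (hh : 0 < h) (hc : 0 ≤ c) (hr : 0 < r)
    (hε : ε = 1 ∨ ε = -1)
    (hεr : 0 < ε * (r - √c)) (hE : 2 * √c < E) (hEr : E < r + c / r)
    (hψ : E * √(E ^ 2 - 4 * c) * Real.cosh (2 * h / E) < ε * (2 * r ^ 2 - E ^ 2 + 2 * c)) :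
    deriv (energyBound h r c ε) E < 0 := by
  obtain ⟨hE0, hR, -⟩ := sqrt_sq_sub_pos hc hE
  rw [(hasDerivAt_energyBound hc hr hε hεr hE hEr).deriv]
  have hq : Real.cosh (2 * h / E) <
      ε * (2 * r ^ 2 - E ^ 2 + 2 * c) / (E * √(E ^ 2 - 4 * c)) := by
    rw [lt_div_iff₀ (by positivity)]; linarith
  have h1 := (Real.arcosh_lt_arcosh (Real.cosh_pos _) ((Real.cosh_pos _).trans hq)).2 hq
  rw [Real.arcosh_cosh (by positivity), div_lt_iff₀ hE0] at h1
  linarith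

theorem deriv_energyBound_pos {h c r E ε : ℝ} (hh : 0 < h) (hc : 0 ≤ c) (hr : 0 < r)
    (hε : ε = 1 ∨ ε = -1)
    (hεr : 0 < ε * (r - √c)) (hE : 2 * √c < E) (hEr : E < r + c / r)
    (hpos : 0 < ε * (2 * r ^ 2 - E ^ 2 + 2 * c))
    (hψ : ε * (2 * r ^ 2 - E ^ 2 + 2 * c) < E * √(E ^ 2 - 4 * c) * Real.cosh (2 * h / E)) :
    0 < deriv (energyBound h r c ε) E := by
  obtain ⟨hE0, hR, -⟩ := sqrt_sq_sub_pos hc hE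
  rw [(hasDerivAt_energyBound hc hr hε hεr hE hEr).deriv]
  have hq : ε * (2 * r ^ 2 - E ^ 2 + 2 * c) / (E * √(E ^ 2 - 4 * c)) <
      Real.cosh (2 * h / E) := by
    rw [div_lt_iff₀ (by positivity)]; linarith
  have h1 := (Real.arcosh_lt_arcosh (by positivity) (Real.cosh_pos _)).2 hq
  rw [Real.arcosh_cosh (by positivity), lt_div_iff₀ hE0] at h1
  linarith

/-! ### Stability of the catenary -/

/-- For `c = 0` and `E = 0` the slope is `y` itself. The value is that of the Goldschmidt
competitor, two discs of radius `r`, as an area divided by `2 π`. -/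
theorem energyBound_catenary_zero {h r : ℝ} (hr : 0 < r) : energyBound h r 0 1 0 = r ^ 2 := by
  have h1 : slopeIntegral 0 r 0 = r ^ 2 / 2 := by
    rw [slopeIntegral, Real.sqrt_zero]
    rw [intervalIntegral.integral_congr (g := fun y => y)]
    · simp
    · intro y hy
      rw [uIcc_of_le hr.le] at hy
      simp [calSlope, Real.sqrt_sq hy.1]
  rw [energyBound, h1]; ring

theorem energyBound_catenary_eq {h r P : ℝ} (hh : 0 < h) (hP : 0 < P)
    (hr : r = P * Real.cosh (h / P)) :
    energyBound h r 0 1 P =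
      P ^ 2 * (h / P + Real.sinh (h / P) * Real.cosh (h / P)) := by
  have ht : 0 < h / P := by positivity
  have hhe : h = P * (h / P) := by field_simp
  set t := h / P
  have hc1 : 1 < Real.cosh t := Real.one_lt_cosh.2 ht.ne'
  have hs : 0 < Real.sinh t := Real.sinh_pos_iff.2 ht
  have hr0 : 0 < r := by rw [hr]; positivity
  have hPr : 0 < 1 * (r - P) := by rw [hr]; nlinarith
  have h1 := slopeIntegral_eq_of_vertex (c := 0) (m := P) (n := 0) (ε := 1) hr0 hP le_rfl (by simp)
    (Or.inl rfl) (by simpa using hP) hPr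
  simp only [add_zero, sub_zero] at h1
  have hS : √((r ^ 2) ^ 2 - 2 * (P ^ 2 / 2) * r ^ 2 + 0 ^ 2) =
      P ^ 2 * (Real.sinh t * Real.cosh t) := by
    rw [← Real.sqrt_sq (by positivity : 0 ≤ P ^ 2 * (Real.sinh t * Real.cosh t))]
    congr 1
    rw [hr]
    linear_combination (P ^ 4 * Real.cosh t ^ 2) * Real.cosh_sq t
  have harg : r ^ 2 - P ^ 2 / 2 + P ^ 2 * (Real.sinh t * Real.cosh t) =
      P ^ 2 / 2 * Real.exp (2 * t) := by
    rw [← Real.cosh_add_sinh, Real.cosh_two_mul_eq, Real.sinh_two_mul, hr]; ring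
  rw [slopePrimitive, hS, harg, Real.log_mul (by positivity) (Real.exp_pos _).ne', Real.log_exp,
    show ((P ^ 2 / 2) ^ 2 - 0 ^ 2 : ℝ) = (P ^ 2 / 2) ^ 2 by ring,
    show Real.log ((P ^ 2 / 2) ^ 2) = 2 * Real.log (P ^ 2 / 2) by rw [Real.log_pow]; norm_num] at h1
  rw [energyBound, h1, hhe]
  ring

/-- Among the bounds for `c = 0` with `0 ≤ E ≤ P₀` the stable catenary has the least. -/
theorem energyBound_catenary_le {h r P₀ P₁ : ℝ} (hh : 0 < h) (hr : 0 < r) (hP₁ : 0 < P₁)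
    (hP : P₁ < P₀) (hrP : r = P₀ * Real.cosh (h / P₀)) (hξ : h / P₀ ≤ 1 / xiConst)
    (hlt : ∀ P, P₁ < P → P < P₀ → P * Real.cosh (h / P) < r)
    (hgt : ∀ P, 0 < P → P < P₁ → r < P * Real.cosh (h / P)) {E : ℝ} (hE : E ∈ Icc 0 P₀) :
    energyBound h r 0 1 P₀ ≤ energyBound h r 0 1 E := by
  have hP₀ : 0 < P₀ := hP₁.trans hP
  have hP₀r : P₀ < r := by
    have : 1 < Real.cosh (h / P₀) := Real.one_lt_cosh.2 (by positivity)
    nlinarith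
  -- The threshold `ω` enters here: `t + sinh t cosh t ≤ cosh² t` at `t = h / P₀` compares the
  -- catenary with the two discs.
  have hend : energyBound h r 0 1 P₀ ≤ energyBound h r 0 1 0 := by
    rw [energyBound_catenary_zero hr, energyBound_catenary_eq hh hP₀ hrP]
    rw [show r ^ 2 = P₀ ^ 2 * Real.cosh (h / P₀) ^ 2 by rw [← mul_pow, ← hrP]]
    exact mul_le_mul_of_nonneg_left (add_sinh_mul_cosh_le_cosh_sq hξ) (by positivity)
  have hcont := continuous_energyBound (h := h) (c := 0) (ε := 1) le_rfl hr
  -- For `c = 0` the sign of the derivative is therefore decided by comparing `E cosh (h / E)` with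
  -- `r`.
  have hψ : ∀ E, 0 < E → E * √(E ^ 2 - 4 * 0) * Real.cosh (2 * h / E) =
      2 * (E * Real.cosh (h / E)) ^ 2 - E ^ 2 := fun E hE => by
    rw [show E ^ 2 - 4 * 0 = E ^ 2 by ring, Real.sqrt_sq hE.le, mul_div_assoc,
      Real.cosh_two_mul_eq]
    ring
  rcases le_total E P₁ with h1 | h1
  · have hmono : MonotoneOn (energyBound h r 0 1) (Icc 0 P₁) := by
      apply StrictMonoOn.monotoneOn
      apply strictMonoOn_of_deriv_pos (convex_Icc 0 P₁) hcont.continuousOn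
      rw [interior_Icc]
      intro x hx
      have hxr : x < r := by linarith [hx.2]
      apply deriv_energyBound_pos hh le_rfl hr (Or.inl rfl) (by simpa using hr)
        (by simpa using hx.1) (by simpa using hxr)
      · have := hx.1; nlinarith
      · rw [hψ x hx.1]
        have := hgt x hx.1 hx.2
        nlinarith
    exact hend.trans (hmono ⟨le_rfl, hP₁.le⟩ ⟨hE.1, h1⟩ hE.1)
  · have hanti : AntitoneOn (energyBound h r 0 1) (Icc P₁ P₀) := by
      apply StrictAntiOn.antitoneOn
      apply strictAntiOn_of_deriv_neg (convex_Icc P₁ P₀) hcont.continuousOn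
      rw [interior_Icc]
      intro x hx
      have hx0 : 0 < x := hP₁.trans hx.1
      have hxr : x < r := by linarith [hx.2]
      apply deriv_energyBound_neg hh le_rfl hr (Or.inl rfl) (by simpa using hr)
        (by simpa using hx0) (by simpa using hxr)
      rw [hψ x hx0]
      have := hlt x hx.1 hx.2
      have := mul_pos hx0 (Real.cosh_pos (h / x))
      nlinarith
    exact hanti ⟨h1, hE.2⟩ ⟨hP.le, le_rfl⟩ hE.2

/-! ### The case `c < r²` -/

/-- `E ↦ E √(E² - 4c) cosh (2h/E) + E²` is increasing for `E ≥ h`. -/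
theorem strictMonoOn_convexEq {h c M : ℝ} (hh : 0 < h) (hc : 0 ≤ c) (hM : h ≤ M)
    (hMc : 2 * √c ≤ M) :
    StrictMonoOn (fun E => E * √(E ^ 2 - 4 * c) * Real.cosh (2 * h / E) + E ^ 2) (Ici M) := by
  have hd : ∀ E, 2 * √c < E → HasDerivAt
      (fun E => E * √(E ^ 2 - 4 * c) * Real.cosh (2 * h / E) + E ^ 2)
      ((√(E ^ 2 - 4 * c) + E ^ 2 / √(E ^ 2 - 4 * c)) * Real.cosh (2 * h / E) -
        √(E ^ 2 - 4 * c) * (2 * h / E) * Real.sinh (2 * h / E) + 2 * E) E := by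
    intro E hE
    obtain ⟨hE0, hR, hlt⟩ := sqrt_sq_sub_pos hc hE
    have dR : HasDerivAt (fun E : ℝ => √(E ^ 2 - 4 * c)) (2 * E / (2 * √(E ^ 2 - 4 * c))) E := by
      have := ((hasDerivAt_pow 2 E).sub_const (4 * c)).sqrt (by linarith : E ^ 2 - 4 * c ≠ 0)
      simpa using! this
    have dC : HasDerivAt (fun E : ℝ => Real.cosh (2 * h / E))
        (Real.sinh (2 * h / E) * (-(2 * h) / E ^ 2)) E := by
      have h1 : HasDerivAt (fun E : ℝ => 2 * h / E) (-(2 * h) / E ^ 2) E := by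
        have := (hasDerivAt_const E (2 * h)).div (hasDerivAt_id E) hE0.ne'
        simpa using! this
      exact (Real.hasDerivAt_cosh _).comp E h1
    have := (((hasDerivAt_id E).mul dR).mul dC).add (hasDerivAt_pow 2 E)
    refine this.congr_deriv ?_
    simp only [id, Nat.cast_ofNat, Nat.add_one_sub_one, pow_one, Pi.mul_apply]
    generalize √(E ^ 2 - 4 * c) = R at *
    field_simp
    ring
  apply strictMonoOn_of_deriv_pos (convex_Ici M)
  · intro E hE
    have hE0 : E ≠ 0 := (hh.trans_le (hM.trans hE)).ne'
    have : ContinuousAt (fun E => E * √(E ^ 2 - 4 * c) * Real.cosh (2 * h / E) + E ^ 2) E := by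
      have : ContinuousAt (fun E : ℝ => 2 * h / E) E :=
        continuousAt_const.div continuousAt_id hE0
      have := Real.continuous_cosh.continuousAt.comp this
      have h3 : ContinuousAt (fun E => Real.cosh (2 * h / E)) E := this
      fun_prop
    exact this.continuousWithinAt
  · rw [interior_Ici]
    intro E hE
    have hEM : M < E := hE
    have hEc : 2 * √c < E := by linarith
    obtain ⟨hE0, hR, hlt⟩ := sqrt_sq_sub_pos hc hEc
    rw [(hd E hEc).deriv]
    have hRE : √(E ^ 2 - 4 * c) ≤ E := by
      rw [Real.sqrt_le_left hE0.le]; linarith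
    generalize √(E ^ 2 - 4 * c) = R at *
    have ht0 : 0 < h / E := by positivity
    have ht1 : h / E < 1 := by rw [div_lt_one hE0]; linarith
    rw [mul_div_assoc]
    generalize h / E = t at *
    have hs : 0 < Real.sinh t := Real.sinh_pos_iff.2 ht0
    have hsc := Real.sinh_lt_cosh t
    have hch := Real.cosh_pos t
    have hts : t * Real.sinh t < Real.cosh t := by nlinarith
    -- With this, and with `R ≤ E` in the subtracted term, the derivative is at least `4 E cosh t
    -- (cosh t - t sinh t)`, which is positive because `t = h / E < 1`.
    have hamgm : 2 * E ≤ R + E ^ 2 / R := by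
      rw [show R + E ^ 2 / R = (R ^ 2 + E ^ 2) / R by field_simp, le_div_iff₀ hR]
      nlinarith [sq_nonneg (R - E)]
    have h1 : 2 * E * Real.cosh (2 * t) ≤ (R + E ^ 2 / R) * Real.cosh (2 * t) :=
      mul_le_mul_of_nonneg_right hamgm (Real.cosh_pos _).le
    have h2 : R * (2 * t) * Real.sinh (2 * t) ≤ E * (2 * t) * Real.sinh (2 * t) := by
      have : 0 ≤ Real.sinh (2 * t) := Real.sinh_nonneg_iff.2 (by linarith)
      gcongr
    rw [Real.sinh_two_mul] at h2 ⊢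
    rw [Real.cosh_two_mul_eq] at h1 ⊢
    have h3 : E * (2 * t) * (2 * Real.sinh t * Real.cosh t) < 4 * E * Real.cosh t ^ 2 := by
      have : t * Real.sinh t * Real.cosh t < Real.cosh t * Real.cosh t :=
        mul_lt_mul_of_pos_right hts hch
      nlinarith
    nlinarith

theorem solvesConvexEq_iff {h r c E : ℝ} (hE : 2 * √c < E) (hc : 0 ≤ c) :
    SolvesConvexEq h r c E ↔
      E * √(E ^ 2 - 4 * c) * Real.cosh (2 * h / E) + E ^ 2 = 2 * r ^ 2 + 2 * c := by
  obtain ⟨hE0, hR, hlt⟩ := sqrt_sq_sub_pos hc hE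
  rw [SolvesConvexEq, eq_div_iff (by positivity)]
  constructor
  · rintro ⟨-, -, h3⟩; linarith
  · intro h3; exact ⟨hE0.ne', hlt, by linarith⟩

theorem two_mul_sqrt_lt {c E : ℝ} (hE : 0 < E) (h : 4 * c < E ^ 2) : 2 * √c < E := by
  rcases le_total 0 c with hc | hc
  · have hsc : √c ^ 2 = c := Real.sq_sqrt hc
    nlinarith [Real.sqrt_nonneg c]
  · rw [Real.sqrt_eq_zero_of_nonpos hc]; linarith

/-- The slope integral for `c > 0` decreases faster in `E` than the one for `c = 0`. -/
theorem antitoneOn_slopeIntegral_sub {c r P : ℝ} (hr : 0 < r) (hc : 0 < c) (hcr : √c < r)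
    (hP : P < r) :
    AntitoneOn (fun E => slopeIntegral c r E - slopeIntegral 0 r E) (Icc (2 * √c) P) := by
  have hsc0 : 0 < √c := Real.sqrt_pos.2 hc
  have hfr : r < r + c / r := lt_add_of_pos_right r (by positivity)
  have hd : ∀ x ∈ Ioo (2 * √c) P, HasDerivAt
      (fun E => slopeIntegral c r E - slopeIntegral 0 r E)
      (-(1 * (x / 2 * Real.arcosh (1 * (2 * r ^ 2 - x ^ 2 + 2 * c) / (x * √(x ^ 2 - 4 * c))))) -
       -(1 * (x / 2 * Real.arcosh (1 * (2 * r ^ 2 - x ^ 2 + 2 * 0) / (x * √(x ^ 2 - 4 * 0))))))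
      x := fun x hx =>
    (hasDerivAt_slopeIntegral hc.le hr (Or.inl rfl) (by linarith) hx.1
      (hx.2.trans (hP.trans hfr))).sub
    (hasDerivAt_slopeIntegral (c := 0) (ε := 1) le_rfl hr (Or.inl rfl)
      (by simpa using hr) (by rw [Real.sqrt_zero]; linarith [hx.1])
      (by rw [zero_div, add_zero]; exact hx.2.trans hP))
  apply antitoneOn_of_deriv_nonpos (convex_Icc _ _)
  · exact ((continuous_slopeIntegral hc.le hr).sub
      (continuous_slopeIntegral le_rfl hr)).continuousOn
  · rw [interior_Icc]
    exact fun x hx => (hd x hx).differentiableAt.differentiableWithinAt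
  · rw [interior_Icc]
    intro x hx
    obtain ⟨hx0, hxR, -⟩ := sqrt_sq_sub_pos hc.le hx.1
    rw [(hd x hx).deriv, show x ^ 2 - 4 * 0 = x ^ 2 by ring, Real.sqrt_sq hx0.le]
    have hxr : x < r := hx.2.trans hP
    have hRx : √(x ^ 2 - 4 * c) ≤ x := by rw [Real.sqrt_le_left hx0.le]; linarith
    have hx2 : x ^ 2 < r ^ 2 := by gcongr
    generalize √(x ^ 2 - 4 * c) = R at *
    have hq0 : 0 < 1 * (2 * r ^ 2 - x ^ 2 + 2 * 0) / (x * x) :=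
      div_pos (by linarith [sq_nonneg x]) (by positivity)
    -- Passing from `0` to `c` raises the numerator and lowers the denominator, so the `arcosh`
    -- grows.
    have hq : 1 * (2 * r ^ 2 - x ^ 2 + 2 * 0) / (x * x) ≤
        1 * (2 * r ^ 2 - x ^ 2 + 2 * c) / (x * R) := by
      apply div_le_div₀ (by linarith [sq_nonneg x]) (by linarith) (by positivity)
      exact mul_le_mul_of_nonneg_left hRx hx0.le
    have h1 := (Real.arcosh_le_arcosh hq0 (hq0.trans_le hq)).2 hq
    have h2 := mul_le_mul_of_nonneg_left h1 (by positivity : 0 ≤ x / 2)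
    linarith

/-- Above `M = max P₀ (2 √c)` the boundary function is increasing and crosses its target once, so
the bound has a strict minimum there. Levels between `2 √c` and `P₀` are excluded by comparison with
`c = 0`, where `P₀` is already optimal among them. -/
theorem exists_convex_minimum {h r c P₀ P₁ : ℝ} (hh : 0 < h) (hr : 0 < r) (hP₁ : 0 < P₁)
    (hP : P₁ < P₀) (hrP : r = P₀ * Real.cosh (h / P₀)) (hξ : h / P₀ ≤ 1 / xiConst)
    (hlt : ∀ P, P₁ < P → P < P₀ → P * Real.cosh (h / P) < r)
    (hgt : ∀ P, 0 < P → P < P₁ → r < P * Real.cosh (h / P)) (hc : 0 < c) (hcr : c < r ^ 2) :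
    ∃ E, P₀ < E ∧ 2 * √c < E ∧ E < r + c / r ∧ SolvesConvexEq h r c E ∧
      (∀ E', P₀ < E' → SolvesConvexEq h r c E' → E' = E) ∧
      ∀ E' ∈ Icc (2 * √c) (r + c / r), E' ≠ E → energyBound h r c 1 E < energyBound h r c 1 E' := by
  have hP₀ : 0 < P₀ := hP₁.trans hP
  have hhP : h < P₀ := by
    have := hξ.trans_lt inv_xiConst_lt_one
    rwa [div_lt_one hP₀] at this
  have hP₀r : P₀ < r := by
    have : 1 < Real.cosh (h / P₀) := Real.one_lt_cosh.2 (by positivity)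
    nlinarith
  have hsc : √c ^ 2 = c := Real.sq_sqrt hc.le
  have hsc0 : 0 < √c := Real.sqrt_pos.2 hc
  have hscr : √c < r := (Real.sqrt_lt' hr).2 hcr
  have hfr : r < r + c / r := by have : 0 < c / r := by positivity
                                 linarith
  have hfr2 : 2 * √c < r + c / r := by
    rw [← sub_pos, show r + c / r - 2 * √c = (r - √c) ^ 2 / r by
      field_simp; linear_combination -hsc]
    have : 0 < r - √c := by linarith
    positivity
  set M := max P₀ (2 * √c) with hM
  have hM1 : P₀ ≤ M := le_max_left _ _
  have hM2 : 2 * √c ≤ M := le_max_right _ _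
  have hM0 : 0 < M := hP₀.trans_le hM1
  have hMr : M < r + c / r := max_lt (hP₀r.trans hfr) hfr2
  have hmono := strictMonoOn_convexEq hh hc.le (by linarith : h ≤ M) hM2
  set φ := fun E => E * √(E ^ 2 - 4 * c) * Real.cosh (2 * h / E) + E ^ 2 with hφ
  have hφc : ContinuousOn φ (Icc M (r + c / r)) := by
    have h1 : ContinuousOn (fun E => 2 * h / E) (Icc M (r + c / r)) :=
      continuousOn_const.div continuousOn_id fun x hx => (hM0.trans_le hx.1).ne'
    have h2 : ContinuousOn (fun E => Real.cosh (2 * h / E)) (Icc M (r + c / r)) :=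
      Real.continuous_cosh.comp_continuousOn h1
    fun_prop
  -- At `2 √c` the root vanishes and `c < r²` decides. At `P₀`, replacing the root by the larger
  -- `P₀` gives `2 r²`, by the catenary equation.
  have hlo : φ M < 2 * r ^ 2 + 2 * c := by
    rcases le_total P₀ (2 * √c) with hle | hle
    · have hMe : M = 2 * √c := max_eq_right hle
      have : M ^ 2 - 4 * c = 0 := by rw [hMe]; linear_combination 4 * hsc
      simp only [hφ]
      rw [this, Real.sqrt_zero]
      nlinarith
    · have hMe : M = P₀ := max_eq_left hle
      simp only [hφ, hMe]
      have : √(P₀ ^ 2 - 4 * c) ≤ P₀ := by rw [Real.sqrt_le_left hP₀.le]; linarith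
      have h1 : P₀ * √(P₀ ^ 2 - 4 * c) * Real.cosh (2 * h / P₀) ≤
          P₀ * P₀ * Real.cosh (2 * h / P₀) := by
        have := Real.cosh_pos (2 * h / P₀)
        gcongr
      rw [mul_div_assoc, Real.cosh_two_mul_eq] at h1 ⊢
      have h2 : r ^ 2 = P₀ ^ 2 * Real.cosh (h / P₀) ^ 2 := by rw [← mul_pow, ← hrP]
      nlinarith
  -- At `E = f r` the root is `r - c / r`, and equality would hold with `1` in place of the cosine.
  have hhi : 2 * r ^ 2 + 2 * c < φ (r + c / r) := by
    have hR : √((r + c / r) ^ 2 - 4 * c) = r - c / r := by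
      rw [show (r + c / r) ^ 2 - 4 * c = (r - c / r) ^ 2 by field_simp; ring]
      apply Real.sqrt_sq
      rw [sub_nonneg, div_le_iff₀ hr]; nlinarith
    simp only [hφ]
    rw [hR]
    have hne : 2 * h / (r + c / r) ≠ 0 := by positivity
    have h1 := Real.one_lt_cosh.2 hne
    have h2 : 0 < (r + c / r) * (r - c / r) := by
      apply mul_pos (by positivity)
      rw [sub_pos, div_lt_iff₀ hr]; nlinarith
    have h3 : (r + c / r) * (r - c / r) + (r + c / r) ^ 2 = 2 * r ^ 2 + 2 * c := by
      field_simp; ring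
    nlinarith
  obtain ⟨E, hEm, hEe⟩ := intermediate_value_Ioo hMr.le hφc ⟨hlo, hhi⟩
  have hEc : 2 * √c < E := hM2.trans_lt hEm.1
  have huniq : ∀ E', P₀ < E' → SolvesConvexEq h r c E' → E' = E := by
    intro E' h1 h2
    have h3 := two_mul_sqrt_lt (hP₀.trans h1) h2.2.1
    have h4 := (solvesConvexEq_iff h3 hc.le).1 h2
    exact hmono.injOn (mem_Ici.2 (max_le h1.le h3.le)) (mem_Ici.2 hEm.1.le) (h4.trans hEe.symm)
  refine ⟨E, hM1.trans_lt hEm.1, hEc, hEm.2, (solvesConvexEq_iff hEc hc.le).2 hEe, huniq, ?_⟩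
  have hεr : 0 < 1 * (r - √c) := by linarith
  have hcont := continuous_energyBound (h := h) (c := c) (ε := 1) hc.le hr
  have hanti : StrictAntiOn (energyBound h r c 1) (Icc M E) := by
    apply strictAntiOn_of_deriv_neg (convex_Icc M E) hcont.continuousOn
    rw [interior_Icc]
    intro x hx
    apply deriv_energyBound_neg hh hc.le hr (Or.inl rfl) hεr (hM2.trans_lt hx.1)
      (hx.2.trans hEm.2)
    have h1 := hmono (mem_Ici.2 hx.1.le) (mem_Ici.2 hEm.1.le) hx.2
    rw [hEe] at h1
    simp only [hφ] at h1
    linarith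
  have hmon : StrictMonoOn (energyBound h r c 1) (Icc E (r + c / r)) := by
    apply strictMonoOn_of_deriv_pos (convex_Icc _ _) hcont.continuousOn
    rw [interior_Icc]
    intro x hx
    have hx0 : 0 < x := by linarith [hx.1]
    apply deriv_energyBound_pos hh hc.le hr (Or.inl rfl) hεr (hEc.trans hx.1) hx.2
    · have h1 : x ^ 2 < (r + c / r) ^ 2 := by have := hx.2; gcongr
      have h2 : (r + c / r) ^ 2 = 2 * r ^ 2 + 2 * c - (r ^ 2 - c ^ 2 / r ^ 2) := by
        field_simp; ring
      have h3 : c ^ 2 / r ^ 2 < r ^ 2 := by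
        rw [div_lt_iff₀ (by positivity)]; nlinarith
      linarith
    · have h1 := hmono (mem_Ici.2 hEm.1.le) (mem_Ici.2 (hEm.1.trans hx.1).le) hx.1
      rw [hEe] at h1
      simp only [hφ] at h1
      linarith
  intro E' hE' hne
  rcases lt_or_gt_of_ne hne with hl | hl
  · rcases le_total M E' with hl' | hl'
    · exact hanti ⟨hl', hl.le⟩ ⟨hEm.1.le, le_rfl⟩ hl
    · rcases le_total P₀ (2 * √c) with hle | hle
      · have hMe : M = 2 * √c := max_eq_right hle
        have : E' = M := le_antisymm hl' (hMe ▸ hE'.1)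
        rw [this]
        exact hanti ⟨le_rfl, hEm.1.le⟩ ⟨hEm.1.le, le_rfl⟩ hEm.1
      · have hMe : M = P₀ := max_eq_left hle
        have h1 : energyBound h r c 1 E < energyBound h r c 1 P₀ := by
          rw [← hMe]
          exact hanti ⟨le_rfl, hEm.1.le⟩ ⟨hEm.1.le, le_rfl⟩ hEm.1
        refine h1.trans_le ?_
        have hE0' : 0 ≤ E' := by linarith [hE'.1]
        -- The bound for `c` is the bound for `0` plus twice the difference of the slope integrals.
        -- Neither part is larger at `P₀` than at `E'`.
        have h2 := energyBound_catenary_le hh hr hP₁ hP hrP hξ hlt hgt (E := E')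
          ⟨hE0', hMe ▸ hl'⟩
        have hD := antitoneOn_slopeIntegral_sub hr hc hscr hP₀r
        have h3 := hD ⟨hE'.1, hMe ▸ hl'⟩ ⟨hle, le_rfl⟩ (hMe ▸ hl')
        simp only at h3
        unfold energyBound at h2 ⊢
        linarith
  · exact hmon ⟨le_rfl, hEm.2.le⟩ ⟨hl.le, hE'.2⟩ hl

/-! ### The case `c > r²` -/

theorem solvesConcaveEq_iff {h r c E : ℝ} (hE : 2 * √c < E) (hc : 0 ≤ c) :
    SolvesConcaveEq h r c E ↔
      E * √(E ^ 2 - 4 * c) * Real.cosh (2 * h / E) = E ^ 2 - 2 * r ^ 2 - 2 * c := by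
  obtain ⟨hE0, hR, hlt⟩ := sqrt_sq_sub_pos hc hE
  rw [SolvesConcaveEq, eq_div_iff (by positivity)]
  constructor
  · rintro ⟨-, -, h3⟩; linarith
  · intro h3; exact ⟨hE0.ne', hlt, by linarith⟩

/-- From `E² > 4c > 2r² + 2c` the numerator is positive, and so is the cosine, which fixes the sign
of the denominator. -/
theorem SolvesConcaveEq.pos {h r c E : ℝ} (hcr : r ^ 2 < c)
    (hS : SolvesConcaveEq h r c E) : 0 < E := by
  obtain ⟨h1, h2, h3⟩ := hS
  by_contra hn
  have hE : E < 0 := lt_of_le_of_ne (not_lt.1 hn) h1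
  have hR : 0 < √(E ^ 2 - 4 * c) := Real.sqrt_pos.2 (by linarith)
  have h4 : (-2 * r ^ 2 + E ^ 2 - 2 * c) / (E * √(E ^ 2 - 4 * c)) < 0 :=
    div_neg_of_pos_of_neg (by nlinarith) (mul_neg_of_neg_of_pos hE hR)
  linarith [Real.cosh_pos (2 * h / E)]

/-- The concave equation in terms of `p = (r² + c) / (r E)` and `s = 2 h / E`. -/
theorem SolvesConcaveEq.slope_relation {h r c E : ℝ} (hh : 0 < h) (hr : 0 < r) (hcr : r ^ 2 < c)
    (hS : SolvesConcaveEq h r c E) :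
    1 ≤ (r ^ 2 + c) / (r * E) ∧
    √(E ^ 2 - 4 * c) * Real.sinh (2 * h / E) = 2 * r * √(((r ^ 2 + c) / (r * E)) ^ 2 - 1) ∧
    √(((r ^ 2 + c) / (r * E)) ^ 2 - 1) *
      ((2 * h / E) * Real.cosh (2 * h / E) / Real.sinh (2 * h / E)) +
      (r ^ 2 + c) / (r * E) * (2 * h / E) = h / r := by
  have hE0 := hS.pos hcr
  have hc : 0 < c := lt_of_le_of_lt (sq_nonneg r) hcr
  have hEc := two_mul_sqrt_lt hE0 hS.2.1
  have heq := (solvesConcaveEq_iff hEc hc.le).1 hS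
  have hRsq : √(E ^ 2 - 4 * c) ^ 2 = E ^ 2 - 4 * c := Real.sq_sqrt (by linarith [hS.2.1])
  have hRp : 0 < √(E ^ 2 - 4 * c) := Real.sqrt_pos.2 (by linarith [hS.2.1])
  have hs0 : 0 < 2 * h / E := by positivity
  have hhs : h = E * (2 * h / E) / 2 := by field_simp
  have hpE : r * E * ((r ^ 2 + c) / (r * E)) = r ^ 2 + c := by field_simp
  have hp0 : 0 < (r ^ 2 + c) / (r * E) := by positivity
  generalize √(E ^ 2 - 4 * c) = R at *
  generalize (r ^ 2 + c) / (r * E) = p at *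
  set s := 2 * h / E
  have hS0 : 0 < Real.sinh s := Real.sinh_pos_iff.2 hs0
  have hcs := Real.cosh_sq s
  -- Here `p = f r / E` is `√(1 + ρ'²)` at the endpoint, so `√(p² - 1)` is the absolute slope there.
  -- This identity is the boundary equation divided by `E`; squaring it and subtracting `R²` gives
  -- the one for `R sinh s`.
  have hRC : R * Real.cosh s = E - 2 * r * p := by
    apply mul_left_cancel₀ hE0.ne'
    linear_combination heq + 2 * hpE
  have hRS : (R * Real.sinh s) ^ 2 = 4 * r ^ 2 * (p ^ 2 - 1) := by
    linear_combination (R * Real.cosh s + E - 2 * r * p) * hRC - R ^ 2 * hcs - hRsq - 4 * hpE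
  have hp2 : 0 ≤ p ^ 2 - 1 := by
    have : 0 < 4 * r ^ 2 := by positivity
    by_contra hn
    have h1 : 4 * r ^ 2 * (p ^ 2 - 1) < 0 := mul_neg_of_pos_of_neg this (not_le.1 hn)
    nlinarith [sq_nonneg (R * Real.sinh s)]
  have hp1 : 1 ≤ p := by nlinarith
  have hT : R * Real.sinh s = 2 * r * √(p ^ 2 - 1) := by
    rw [← Real.sqrt_sq (by positivity : 0 ≤ R * Real.sinh s), hRS,
      show 4 * r ^ 2 * (p ^ 2 - 1) = (2 * r) ^ 2 * (p ^ 2 - 1) by ring,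
      Real.sqrt_mul (by positivity), Real.sqrt_sq (by positivity)]
  refine ⟨hp1, hT, ?_⟩
  have hTC : 2 * r * √(p ^ 2 - 1) * Real.cosh s = (E - 2 * r * p) * Real.sinh s := by
    rw [← hT, ← hRC]; ring
  rw [hhs]
  field_simp
  linear_combination hTC

/-- The expression `√(p² - 1) κ + p s` increases in `s` and `κ`, and strictly in `p`. At a fixed
value `k`, larger `s` and `κ` force a smaller `p`. -/
theorem concave_comparison_aux {κ₁ κ₂ p₁ p₂ s₁ s₂ k : ℝ} (hs₁ : 0 < s₁) (hκ₁ : 0 ≤ κ₁)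
    (hs : s₁ ≤ s₂) (hκ : κ₁ ≤ κ₂) (hp₁ : 1 ≤ p₁) 
    (h₁ : √(p₁ ^ 2 - 1) * κ₁ + p₁ * s₁ = k) (h₂ : √(p₂ ^ 2 - 1) * κ₂ + p₂ * s₂ = k) :
    p₂ ≤ p₁ := by
  by_contra hn
  have hlt : p₁ < p₂ := not_le.1 hn
  have h3 : √(p₁ ^ 2 - 1) ≤ √(p₂ ^ 2 - 1) := Real.sqrt_le_sqrt (by nlinarith)
  have h4 : √(p₁ ^ 2 - 1) * κ₁ ≤ √(p₂ ^ 2 - 1) * κ₂ :=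
    mul_le_mul h3 hκ hκ₁ (Real.sqrt_nonneg _)
  have h5 : p₁ * s₁ < p₂ * s₂ := by nlinarith
  linarith

/-- Monotone dependence of the concave solution on `c`. -/
theorem SolvesConcaveEq.comparison {h r c₁ c₂ E₁ E₂ : ℝ} (hh : 0 < h) (hr : 0 < r)
    (hc₁ : r ^ 2 < c₁) (hc : c₁ ≤ c₂) (h₁ : SolvesConcaveEq h r c₁ E₁)
    (h₂ : SolvesConcaveEq h r c₂ E₂) :
    (E₂ ≤ E₁ → c₁ = c₂ ∧ E₁ = E₂) ∧
    (c₁ < c₂ → E₁ < E₂ ∧ (r ^ 2 + c₁) / (r * E₁) < (r ^ 2 + c₂) / (r * E₂)) := by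
  have hE₁ := h₁.pos hc₁
  have hE₂ := h₂.pos (hc₁.trans_le hc)
  obtain ⟨a1, -, a3⟩ := h₁.slope_relation hh hr hc₁
  obtain ⟨b1, -, b3⟩ := h₂.slope_relation hh hr (hc₁.trans_le hc)
  have q1 : r * (E₁ * ((r ^ 2 + c₁) / (r * E₁))) = r ^ 2 + c₁ := by field_simp
  have q2 : r * (E₂ * ((r ^ 2 + c₂) / (r * E₂))) = r ^ 2 + c₂ := by field_simp
  set p₁ := (r ^ 2 + c₁) / (r * E₁)
  set p₂ := (r ^ 2 + c₂) / (r * E₂)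
  have hs₁ : 0 < 2 * h / E₁ := by positivity
  have hs₂ : 0 < 2 * h / E₂ := by positivity
  have hκ : ∀ s : ℝ, 0 < s → 0 < s * Real.cosh s / Real.sinh s := fun s hs =>
    div_pos (mul_pos hs (Real.cosh_pos s)) (Real.sinh_pos_iff.2 hs)
  have hfirst : E₂ ≤ E₁ → c₁ = c₂ ∧ E₁ = E₂ := by
    intro hE
    have hs : 2 * h / E₁ ≤ 2 * h / E₂ := by gcongr
    have hp := concave_comparison_aux hs₁ (hκ _ hs₁).le hs
      (Real.monotoneOn_mul_cosh_div_sinh hs₁ hs₂ hs) a1 a3 b3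
    -- Since `r E p = r² + c`, a smaller `E` together with a smaller `p` would make `c` smaller,
    -- contrary to `c₁ ≤ c₂` unless equality holds.
    have hle : E₂ * p₂ ≤ E₁ * p₁ := mul_le_mul hE hp (by linarith) hE₁.le
    have hle' := mul_le_mul_of_nonneg_left hle hr.le
    have hcc : c₁ = c₂ := by linarith
    refine ⟨hcc, le_antisymm ?_ hE⟩
    by_contra hn
    have : E₂ * p₂ < E₁ * p₁ := by nlinarith [not_le.1 hn]
    have := mul_lt_mul_of_pos_left this hr
    linarith
  refine ⟨hfirst, fun hlt => ?_⟩
  have hE : E₁ < E₂ := by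
    by_contra hn
    exact hlt.ne (hfirst (not_lt.1 hn)).1
  refine ⟨hE, ?_⟩
  have hs : 2 * h / E₂ ≤ 2 * h / E₁ := by gcongr
  have hs' : 2 * h / E₂ < 2 * h / E₁ := by gcongr
  have hp := concave_comparison_aux hs₂ (hκ _ hs₂).le hs
      (Real.monotoneOn_mul_cosh_div_sinh hs₂ hs₁ hs) b1 b3 a3
  refine lt_of_le_of_ne hp fun hpe => ?_
  have h3 := mul_le_mul_of_nonneg_left (Real.monotoneOn_mul_cosh_div_sinh hs₂ hs₁ hs)
    (Real.sqrt_nonneg (p₁ ^ 2 - 1))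
  simp only at h3
  rw [← hpe] at b3
  nlinarith

/-- Monotonicity of the boundary function is not needed: its root is unique, so by the intermediate
value theorem it keeps the sign of its end value on each side of the root, and the bound falls and
then rises. -/
theorem exists_concave_minimum {h r c : ℝ} (hh : 0 < h) (hr : 0 < r) (hcr : r ^ 2 < c) :
    ∃ E, 2 * √c < E ∧ E < r + c / r ∧ SolvesConcaveEq h r c E ∧
      (∀ E', SolvesConcaveEq h r c E' → E' = E) ∧
      ∀ E' ∈ Icc (2 * √c) (r + c / r), E' ≠ E →
        energyBound h r c (-1) E < energyBound h r c (-1) E' := by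
  have hc : 0 < c := lt_of_le_of_lt (sq_nonneg r) hcr
  have hsc : √c ^ 2 = c := Real.sq_sqrt hc.le
  have hsc0 : 0 < √c := Real.sqrt_pos.2 hc
  have hscr : r < √c := Real.lt_sqrt_of_sq_lt hcr
  have hfr2 : 2 * √c < r + c / r := by
    rw [← sub_pos, show r + c / r - 2 * √c = (√c - r) ^ 2 / r by
      field_simp; linear_combination -hsc]
    have : 0 < √c - r := by linarith
    positivity
  have huniq : ∀ E E', SolvesConcaveEq h r c E → SolvesConcaveEq h r c E' → E' = E := by
    intro E E' h1 h2
    rcases le_total E E' with hle | hle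
    · exact ((h2.comparison hh hr hcr le_rfl h1).1 hle).2
    · exact ((h1.comparison hh hr hcr le_rfl h2).1 hle).2.symm
  set φ := fun E => E ^ 2 - E * √(E ^ 2 - 4 * c) * Real.cosh (2 * h / E) with hφ
  have hφc : ContinuousOn φ (Icc (2 * √c) (r + c / r)) := by
    have h1 : ContinuousOn (fun E => 2 * h / E) (Icc (2 * √c) (r + c / r)) :=
      continuousOn_const.div continuousOn_id fun x hx =>
        ((by positivity : 0 < 2 * √c).trans_le hx.1).ne'
    have h2 : ContinuousOn (fun E => Real.cosh (2 * h / E)) (Icc (2 * √c) (r + c / r)) :=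
      Real.continuous_cosh.comp_continuousOn h1
    fun_prop
  have hlo : 2 * r ^ 2 + 2 * c < φ (2 * √c) := by
    have : (2 * √c) ^ 2 - 4 * c = 0 := by linear_combination 4 * hsc
    simp only [hφ]
    rw [this, Real.sqrt_zero]
    nlinarith
  have hhi : φ (r + c / r) < 2 * r ^ 2 + 2 * c := by
    have hR : √((r + c / r) ^ 2 - 4 * c) = c / r - r := by
      rw [show (r + c / r) ^ 2 - 4 * c = (c / r - r) ^ 2 by field_simp; ring]
      apply Real.sqrt_sq
      rw [sub_nonneg, le_div_iff₀ hr]; nlinarith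
    simp only [hφ]
    rw [hR]
    have hne : 2 * h / (r + c / r) ≠ 0 := by positivity
    have h1 := Real.one_lt_cosh.2 hne
    have h2 : 0 < (r + c / r) * (c / r - r) := by
      apply mul_pos (by positivity)
      rw [sub_pos, lt_div_iff₀ hr]; nlinarith
    have h3 : (r + c / r) ^ 2 - (r + c / r) * (c / r - r) = 2 * r ^ 2 + 2 * c := by
      field_simp; ring
    nlinarith
  have hsolve : ∀ E, 2 * √c < E → φ E = 2 * r ^ 2 + 2 * c → SolvesConcaveEq h r c E := by
    intro E h1 h2
    rw [solvesConcaveEq_iff h1 hc.le]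
    simp only [hφ] at h2
    linarith
  obtain ⟨E, hEm, hEe⟩ := intermediate_value_Ioo' hfr2.le hφc ⟨hhi, hlo⟩
  have hES := hsolve E hEm.1 hEe
  refine ⟨E, hEm.1, hEm.2, hES, fun E' => huniq E E' hES, ?_⟩
  have hεr : 0 < -1 * (r - √c) := by linarith
  have hcont := continuous_energyBound (h := h) (c := c) (ε := -1) hc.le hr
  have hleft : ∀ x ∈ Ioo (2 * √c) E, 2 * r ^ 2 + 2 * c < φ x := by
    intro x hx
    by_contra hn
    obtain ⟨y, hy, hye⟩ := intermediate_value_Icc' hx.1.le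
      (hφc.mono (Icc_subset_Icc_right (hx.2.trans hEm.2).le)) ⟨not_lt.1 hn, hlo.le⟩
    have hy1 : 2 * √c < y := by
      refine lt_of_le_of_ne hy.1 fun h => ?_
      rw [← h] at hye; linarith
    have := huniq E y hES (hsolve y hy1 hye)
    linarith [hy.2, hx.2]
  have hright : ∀ x ∈ Ioo E (r + c / r), φ x < 2 * r ^ 2 + 2 * c := by
    intro x hx
    by_contra hn
    obtain ⟨y, hy, hye⟩ := intermediate_value_Icc' hx.2.le
      (hφc.mono (Icc_subset_Icc_left (hEm.1.trans hx.1).le)) ⟨hhi.le, not_lt.1 hn⟩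
    have := huniq E y hES (hsolve y (hEm.1.trans (hx.1.trans_le hy.1)) hye)
    linarith [hy.1, hx.1]
  have hanti : StrictAntiOn (energyBound h r c (-1)) (Icc (2 * √c) E) := by
    apply strictAntiOn_of_deriv_neg (convex_Icc _ E) hcont.continuousOn
    rw [interior_Icc]
    intro x hx
    apply deriv_energyBound_neg hh hc.le hr (Or.inr rfl) hεr hx.1 (hx.2.trans hEm.2)
    have h1 := hleft x hx
    simp only [hφ] at h1
    linarith
  have hmon : StrictMonoOn (energyBound h r c (-1)) (Icc E (r + c / r)) := by
    apply strictMonoOn_of_deriv_pos (convex_Icc _ _) hcont.continuousOn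
    rw [interior_Icc]
    intro x hx
    apply deriv_energyBound_pos hh hc.le hr (Or.inr rfl) hεr (hEm.1.trans hx.1) hx.2
    · have := (sqrt_sq_sub_pos hc.le (hEm.1.trans hx.1)).2.2
      linarith
    · have h1 := hright x hx
      simp only [hφ] at h1
      linarith
  intro E' hE' hne
  rcases lt_or_gt_of_ne hne with hl | hl
  · exact hanti ⟨hE'.1, hl.le⟩ ⟨hEm.1.le, le_rfl⟩ hl
  · exact hmon ⟨le_rfl, hEm.2.le⟩ ⟨hl.le, hE'.2⟩ hl

/-! ### Extremal profiles and their energy -/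

/-- The extremal with constant `E`; `ε = 1` for the convex and `ε = -1` for the concave profile. -/
noncomputable def profile (ε c E x : ℝ) : ℝ :=
  √(ε * (E / 2 * √(E ^ 2 - 4 * c) * Real.cosh (2 * x / E)) + E ^ 2 / 2 - c)

theorem convexProfile_eq_profile (c E x : ℝ) : convexProfile c E x = profile 1 c E x := by
  rw [convexProfile, profile, one_mul]

theorem concaveProfile_eq_profile (c E x : ℝ) : concaveProfile c E x = profile (-1) c E x := by
  rw [concaveProfile, profile]
  congr 1; ring

theorem profile_neg (ε c E x : ℝ) : profile ε c E (-x) = profile ε c E x := by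
  rw [profile, profile, show 2 * -x / E = -(2 * x / E) by ring, Real.cosh_neg]

/-- Data of an extremal through `(±h, r)`: `E` is admissible for the branch `ε` and satisfies the
boundary condition. -/
structure IsExtremal (h r c ε E : ℝ) : Prop where
  hh : 0 < h
  hr : 0 < r
  hc : 0 < c
  hε : ε = 1 ∨ ε = -1
  hεr : 0 < ε * (r - √c)
  hE : 2 * √c < E
  hEr : E < r + c / r
  heq : ε * (E * √(E ^ 2 - 4 * c) * Real.cosh (2 * h / E)) + E ^ 2 = 2 * r ^ 2 + 2 * c

namespace IsExtremal

variable {h r c ε E : ℝ}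

theorem E_pos (H : IsExtremal h r c ε E) : 0 < E := (sqrt_sq_sub_pos H.hc.le H.hE).1

theorem sqrt_pos (H : IsExtremal h r c ε E) : 0 < √(E ^ 2 - 4 * c) :=
  (sqrt_sq_sub_pos H.hc.le H.hE).2.1

theorem eps_sq (H : IsExtremal h r c ε E) : ε ^ 2 = 1 := by
  rcases H.hε with h | h <;> rw [h] <;> norm_num

/-- The squared profile lies between its vertex value `m²` and its boundary value `r²`, where
`m + n = E` and `m n = c`; in particular it is positive. -/
theorem radicand (H : IsExtremal h r c ε E) {x : ℝ} (hx : x ∈ Icc (-h) h) :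
    ∃ m n, 0 < m ∧ 0 < n ∧ m * n = c ∧ m + n = E ∧ ε * (m - n) = √(E ^ 2 - 4 * c) ∧
      0 < ε * (m - n) ∧ 0 < ε * (r - m) ∧
      ε * m ^ 2 ≤ ε * (ε * (E / 2 * √(E ^ 2 - 4 * c) * Real.cosh (2 * x / E)) + E ^ 2 / 2 - c) ∧
      ε * (ε * (E / 2 * √(E ^ 2 - 4 * c) * Real.cosh (2 * x / E)) + E ^ 2 / 2 - c) ≤ ε * r ^ 2 ∧
      0 < ε * (E / 2 * √(E ^ 2 - 4 * c) * Real.cosh (2 * x / E)) + E ^ 2 / 2 - c := by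
  obtain ⟨m, n, hm, hn, hmn, hE, hR, h1, h2⟩ :=
    exists_vertex H.hc.le H.hr H.hε H.hεr H.hE H.hEr
  have hn0 : 0 < n := by
    refine lt_of_le_of_ne hn fun h0 => ?_
    rw [← h0, mul_zero] at hmn
    exact H.hc.ne hmn
  refine ⟨m, n, hm, hn0, hmn, hE, hR, h1, h2, ?_⟩
  have hE0 := H.E_pos
  have hRp := H.sqrt_pos
  have hcosh : Real.cosh (2 * x / E) ≤ Real.cosh (2 * h / E) := by
    rw [Real.cosh_le_cosh, abs_div, abs_div, abs_mul, abs_mul, abs_of_pos H.hh]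
    have := abs_le.2 hx
    gcongr
  have hcosh1 := Real.one_le_cosh (2 * x / E)
  have heq := H.heq
  have hε2 := H.eps_sq
  have hm2 : m ^ 2 = ε * (E / 2 * √(E ^ 2 - 4 * c)) + E ^ 2 / 2 - c := by
    rw [← hR, ← hmn, ← hE]
    linear_combination (-(m + n) / 2 * (m - n)) * hε2
  generalize √(E ^ 2 - 4 * c) = R at *
  set C := Real.cosh (2 * x / E)
  have hA : 0 < E * R := by positivity
  have q1 : E * R * 1 ≤ E * R * C := by gcongr
  have q2 : E * R * C ≤ E * R * Real.cosh (2 * h / E) := by gcongr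
  have p1 : ε * m ^ 2 ≤ ε * (ε * (E / 2 * R * C) + E ^ 2 / 2 - c) := by
    have : ε * (ε * (E / 2 * R * C) + E ^ 2 / 2 - c) - ε * m ^ 2 = (E * R * C - E * R) / 2 := by
      rw [hm2]; linear_combination ((E * R * C - E * R) / 2) * hε2
    linarith
  have p2 : ε * (ε * (E / 2 * R * C) + E ^ 2 / 2 - c) ≤ ε * r ^ 2 := by
    have : ε * r ^ 2 - ε * (ε * (E / 2 * R * C) + E ^ 2 / 2 - c) =
        (E * R * Real.cosh (2 * h / E) - E * R * C) / 2 := by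
      linear_combination ((E * R * Real.cosh (2 * h / E) - E * R * C) / 2) * hε2 - ε / 2 * heq
    linarith
  refine ⟨p1, p2, ?_⟩
  have hr2 : 0 < r ^ 2 := pow_pos H.hr 2
  have hm2' : 0 < m ^ 2 := pow_pos hm 2
  rcases H.hε with h | h <;> rw [h] at p1 p2 ⊢ <;> linarith

theorem profile_pos (H : IsExtremal h r c ε E) {x : ℝ} (hx : x ∈ Icc (-h) h) :
    0 < profile ε c E x := by
  obtain ⟨m, n, -, -, -, -, -, -, -, -, -, h1⟩ := H.radicand hx
  exact Real.sqrt_pos.2 h1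

theorem profile_sq (H : IsExtremal h r c ε E) {x : ℝ} (hx : x ∈ Icc (-h) h) :
    profile ε c E x ^ 2 =
      ε * (E / 2 * √(E ^ 2 - 4 * c) * Real.cosh (2 * x / E)) + E ^ 2 / 2 - c := by
  obtain ⟨m, n, -, -, -, -, -, -, -, -, -, h1⟩ := H.radicand hx
  exact Real.sq_sqrt h1.le

theorem profile_h (H : IsExtremal h r c ε E) : profile ε c E h = r := by
  have h1 := H.profile_sq (right_mem_Icc.2 (by linarith [H.hh]))
  have h2 := H.profile_pos (right_mem_Icc.2 (by linarith [H.hh]))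
  have h3 : profile ε c E h ^ 2 = r ^ 2 := by rw [h1]; linear_combination H.heq / 2
  exact (pow_left_inj₀ h2.le H.hr.le two_ne_zero).1 h3

theorem contDiffOn_profile (H : IsExtremal h r c ε E) {n : WithTop ℕ∞} :
    ContDiffOn ℝ n (profile ε c E) (Icc (-h) h) := by
  unfold profile
  apply ContDiffOn.sqrt
  · have : ContDiff ℝ n fun x : ℝ => Real.cosh (2 * x / E) :=
      ((contDiff_const.mul contDiff_id).div_const E).cosh
    exact ((((contDiff_const.mul this).const_smul ε).add contDiff_const).sub
      contDiff_const).contDiffOn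
  · intro x hx
    obtain ⟨m, n, -, -, -, -, -, -, -, -, -, h1⟩ := H.radicand hx
    exact h1.ne'

theorem hasDerivAt_profile (H : IsExtremal h r c ε E) {x : ℝ} (hx : x ∈ Icc (-h) h) :
    HasDerivAt (profile ε c E)
      (ε * (√(E ^ 2 - 4 * c) * Real.sinh (2 * x / E)) / (2 * profile ε c E x)) x := by
  obtain ⟨m, n, -, -, -, -, -, -, -, -, -, h1⟩ := H.radicand hx
  have hE0 := H.E_pos
  have hl : HasDerivAt (fun x : ℝ => 2 * x / E) (2 / E) x := by
    have := ((hasDerivAt_id x).const_mul 2).div_const E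
    simpa using! this
  have hd := ((((((Real.hasDerivAt_cosh (2 * x / E)).comp x hl).const_mul
    (E / 2 * √(E ^ 2 - 4 * c))).const_mul ε).add_const (E ^ 2 / 2)).sub_const c).sqrt h1.ne'
  refine hd.congr_deriv ?_
  change _ = ε * (√(E ^ 2 - 4 * c) * Real.sinh (2 * x / E)) / (2 * √_)
  congr 1
  field_simp

theorem profile_mem_admissible (H : IsExtremal h r c ε E) :
    profile ε c E ∈ admissible h r := by
  have hab : -h < h := by linarith [H.hh]
  refine ⟨(memW11_of_contDiffOn hab H.contDiffOn_profile).1,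
    (H.contDiffOn_profile (n := 0)).continuousOn, fun x hx => H.profile_pos hx, ?_, H.profile_h⟩
  rw [profile_neg, H.profile_h]

/-- In terms of `v = ε (y² - B) / A`, with `A = E √(E² - 4c) / 2` and `B = E² / 2 - c`, this reads
`y √(f² - E²) = A √(v² - 1)`. It turns the calibration equation into one solved by `cosh`. -/
theorem calSlope_eq (H : IsExtremal h r c ε E) {y : ℝ} (hy : 0 < y) :
    calSlope c E y * y = E / 2 * √(E ^ 2 - 4 * c) *
      √((ε * (y ^ 2 - (E ^ 2 / 2 - c)) / (E / 2 * √(E ^ 2 - 4 * c))) ^ 2 - 1) := by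
  have hE0 := H.E_pos
  have hRp := H.sqrt_pos
  have hRsq : √(E ^ 2 - 4 * c) ^ 2 = E ^ 2 - 4 * c :=
    Real.sq_sqrt (by linarith [(sqrt_sq_sub_pos H.hc.le H.hE).2.2])
  rw [calSlope_eq_div hy, div_mul_cancel₀ _ hy.ne']
  generalize √(E ^ 2 - 4 * c) = R at *
  rw [← Real.sqrt_sq (by positivity : 0 ≤ E / 2 * R)]
  rw [← Real.sqrt_mul (by positivity)]
  rw [Real.sqrt_sq (by positivity : 0 ≤ E / 2 * R)]
  congr 1
  have h2 := H.eps_sq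
  have hD : (E / 2 * R) ^ 2 * ((ε * (y ^ 2 - (E ^ 2 / 2 - c)) / (E / 2 * R)) ^ 2 - 1) =
      (ε * (y ^ 2 - (E ^ 2 / 2 - c))) ^ 2 - (E / 2 * R) ^ 2 := by
    rw [div_pow, mul_sub, mul_div_cancel₀ _ (by positivity), mul_one]
  rw [hD]
  linear_combination (-(y ^ 2 - (E ^ 2 / 2 - c)) ^ 2) * h2 + E ^ 2 / 4 * hRsq

/-- The profile is an integral curve of the calibration, so that its energy is the bound. -/
theorem energy_profile (H : IsExtremal h r c ε E) :
    energy h c (profile ε c E) = energyBound h r c ε E := by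
  have hab : -h < h := by linarith [H.hh]
  have hE0 := H.E_pos
  have hRp := H.sqrt_pos
  have hε2 := H.eps_sq
  have h0m : (0 : ℝ) ∈ Icc (-h) h := ⟨by linarith [H.hh], H.hh.le⟩
  have hf : ∀ x ∈ Icc (-h) h, E ≤ profile ε c E x + c / profile ε c E x := by
    intro x hx
    obtain ⟨m, n, hm, hn, hmn, hE, hR, h1, h2, h3, -, -⟩ := H.radicand hx
    rw [← H.profile_sq hx] at h3
    have hp := H.profile_pos hx
    set y := profile ε c E x
    have : y + c / y - E = (y - m) * (y - n) / y := by
      rw [← hmn, ← hE]; field_simp; ring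
    rw [← sub_nonneg, this]
    refine div_nonneg ?_ hp.le
    rcases H.hε with h | h
    · rw [h] at h3 h1
      have : m ≤ y := le_of_sq_le_sq (by linarith) hp.le
      exact mul_nonneg (by linarith) (by linarith)
    · rw [h] at h3 h1
      have : y ≤ m := le_of_sq_le_sq (by linarith) hm.le
      exact mul_nonneg_of_nonpos_of_nonpos (by linarith) (by linarith)
  have hae : ∀ᵐ x ∂(volume.restrict (Ioo (-h) h)), E * weakDeriv (-h) h (profile ε c E) x =
      (ε * if (0 : ℝ) ≤ x then 1 else -1) * calSlope c E (profile ε c E x) := by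
    filter_upwards [(memW11_of_contDiffOn hab H.contDiffOn_profile).2,
      ae_restrict_mem measurableSet_Ioo] with x hx hxm
    have hxm' := Ioo_subset_Icc_self hxm
    have hp := H.profile_pos hxm'
    rw [hx, (H.hasDerivAt_profile hxm').deriv]
    have h1 := H.calSlope_eq hp
    have hA : 0 < E / 2 * √(E ^ 2 - 4 * c) := by positivity
    have hv : ε * (profile ε c E x ^ 2 - (E ^ 2 / 2 - c)) / (E / 2 * √(E ^ 2 - 4 * c)) =
        Real.cosh (2 * x / E) := by
      rw [H.profile_sq hxm', div_eq_iff hA.ne']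
      linear_combination (E / 2 * √(E ^ 2 - 4 * c) * Real.cosh (2 * x / E)) * hε2
    rw [hv, Real.cosh_sq, add_sub_cancel_right, Real.sqrt_sq_eq_abs] at h1
    have hsgn : |Real.sinh (2 * x / E)| =
        (if (0 : ℝ) ≤ x then 1 else -1) * Real.sinh (2 * x / E) := by
      split_ifs with h0
      · rw [one_mul, abs_of_nonneg (Real.sinh_nonneg_iff.2 (by positivity))]
      · rw [neg_one_mul, abs_of_nonpos (Real.sinh_nonpos_iff.2 ?_)]
        exact div_nonpos_of_nonpos_of_nonneg (by linarith) hE0.le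
    have hcs : calSlope c E (profile ε c E x) = E / 2 * √(E ^ 2 - 4 * c) *
        ((if (0 : ℝ) ≤ x then 1 else -1) * Real.sinh (2 * x / E)) / profile ε c E x := by
      rw [← hsgn, ← h1, mul_div_cancel_right₀ _ hp.ne']
    rw [hcs]
    have hs2 : (if (0 : ℝ) ≤ x then (1 : ℝ) else -1) ^ 2 = 1 := by split_ifs <;> norm_num
    generalize (if (0 : ℝ) ≤ x then (1 : ℝ) else -1) = s at *
    field_simp
    linear_combination (-(ε * Real.sinh (2 * x / E))) * hs2
  rw [energy_eq_of_ae_eq H.hh hE0 hε2 H.profile_mem_admissible h0m hf hae, energyBound]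
  obtain ⟨m, n, hm, hn, hmn, hE, hR, h1, h2, -⟩ := H.radicand h0m
  have hp0 : profile ε c E 0 = m := by
    have hpp := H.profile_pos h0m
    have hps := H.profile_sq h0m
    refine (pow_left_inj₀ hpp.le hm.le two_ne_zero).1 ?_
    rw [hps, mul_zero, zero_div, Real.cosh_zero, ← hR, ← hmn, ← hE]
    linear_combination ((m + n) / 2 * (m - n)) * hε2
  have hz0 : ∀ y ∈ uIcc √c m, calSlope c E y = 0 := fun y hy => by
    rw [← hE]
    exact calSlope_eq_zero_of_mem_uIcc hm hn.le hmn H.hε h1.le hy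
  have hz : ∫ y in (√c)..m, calSlope c E y = 0 := by
    rw [intervalIntegral.integral_congr (g := fun _ => (0 : ℝ)) hz0]
    simp
  have hii : ∀ p q, 0 < p → 0 < q → IntervalIntegrable (calSlope c E) volume p q :=
    fun p q hp hq => ((continuousOn_calSlope c E).mono
      fun y hy => (lt_min hp hq).trans_le hy.1).intervalIntegrable
  rw [hp0, slopeIntegral, ← intervalIntegral.integral_add_adjacent_intervals
    (hii _ _ (Real.sqrt_pos.2 H.hc) hm) (hii _ _ hm H.hr), hz, zero_add]

end IsExtremal

/-! ### The adapted level and uniqueness of the minimizer -/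

/-- Every admissible curve has energy at least one of the calibration bounds. -/
theorem exists_energyBound_le {h r c ε : ℝ} (hh : 0 < h) (hr : 0 < r) (hc : 0 < c)
    (hε : ε = 1 ∨ ε = -1) (hεr : 0 < ε * (r - √c)) {σ : ℝ → ℝ} (hσ : σ ∈ admissible h r) :
    ∃ x₀ ∈ Icc (-h) h, ∃ z, 0 < z ∧ 0 ≤ ε * (z - √c) ∧ z + c / z ∈ Icc (2 * √c) (r + c / r) ∧
      (∀ x ∈ Icc (-h) h, 0 ≤ ε * (σ x - σ x₀)) ∧ (z = σ x₀ ∨ z = √c) ∧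
      (∀ x ∈ Icc (-h) h, z + c / z ≤ σ x + c / σ x) ∧
      energyBound h r c ε (z + c / z) ≤ 2 * h * (z + c / z) +
        2 * ε * ∫ y in (σ x₀)..r, calSlope c (z + c / z) y := by
  have hne : (Icc (-h) h).Nonempty := nonempty_Icc.2 (by linarith)
  obtain ⟨-, hcont, hpos, hr1, hr2⟩ := hσ
  have hsc : √c ^ 2 = c := Real.sq_sqrt hc.le
  have hsc0 : 0 < √c := Real.sqrt_pos.2 hc
  have hε2 : ε ^ 2 = 1 := by rcases hε with rfl | rfl <;> norm_num
  have hhm : h ∈ Icc (-h) h := right_mem_Icc.2 (by linarith)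
  obtain ⟨x₀, hx₀, hext⟩ : ∃ x₀ ∈ Icc (-h) h, ∀ x ∈ Icc (-h) h, 0 ≤ ε * (σ x - σ x₀) := by
    rcases hε with rfl | rfl
    · obtain ⟨x₀, h1, h2⟩ := isCompact_Icc.exists_isMinOn hne hcont
      exact ⟨x₀, h1, fun x hx => by have := isMinOn_iff.1 h2 x hx; linarith⟩
    · obtain ⟨x₀, h1, h2⟩ := isCompact_Icc.exists_isMaxOn hne hcont
      exact ⟨x₀, h1, fun x hx => by have := isMaxOn_iff.1 h2 x hx; linarith⟩
  have hy0 := hpos x₀ hx₀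
  have hry := hext h hhm
  rw [hr2] at hry
  -- If the extremal value of `σ` lies beyond `√c`, then `f (σ x₀)` need not be the least value of
  -- `f` along `σ`; the level is then taken at the minimum point `√c` of `f`.
  obtain ⟨z, hz0, hzc, hzr, hzz⟩ : ∃ z, 0 < z ∧ 0 ≤ ε * (z - √c) ∧ 0 ≤ ε * (r - z) ∧
      (z = σ x₀ ∨ (z = √c ∧ 0 ≤ ε * (√c - σ x₀))) := by
    rcases le_total 0 (ε * (σ x₀ - √c)) with hle | hle
    · exact ⟨σ x₀, hy0, hle, hry, Or.inl rfl⟩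
    · exact ⟨√c, hsc0, by simp, hεr.le, Or.inr ⟨rfl, by linarith⟩⟩
  have hzc' : 0 ≤ ε * (√c - c / z) := by
    have : ε * (√c - c / z) = √c / z * (ε * (z - √c)) := by
      field_simp; linear_combination ε * hsc
    rw [this]; positivity
  have hagm : ∀ y, 0 < y → 2 * √c ≤ y + c / y := by
    intro y hy
    rw [← sub_nonneg, show y + c / y - 2 * √c = (y - √c) ^ 2 / y by
      field_simp; linear_combination -hsc]
    positivity
  -- `c / z` is the other point of level `f z`, on the opposite side of `√c`. Both factors therefore
  -- have the sign of `ε`, if they do not vanish.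
  have hfac : ∀ y, 0 < y → 0 ≤ ε * (y - z) → z + c / z ≤ y + c / y := by
    intro y hy h1
    rw [← sub_nonneg, show y + c / y - (z + c / z) = (y - z) * (y - c / z) / y by
      field_simp; ring]
    refine div_nonneg ?_ hy.le
    rw [show (y - z) * (y - c / z) = (ε * (y - z)) * (ε * (y - z) + (ε * (z - √c) +
      ε * (√c - c / z))) by linear_combination (-(y - z) * (y - c / z)) * hε2]
    positivity
  refine ⟨x₀, hx₀, z, hz0, hzc, ⟨hagm z hz0, hfac r hr hzr⟩, hext, hzz.imp_right And.left, ?_, ?_⟩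
  · intro x hx
    rcases hzz with h1 | ⟨h1, -⟩
    · exact hfac _ (hpos x hx) (h1 ▸ hext x hx)
    · have : z + c / z = 2 * √c := by
        rw [h1]; field_simp; linear_combination (-1) * hsc
      rw [this]; exact hagm _ (hpos x hx)
  · have hii : ∀ p q, 0 < p → 0 < q →
        IntervalIntegrable (calSlope c (z + c / z)) volume p q := fun p q hp hq =>
      ((continuousOn_calSlope c _).mono
        fun y hy => (lt_min hp hq).trans_le hy.1).intervalIntegrable
    -- This is the effect of replacing the lower limit `σ x₀` by `√c`: the slope vanishes in between
    -- when `z = σ x₀`, and otherwise the extra piece has the favourable sign.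
    have hnn : 0 ≤ ε * ∫ y in (σ x₀)..√c, calSlope c (z + c / z) y := by
      rcases hzz with h1 | ⟨h1, h2⟩
      · have : ∫ y in (σ x₀)..√c, calSlope c (z + c / z) y = 0 := by
          rw [← h1, intervalIntegral.integral_symm, intervalIntegral.integral_congr
            (g := fun _ => (0 : ℝ)) fun y hy => calSlope_eq_zero_of_mem_uIcc hz0 (by positivity)
            (mul_div_cancel₀ c hz0.ne') hε (by linarith) hy]
          simp
        rw [this, mul_zero]
      · rcases hε with rfl | rfl
        · rw [one_mul]
          exact intervalIntegral.integral_nonneg (by linarith) fun y _ => Real.sqrt_nonneg _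
        · rw [intervalIntegral.integral_symm, neg_one_mul, neg_neg]
          exact intervalIntegral.integral_nonneg (by linarith) fun y _ => Real.sqrt_nonneg _
    rw [energyBound, slopeIntegral, ← intervalIntegral.integral_add_adjacent_intervals
      (hii _ _ hy0 hsc0) (hii _ _ hsc0 hr)]
    linarith

/-- Integral curves of `v' = k √(v² - 1)` leaving `v = 1`. -/
theorem eq_cosh_of_hasDerivAt {a h k : ℝ} {v : ℝ → ℝ} (hk : 0 < k) (hh : 0 < h) (ha : a ≤ h)
    (hv : ContinuousOn v (Icc a h)) (h1 : ∀ x ∈ Icc a h, 1 ≤ v x) (hva : v a = 1)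
    (hvh : v h = Real.cosh (k * h))
    (hd : ∀ x ∈ Ioo a h, HasDerivAt v (k * √(v x ^ 2 - 1)) x) :
    a ≤ 0 ∧ ∀ x ∈ Icc 0 h, v x = Real.cosh (k * x) := by
  -- Uniqueness fails at `v = 1`, where a solution may rest for a while. After the last such time
  -- `b`, `arcosh v` grows at the rate `k`, and the value prescribed at `h` forces `b = 0`.
  set S := {x ∈ Icc a h | v x = 1} with hS
  have hSc : IsCompact S := by
    refine isCompact_Icc.of_isClosed_subset ?_ (sep_subset _ _)
    exact hv.preimage_isClosed_of_isClosed isClosed_Icc isClosed_singleton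
  obtain ⟨b, hb, hbmax⟩ := hSc.exists_isGreatest ⟨a, ⟨le_rfl, ha⟩, hva⟩
  have hvh1 : 1 < v h := by rw [hvh]; exact Real.one_lt_cosh.2 (by positivity)
  have hbh : b < h := by
    refine lt_of_le_of_ne hb.1.2 fun h' => ?_
    rw [← h', hb.2] at hvh1
    exact lt_irrefl _ hvh1
  have hgt : ∀ x ∈ Ioc b h, 1 < v x := by
    intro x hx
    have hxm : x ∈ Icc a h := ⟨hb.1.1.trans hx.1.le, hx.2⟩
    refine lt_of_le_of_ne (h1 x hxm) fun h' => ?_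
    have := hbmax ⟨hxm, h'.symm⟩
    linarith [hx.1]
  set θ := fun x => Real.arcosh (v x) - k * x with hθ
  have hθc : ContinuousOn θ (Icc b h) := by
    have := Real.continuousOn_arcosh.comp (hv.mono (Icc_subset_Icc_left hb.1.1))
      (fun x hx => h1 x ⟨hb.1.1.trans hx.1, hx.2⟩)
    exact this.sub (by fun_prop)
  have hθd : ∀ x ∈ Ioo b h, HasDerivAt θ 0 x := by
    intro x hx
    have hx1 := hgt x ⟨hx.1, hx.2.le⟩
    have hs : 0 < √(v x ^ 2 - 1) := Real.sqrt_pos.2 (by nlinarith)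
    have := ((Real.hasDerivAt_arcosh (mem_Ioi.2 hx1)).comp x
      (hd x ⟨hb.1.1.trans_lt hx.1, hx.2⟩)).sub ((hasDerivAt_id x).const_mul k)
    refine this.congr_deriv ?_
    field_simp
    ring
  have hconst : ∀ x ∈ Icc b h, θ x = θ b := by
    intro x hx
    rcases hx.1.eq_or_lt with rfl | hbx
    · rfl
    obtain ⟨y, -, hy⟩ := exists_hasDerivAt_eq_slope θ (fun _ => 0) hbx
      (hθc.mono (Icc_subset_Icc_right hx.2)) fun y hy => hθd y ⟨hy.1, hy.2.trans_le hx.2⟩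
    rw [eq_comm, div_eq_zero_iff] at hy
    rcases hy with hy | hy <;> linarith
  have hkb : k * b = 0 := by
    have := hconst h ⟨hbh.le, le_rfl⟩
    simp only [hθ, hvh, hb.2, Real.arcosh_cosh (by positivity : 0 ≤ k * h),
      Real.arcosh_zero] at this
    linarith
  have hb0 : b = 0 := (mul_eq_zero.1 hkb).resolve_left hk.ne'
  refine ⟨hb0 ▸ hb.1.1, fun x hx => ?_⟩
  have := hconst x ⟨hb0 ▸ hx.1, hx.2⟩
  simp only [hθ, hb.2, Real.arcosh_zero, hkb] at this
  rw [← Real.cosh_arcosh (h1 x ⟨(hb0 ▸ hb.1.1 : a ≤ 0).trans hx.1, hx.2⟩)]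
  congr 1
  linarith

/-- A curve whose weak derivative is a.e. equal to `s · w(σ)`, with `s` jumping at `x₀`, is
classically differentiable away from `x₀`. -/
theorem hasDerivAt_of_ae_eq {h r c E ε x₀ : ℝ} (hh : 0 < h) (hE : 0 < E) {σ : ℝ → ℝ}
    (hσ : σ ∈ admissible h r)
    (hae : ∀ᵐ x ∂(volume.restrict (Ioo (-h) h)),
      E * weakDeriv (-h) h σ x = (ε * if x₀ ≤ x then 1 else -1) * calSlope c E (σ x))
    {x : ℝ} (hx : x ∈ Ioo (-h) h) (hx₀ : x ≠ x₀) :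
    HasDerivAt σ ((ε * if x₀ ≤ x then 1 else -1) * calSlope c E (σ x) / E) x := by
  have hab : -h < h := by linarith
  obtain ⟨hW, hcont, hpos, -, -⟩ := hσ
  -- The right-hand side is continuous away from `x₀`, so its primitive, which is `σ` up to a
  -- constant, is differentiable there.
  set G : ℝ → ℝ := fun x => (ε * if x₀ ≤ x then 1 else -1) * calSlope c E (σ x) / E with hG
  have hgi := hW.weakDeriv_spec.1
  have hgG : ∀ᵐ x ∂(volume.restrict (Ioo (-h) h)), weakDeriv (-h) h σ x = G x := by
    filter_upwards [hae] with y hy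
    rw [hG]; field_simp; linarith
  have hGi : IntegrableOn G (Ioo (-h) h) := hgi.congr hgG
  have hGc : ∀ y ∈ Ioo (-h) h \ {x₀}, ContinuousAt G y := by
    intro y hy
    have hyI : Icc (-h) h ∈ 𝓝 y := Icc_mem_nhds hy.1.1 hy.1.2
    have hcs : ContinuousAt (fun x => calSlope c E (σ x)) y := by
      have h1 := (continuousOn_calSlope c E).continuousAt
        (Ioi_mem_nhds (hpos y (Ioo_subset_Icc_self hy.1)))
      exact ContinuousAt.comp (f := σ) h1 (hcont.continuousAt hyI)
    have hsg : ContinuousAt (fun x => if x₀ ≤ x then (1 : ℝ) else -1) y := by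
      rcases lt_or_gt_of_ne hy.2 with hlt | hlt
      · refine continuousAt_const (y := (-1 : ℝ)) |>.congr ?_
        filter_upwards [Iio_mem_nhds hlt] with z hz
        rw [if_neg (not_le.2 hz)]
      · refine continuousAt_const (y := (1 : ℝ)) |>.congr ?_
        filter_upwards [Ioi_mem_nhds hlt] with z hz
        rw [if_pos (le_of_lt hz)]
    exact ((continuousAt_const.mul hsg).mul hcs).div_const E
  have hxm : x ∈ Ioo (-h) h \ {x₀} := ⟨hx, hx₀⟩
  have hopen : IsOpen (Ioo (-h) h \ {x₀}) := isOpen_Ioo.sdiff isClosed_singleton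
  have hint : ∀ y ∈ Icc (-h) h, ∫ t in (-h)..y, weakDeriv (-h) h σ t = ∫ t in (-h)..y, G t := by
    intro y hy
    rw [intervalIntegral.integral_of_le hy.1, intervalIntegral.integral_of_le hy.1,
      integral_Ioc_eq_integral_Ioo, integral_Ioc_eq_integral_Ioo]
    exact integral_congr_ae (ae_restrict_of_ae_restrict_of_subset (Ioo_subset_Ioo_right hy.2) hgG)
  have hd := intervalIntegral.integral_hasDerivAt_right (a := -h)
    (IntegrableOn.intervalIntegrable_of_Ioo hx.1.le (hGi.mono_set (Ioo_subset_Ioo_right hx.2.le)))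
    (ContinuousAt.stronglyMeasurableAtFilter hopen hGc x hxm) (hGc x hxm)
  refine (hd.const_add (σ (-h))).congr_of_eventuallyEq ?_
  filter_upwards [Ioo_mem_nhds hx.1 hx.2] with y hy
  rw [hW.eq_add_integral hab hcont (Ioo_subset_Icc_self hy), hint y (Ioo_subset_Icc_self hy)]

namespace IsExtremal

variable {h r c ε E : ℝ}

/-- Integral curves of the calibration through the vertex are the profile. -/
theorem eqOn_profile_of_ae_eq (H : IsExtremal h r c ε E) {σ : ℝ → ℝ} {x₀ m n : ℝ}
    (hσ : σ ∈ admissible h r) (hx₀ : x₀ ∈ Icc (-h) h) (hmn : m * n = c) (hmnE : m + n = E)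
    (hR : ε * (m - n) = √(E ^ 2 - 4 * c)) (hm : 0 < m) (hσ₀ : σ x₀ = m)
    (hext : ∀ x ∈ Icc (-h) h, 0 ≤ ε * (σ x - m))
    (hae : ∀ᵐ x ∂(volume.restrict (Ioo (-h) h)),
      E * weakDeriv (-h) h σ x = (ε * if x₀ ≤ x then 1 else -1) * calSlope c E (σ x)) :
    EqOn σ (profile ε c E) (Icc (-h) h) := by
  have hE0 := H.E_pos
  have hRp := H.sqrt_pos
  have hε2 := H.eps_sq
  have hder := fun {x : ℝ} => hasDerivAt_of_ae_eq H.hh hE0 hσ hae (x := x)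
  obtain ⟨-, hcont, hpos, hr1, hr2⟩ := hσ
  have hA : 0 < E / 2 * √(E ^ 2 - 4 * c) := by positivity
  set A := E / 2 * √(E ^ 2 - 4 * c) with hAdef
  have hmA : m ^ 2 = E ^ 2 / 2 - c + ε * A := by
    rw [hAdef, ← hR, ← hmnE, ← hmn]; linear_combination (-((m + n) / 2 * (m - n))) * hε2
  -- The normalization in which the profile becomes `cosh (2x/E)` and the vertex value `m` becomes
  -- `1`.
  set v : ℝ → ℝ := fun x => ε * (σ x ^ 2 - (E ^ 2 / 2 - c)) / A with hv
  have hvc : ContinuousOn v (Icc (-h) h) :=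
    ((((hcont.pow 2).sub continuousOn_const).const_smul ε).div_const A)
  have hv1 : ∀ x ∈ Icc (-h) h, 1 ≤ v x := by
    intro x hx
    rw [hv]
    simp only
    rw [le_div_iff₀ hA, one_mul]
    have h1 := hpos x hx
    have : 0 ≤ ε * (σ x - m) * (σ x + m) := mul_nonneg (hext x hx) (by linarith)
    have h2 : ε * (σ x ^ 2 - (E ^ 2 / 2 - c)) - A = ε * (σ x - m) * (σ x + m) := by
      linear_combination A * hε2 + ε * hmA
    linarith
  have hv0 : v x₀ = 1 := by
    rw [hv]
    simp only
    rw [hσ₀, hmA, div_eq_one_iff_eq hA.ne']; linear_combination A * hε2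
  have hvb : ∀ x, σ x = r → v x = Real.cosh (2 / E * h) := by
    intro x hx
    rw [hv]
    simp only
    rw [hx, div_eq_iff hA.ne', show 2 / E * h = 2 * h / E by ring]
    linear_combination (-ε / 2) * H.heq + (A * Real.cosh (2 * h / E)) * hε2
  have hvd : ∀ x ∈ Ioo (-h) h, x ≠ x₀ →
      HasDerivAt v ((if x₀ ≤ x then 1 else -1) * (2 / E * √(v x ^ 2 - 1))) x := by
    intro x hx hne
    refine (((((hder hx hne).pow 2).sub_const (E ^ 2 / 2 - c)).const_mul ε).div_const
      A).congr_deriv ?_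
    have h1 := H.calSlope_eq (hpos x (Ioo_subset_Icc_self hx))
    change _ = A * √(v x ^ 2 - 1) at h1
    generalize √(v x ^ 2 - 1) = q at *
    generalize calSlope c E (σ x) = w at *
    generalize (if x₀ ≤ x then (1 : ℝ) else -1) = s
    simp only [Nat.cast_ofNat, Nat.add_one_sub_one, pow_one]
    field_simp
    linear_combination (ε ^ 2 * s) * h1 + s * A * q * hε2
  have hright := eq_cosh_of_hasDerivAt (a := x₀) (h := h) (k := 2 / E) (v := v) (by positivity) H.hh
    hx₀.2 (hvc.mono (Icc_subset_Icc_left hx₀.1)) (fun x hx => hv1 x ⟨hx₀.1.trans hx.1, hx.2⟩) hv0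
    (hvb h hr2) (fun x hx => by
      have := hvd x ⟨hx₀.1.trans_lt hx.1, hx.2⟩ hx.1.ne'
      rwa [if_pos hx.1.le, one_mul] at this)
  have hneg : ∀ x ∈ Icc (-x₀) h, -x ∈ Icc (-h) h := fun x hx =>
    ⟨by linarith [hx.2], by linarith [hx.1, hx₀.2, hx₀.1]⟩
  -- The part left of `x₀` is the same problem after the reflection `x ↦ -x`, which absorbs the sign
  -- change.
  have hleft := eq_cosh_of_hasDerivAt (a := -x₀) (h := h) (k := 2 / E) (v := fun x => v (-x))
    (by positivity) H.hh (by linarith [hx₀.1])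
    (hvc.comp continuousOn_neg fun x hx => ⟨by linarith [hx.2], by linarith [hx.1, hx₀.2]⟩)
    (fun x hx => hv1 _ ⟨by linarith [hx.2], by linarith [hx.1, hx₀.2]⟩)
    (by rw [neg_neg]; exact hv0) (hvb (-h) hr1) (fun x hx => by
      have h1 : -x < x₀ := by linarith [hx.1]
      have := hvd (-x) ⟨by linarith [hx.2], h1.trans_le hx₀.2⟩ h1.ne
      rw [if_neg (not_le.2 h1)] at this
      have h2 := this.comp x (hasDerivAt_neg x)
      refine h2.congr_deriv ?_
      ring)
  intro x hx
  have hvx : v x = Real.cosh (2 * x / E) := by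
    rcases le_total 0 x with h0 | h0
    · rw [hright.2 x ⟨h0, hx.2⟩]; congr 1; ring
    · have := hleft.2 (-x) ⟨by linarith, by linarith [hx.1]⟩
      simp only [neg_neg] at this
      rw [this, ← Real.cosh_neg]; congr 1; ring
  have h1 : σ x ^ 2 = profile ε c E x ^ 2 := by
    rw [H.profile_sq hx, ← hvx]
    have : A * v x = ε * (σ x ^ 2 - (E ^ 2 / 2 - c)) := by
      rw [hv]; field_simp
    rw [this]; linear_combination (-(σ x ^ 2 - (E ^ 2 / 2 - c))) * hε2
  exact (pow_left_inj₀ (hpos x hx).le (H.profile_pos hx).le two_ne_zero).1 h1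

/-- If the bound has its strict minimum at `E`, then the profile is the unique minimizer. -/
theorem isMinimizer_profile (H : IsExtremal h r c ε E)
    (hmin : ∀ E' ∈ Icc (2 * √c) (r + c / r), E' ≠ E →
      energyBound h r c ε E < energyBound h r c ε E') :
    IsMinimizer h r c (profile ε c E) ∧
      ∀ σ, IsMinimizer h r c σ → EqOn σ (profile ε c E) (Icc (-h) h) := by
  have hle : ∀ E' ∈ Icc (2 * √c) (r + c / r), energyBound h r c ε E ≤ energyBound h r c ε E' := by
    intro E' hE'
    by_cases hne : E' = E
    · rw [hne]
    · exact (hmin E' hE' hne).le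
  have hz0 : ∀ z : ℝ, 2 * √c ≤ z → 0 ≤ z := fun z hz => by linarith [Real.sqrt_nonneg c]
  constructor
  · refine ⟨H.profile_mem_admissible, fun σ hσ => ?_⟩
    obtain ⟨x₀, hx₀, z, -, -, hzI, -, -, hf, hb⟩ := exists_energyBound_le H.hh H.hr H.hc H.hε
      H.hεr hσ
    rw [H.energy_profile]
    exact ((hle _ hzI).trans hb).trans (le_energy H.hh (hz0 _ hzI.1) H.eps_sq hσ hx₀ hf)
  · rintro σ ⟨hσ, hσm⟩
    obtain ⟨x₀, hx₀, z, hz, hzc, hzI, hext, hzz, hf, hb⟩ := exists_energyBound_le H.hh H.hr H.hc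
      H.hε H.hεr hσ
    have h1 := hσm _ H.profile_mem_admissible
    rw [H.energy_profile] at h1
    have h2 := le_energy H.hh (hz0 _ hzI.1) H.eps_sq hσ hx₀ hf
    have hzE : z + c / z = E := by
      by_contra hne
      linarith [hmin _ hzI hne]
    rw [hzE] at h2 hb hf
    have h3 := le_antisymm (h1.trans hb) h2
    have hae := ae_eq_of_energy_eq H.hh H.E_pos.le H.eps_sq hσ hx₀ hf h3
    obtain ⟨m, n, hm, hn, hmn, hmnE, hR, hmn0, hrm, -⟩ := H.radicand hx₀
    have hsc : √c ^ 2 = c := Real.sq_sqrt H.hc.le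
    have hsc0 : 0 < √c := Real.sqrt_pos.2 H.hc
    -- Both `m` and `n` have level `E`; the side of `√c` on which `z` lies rules out `n`.
    have hzm : z = m := by
      have h4 : (z - m) * (z - n) = 0 := by
        have : z * (z + c / z) = z * E := by rw [hzE]
        rw [mul_add, mul_div_cancel₀ _ hz.ne'] at this
        linear_combination this + hmn - z * hmnE
      rcases mul_eq_zero.1 h4 with h5 | h5
      · linarith
      · exfalso
        have h6 : z = n := by linarith
        rw [h6] at hzc
        rcases H.hε with h | h
        · rw [h] at hzc hmn0
          have h7 : √c ≤ n := by linarith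
          have h8 : √c < m := by linarith
          nlinarith
        · rw [h] at hzc hmn0
          have h7 : n ≤ √c := by linarith
          have h8 : m < √c := by linarith
          nlinarith
    have hσ₀ : σ x₀ = m := by
      rcases hzz with h5 | h5
      · rw [← h5, hzm]
      · exfalso
        have : z + c / z = 2 * √c := by
          rw [h5]; field_simp; linear_combination (-1) * hsc
        linarith [H.hE]
    exact H.eqOn_profile_of_ae_eq hσ hx₀ hmn hmnE hR hm hσ₀
      (fun x hx => hσ₀ ▸ hext x hx) hae

end IsExtremal

/-! ### The case `c = r²` -/

/-- For `c = r²` the constant curve is the unique minimizer. -/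
theorem isMinimizer_const {h r : ℝ} (hh : 0 < h) (hr : 0 < r) :
    IsMinimizer h r (r ^ 2) (fun _ => r) ∧
      ∀ σ, IsMinimizer h r (r ^ 2) σ → EqOn σ (fun _ => r) (Icc (-h) h) := by
  have hab : -h < h := by linarith
  have hhm : h ∈ Icc (-h) h := right_mem_Icc.2 hab.le
  have hcd : ContDiffOn ℝ 1 (fun _ : ℝ => r) (Icc (-h) h) := contDiffOn_const
  have hadm : (fun _ : ℝ => r) ∈ admissible h r :=
    ⟨(memW11_of_contDiffOn hab hcd).1, continuousOn_const, fun _ _ => hr, rfl, rfl⟩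
  have hrr : r + r ^ 2 / r = 2 * r := by field_simp; ring
  have hf : ∀ y, 0 < y → 2 * r ≤ y + r ^ 2 / y := by
    intro y hy
    rw [← sub_nonneg, show y + r ^ 2 / y - 2 * r = (y - r) ^ 2 / y by field_simp; ring]
    positivity
  have hen : energy h (r ^ 2) (fun _ => r) = 2 * h * (2 * r) := by
    have := energy_eq_of_ae_eq (c := r ^ 2) (E := 2 * r) (ε := 1) hh (by positivity) (by norm_num)
      hadm hhm (fun _ _ => hf r hr) (by
        filter_upwards [(memW11_of_contDiffOn hab hcd).2] with x hx
        rw [hx, calSlope, hrr]; simp)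
    rw [this]; simp
  refine ⟨⟨hadm, fun σ hσ => ?_⟩, ?_⟩
  · have := le_energy (c := r ^ 2) (E := 2 * r) (ε := 1) hh (by positivity) (by norm_num) hσ hhm
      (fun x hx => hf _ (hσ.2.2.1 x hx))
    rw [hσ.2.2.2.2, intervalIntegral.integral_same] at this
    rw [hen]; linarith
  · rintro σ ⟨hσ, hσm⟩
    have h1 := hσm _ hadm
    rw [hen] at h1
    have h2 := le_energy (c := r ^ 2) (E := 2 * r) (ε := 1) hh (by positivity) (by norm_num) hσ hhm
      (fun x hx => hf _ (hσ.2.2.1 x hx))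
    rw [hσ.2.2.2.2, intervalIntegral.integral_same, mul_zero, add_zero] at h2
    -- With `x₀ = h` the integral term of the bound vanishes for either sign, so `σ` solves the
    -- equation for `ε = 1` and for `ε = -1`, and the slope must be zero.
    have h3 : ∀ ε : ℝ, ε ^ 2 = 1 → ∀ᵐ x ∂(volume.restrict (Ioo (-h) h)),
        (2 * r) * weakDeriv (-h) h σ x =
          (ε * if h ≤ x then 1 else -1) * calSlope (r ^ 2) (2 * r) (σ x) := fun ε hε =>
      ae_eq_of_energy_eq hh (by positivity) hε hσ hhm (fun x hx => hf _ (hσ.2.2.1 x hx)) (by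
        rw [hσ.2.2.2.2, intervalIntegral.integral_same, mul_zero, add_zero]
        exact le_antisymm h1 h2)
    have h4 : ∀ᵐ x ∂(volume.restrict (Ioo (-h) h)), σ x = r := by
      filter_upwards [h3 1 (by norm_num), h3 (-1) (by norm_num), ae_restrict_mem
        measurableSet_Ioo] with x h5 h6 hx
      have h7 : calSlope (r ^ 2) (2 * r) (σ x) = 0 := by
        rw [if_neg (not_le.2 hx.2)] at h5 h6
        linarith
      have hσx := hσ.2.2.1 x (Ioo_subset_Icc_self hx)
      have h8 := hf _ hσx
      rw [calSlope, Real.sqrt_eq_zero (by nlinarith)] at h7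
      have h9 : σ x + r ^ 2 / σ x = 2 * r := by nlinarith
      have h10 : (σ x - r) ^ 2 = 0 := by
        have : σ x * (σ x + r ^ 2 / σ x) = σ x * (2 * r) := by rw [h9]
        rw [mul_add, mul_div_cancel₀ _ hσx.ne'] at this
        linear_combination this
      linarith [pow_eq_zero_iff (two_ne_zero) |>.1 h10]
    have h5 : EqOn σ (fun _ => r) (Ioo (-h) h) := Measure.eqOn_Ioo_of_ae_eq volume h4
      (hσ.2.1.mono Ioo_subset_Icc_self) continuousOn_const
    exact h5.of_subset_closure hσ.2.1 continuousOn_const Ioo_subset_Icc_self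
      (by rw [closure_Ioo hab.ne])

/-! ### Differences of cosines, convexity and concavity of the profiles -/

theorem Real.cosh_two_mul_div_eq {E : ℝ} (hE : 0 < E) (x : ℝ) :
    Real.cosh (2 * x / E) = Real.cosh (2 / E * |x|) := by
  rw [← Real.cosh_abs, abs_div, abs_mul, abs_of_pos hE, abs_two]
  congr 1; ring

/-- `(cosh dh - cosh dx) / (h² - x²)` is at most its value `d sinh (dh) / (2h)` at `x = h`. -/
theorem Real.cosh_sub_cosh_lt {d h x : ℝ} (hd : 0 < d) (hx : 0 ≤ x) (hxh : x < h) :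
    2 * h * (Real.cosh (d * h) - Real.cosh (d * x)) <
      (h ^ 2 - x ^ 2) * (d * Real.sinh (d * h)) := by
  -- With these half sums the claim is `(a + b) sinh a sinh b < a b sinh (a + b)`, which follows
  -- from `sinh s < s cosh s` at `a` and `b`.
  obtain ⟨a, ha⟩ : ∃ a, a = d * (h + x) / 2 := ⟨_, rfl⟩
  obtain ⟨b, hb⟩ : ∃ b, b = d * (h - x) / 2 := ⟨_, rfl⟩
  have ha0 : 0 < a := by rw [ha]; exact half_pos (mul_pos hd (by linarith))
  have hb0 : 0 < b := by rw [hb]; exact half_pos (mul_pos hd (by linarith))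
  have e1 : d * h = a + b := by rw [ha, hb]; ring
  have e2 : d * x = a - b := by rw [ha, hb]; ring
  have e3 : d ^ 2 * (h ^ 2 - x ^ 2) = 4 * (a * b) := by rw [ha, hb]; ring
  have sa := Real.sinh_pos_iff.2 ha0
  have sb := Real.sinh_pos_iff.2 hb0
  have ka := Real.sinh_lt_mul_cosh ha0
  have kb := Real.sinh_lt_mul_cosh hb0
  have k1 : Real.sinh a * Real.sinh b * a < a * b * (Real.sinh a * Real.cosh b) := by
    have := mul_lt_mul_of_pos_left kb (mul_pos sa ha0)
    linarith
  have k2 : Real.sinh a * Real.sinh b * b < a * b * (Real.cosh a * Real.sinh b) := by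
    have := mul_lt_mul_of_pos_left ka (mul_pos sb hb0)
    linarith
  have k3 : d * (2 * h * (Real.cosh (d * h) - Real.cosh (d * x))) <
      d * ((h ^ 2 - x ^ 2) * (d * Real.sinh (d * h))) := by
    rw [show d * (2 * h * (Real.cosh (d * h) - Real.cosh (d * x))) =
        2 * (d * h) * (Real.cosh (d * h) - Real.cosh (d * x)) by ring,
      show d * ((h ^ 2 - x ^ 2) * (d * Real.sinh (d * h))) =
        d ^ 2 * (h ^ 2 - x ^ 2) * Real.sinh (d * h) by ring,
      e3, e1, e2, Real.cosh_add, Real.cosh_sub, Real.sinh_add]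
    linarith
  exact lt_of_mul_lt_mul_left k3 hd.le

theorem Real.le_cosh_sub_cosh {d h x : ℝ} (hd : 0 < d) (hx : 0 ≤ x) (hxh : x ≤ h) :
    d ^ 2 * (h ^ 2 - x ^ 2) / 2 ≤ Real.cosh (d * h) - Real.cosh (d * x) := by
  obtain ⟨a, ha⟩ : ∃ a, a = d * (h + x) / 2 := ⟨_, rfl⟩
  obtain ⟨b, hb⟩ : ∃ b, b = d * (h - x) / 2 := ⟨_, rfl⟩
  have ha0 : 0 ≤ a := by rw [ha]; exact div_nonneg (mul_nonneg hd.le (by linarith)) two_pos.le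
  have hb0 : 0 ≤ b := by rw [hb]; exact div_nonneg (mul_nonneg hd.le (by linarith)) two_pos.le
  rw [show d * h = a + b by rw [ha, hb]; ring, show d * x = a - b by rw [ha, hb]; ring,
    show d ^ 2 * (h ^ 2 - x ^ 2) / 2 = 2 * (a * b) by rw [ha, hb]; ring, Real.cosh_add,
    Real.cosh_sub]
  have := mul_le_mul (Real.self_le_sinh_iff.2 ha0) (Real.self_le_sinh_iff.2 hb0) hb0
    (Real.sinh_nonneg_iff.2 ha0)
  linarith

namespace IsExtremal

variable {h r c ε E : ℝ}

theorem of_convex (hh : 0 < h) (hr : 0 < r) (hc : 0 < c) (hcr : c < r ^ 2) (hE : 2 * √c < E)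
    (hEr : E < r + c / r) (hS : SolvesConvexEq h r c E) : IsExtremal h r c 1 E where
  hh := hh
  hr := hr
  hc := hc
  hε := Or.inl rfl
  hεr := by rw [one_mul, sub_pos]; exact (Real.sqrt_lt' hr).2 hcr
  hE := hE
  hEr := hEr
  heq := by rw [one_mul]; exact (solvesConvexEq_iff hE hc.le).1 hS

theorem of_concave (hh : 0 < h) (hr : 0 < r) (hcr : r ^ 2 < c) (hE : 2 * √c < E)
    (hEr : E < r + c / r) (hS : SolvesConcaveEq h r c E) : IsExtremal h r c (-1) E where
  hh := hh
  hr := hr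
  hc := (sq_nonneg r).trans_lt hcr
  hε := Or.inr rfl
  hεr := by rw [neg_one_mul, neg_pos, sub_neg]; exact Real.lt_sqrt_of_sq_lt hcr
  hE := hE
  hEr := hEr
  heq := by
    have := (solvesConcaveEq_iff hE ((sq_nonneg r).trans hcr.le)).1 hS
    linarith

theorem radicand_eq (H : IsExtremal h r c ε E) (x : ℝ) :
    ε * (E / 2 * √(E ^ 2 - 4 * c) * Real.cosh (2 * x / E)) + E ^ 2 / 2 - c =
      r ^ 2 - ε * (E / 2 * √(E ^ 2 - 4 * c) *
        (Real.cosh (2 * h / E) - Real.cosh (2 * x / E))) := by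
  linear_combination H.heq / 2

theorem eps_mul_sub_profile_pos (H : IsExtremal h r c ε E) {x : ℝ} (hx : x ∈ Ioo (-h) h) :
    0 < ε * (r - profile ε c E x) := by
  have hxm := Ioo_subset_Icc_self hx
  have hp := H.profile_pos hxm
  have hps := H.profile_sq hxm
  rw [H.radicand_eq] at hps
  have hlt : Real.cosh (2 * x / E) < Real.cosh (2 * h / E) := by
    rw [Real.cosh_lt_cosh, abs_div, abs_div, abs_mul, abs_mul, abs_of_pos H.hh, abs_of_pos H.E_pos]
    have := abs_lt.2 hx
    have := H.E_pos
    gcongr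
  have hA : 0 < E / 2 * √(E ^ 2 - 4 * c) * (Real.cosh (2 * h / E) - Real.cosh (2 * x / E)) := by
    have := H.E_pos
    have := H.sqrt_pos
    have : 0 < Real.cosh (2 * h / E) - Real.cosh (2 * x / E) := by linarith
    positivity
  have hr := H.hr
  have hk : ε * (r - profile ε c E x) * (r + profile ε c E x) =
      E / 2 * √(E ^ 2 - 4 * c) * (Real.cosh (2 * h / E) - Real.cosh (2 * x / E)) := by
    linear_combination (-ε) * hps + (E / 2 * √(E ^ 2 - 4 * c) *
      (Real.cosh (2 * h / E) - Real.cosh (2 * x / E))) * H.eps_sq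
  exact pos_of_mul_pos_left (hk ▸ hA) (by positivity)

/-- With `B = E² / 2 - c`, `R = √(E² - 4c)` and `C = cosh (2x/E)`, the sign is that of `4 B C / E +
ε R (C² + 1)`. For `ε = -1`, positivity of the squared profile means `E R C / 2 < B`, so the first
term exceeds `2 R C² ≥ R (C² + 1)`. -/
theorem eps_mul_deriv2_profile_pos (H : IsExtremal h r c ε E) {x : ℝ} (hx : x ∈ Ioo (-h) h) :
    0 < ε * deriv^[2] (profile ε c E) x := by
  have hxm := Ioo_subset_Icc_self hx
  have hE0 := H.E_pos
  have hRp := H.sqrt_pos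
  have hε2 := H.eps_sq
  have hRsq : √(E ^ 2 - 4 * c) ^ 2 = E ^ 2 - 4 * c :=
    Real.sq_sqrt (sub_nonneg.2 (sqrt_sq_sub_pos H.hc.le H.hE).2.2.le)
  have hp := H.profile_pos hxm
  have hps := H.profile_sq hxm
  have hd := H.hasDerivAt_profile hxm
  have hev : deriv (profile ε c E) =ᶠ[𝓝 x] fun x =>
      ε * (√(E ^ 2 - 4 * c) * Real.sinh (2 * x / E)) / (2 * profile ε c E x) := by
    filter_upwards [Ioo_mem_nhds hx.1 hx.2] with y hy
    exact (H.hasDerivAt_profile (Ioo_subset_Icc_self hy)).deriv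
  have hl : HasDerivAt (fun x : ℝ => 2 * x / E) (2 / E) x := by
    have := ((hasDerivAt_id x).const_mul 2).div_const E
    simpa using! this
  have hd2 := ((((Real.hasDerivAt_sinh (2 * x / E)).comp x hl).const_mul
    √(E ^ 2 - 4 * c)).const_mul ε).fun_div (hd.const_mul 2) (by positivity)
  have hval := hev.deriv_eq.trans hd2.deriv
  rw [Function.iterate_succ, Function.iterate_one, Function.comp_apply, hval]
  simp only [Function.comp_apply]
  have hC1 := Real.one_le_cosh (2 * x / E)
  have hCS := Real.cosh_sq (2 * x / E)
  have hc := H.hc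
  have hcE : 4 * c < E ^ 2 := (sqrt_sq_sub_pos H.hc.le H.hE).2.2
  generalize √(E ^ 2 - 4 * c) = R at *
  generalize Real.cosh (2 * x / E) = C at *
  generalize Real.sinh (2 * x / E) = S at *
  generalize profile ε c E x = y at *
  have key : ε * ((ε * (R * (C * (2 / E))) * (2 * y) -
      ε * (R * S) * (2 * (ε * (R * S) / (2 * y)))) / (2 * y) ^ 2) =
      R * (4 * (E ^ 2 / 2 - c) * C / E + ε * R * (C ^ 2 + 1)) / (4 * y ^ 3) := by
    field_simp
    linear_combination (C * 2 ^ 2 * y ^ 2 - ε * R * E * S ^ 2) * 4 * hε2 + 16 * C * hps +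
      4 * ε * R * E * hCS
  rw [key]
  refine div_pos (mul_pos hRp ?_) (by positivity)
  have hB : 0 < E ^ 2 / 2 - c := by linarith
  rcases H.hε with h1 | h1
  · rw [h1]; positivity
  · rw [h1] at hps ⊢
    have hy2 : 0 < y ^ 2 := by positivity
    have hBA : E / 2 * R * C < E ^ 2 / 2 - c := by linarith
    have : 2 * R * C * C < 4 * (E ^ 2 / 2 - c) * C / E := by
      rw [lt_div_iff₀ hE0]
      have := mul_lt_mul_of_pos_right hBA (show 0 < 4 * C by linarith)
      linarith
    nlinarith [mul_nonneg hRp.le (show 0 ≤ (C - 1) * (C + 1) by nlinarith)]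

theorem strictConvexOn_profile (H : IsExtremal h r c 1 E) :
    StrictConvexOn ℝ (Icc (-h) h) (profile 1 c E) := by
  refine strictConvexOn_of_deriv2_pos (convex_Icc _ _) (H.contDiffOn_profile (n := 0)).continuousOn
    fun x hx => ?_
  rw [interior_Icc] at hx
  simpa using H.eps_mul_deriv2_profile_pos hx

theorem strictConcaveOn_profile (H : IsExtremal h r c (-1) E) :
    StrictConcaveOn ℝ (Icc (-h) h) (profile (-1) c E) := by
  refine strictConcaveOn_of_deriv2_neg (convex_Icc _ _)
    (H.contDiffOn_profile (n := 0)).continuousOn fun x hx => ?_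
  rw [interior_Icc] at hx
  have := H.eps_mul_deriv2_profile_pos hx
  linarith

end IsExtremal

/-! ### Dependence on `c` and the limiting arc -/

/-- On the convex branch the constants `E` and the vertex heights increase with `c`. -/
theorem convex_vertex_lt {h r c₁ c₂ E₁ E₂ : ℝ} (hh : 0 < h) (hc₁ : 0 ≤ c₁) (hc : c₁ < c₂)
    (h₁ : h ≤ E₁) (h₂ : h ≤ E₂) (hE₁ : 2 * √c₁ < E₁) (hE₂ : 2 * √c₂ < E₂)
    (q₁ : E₁ * √(E₁ ^ 2 - 4 * c₁) * Real.cosh (2 * h / E₁) + E₁ ^ 2 = 2 * r ^ 2 + 2 * c₁)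
    (q₂ : E₂ * √(E₂ ^ 2 - 4 * c₂) * Real.cosh (2 * h / E₂) + E₂ ^ 2 = 2 * r ^ 2 + 2 * c₂) :
    E₁ < E₂ ∧ E₁ + √(E₁ ^ 2 - 4 * c₁) < E₂ + √(E₂ ^ 2 - 4 * c₂) := by
  obtain ⟨p1, s1, l1⟩ := sqrt_sq_sub_pos hc₁ hE₁
  obtain ⟨p2, s2, l2⟩ := sqrt_sq_sub_pos (hc₁.trans hc.le) hE₂
  have hR₁ : √(E₁ ^ 2 - 4 * c₁) ^ 2 = E₁ ^ 2 - 4 * c₁ := Real.sq_sqrt (by linarith)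
  -- `m` is the height of the vertex for `c₁`. If `m ≤ √c₂`, then already `2 m ≤ 2 √c₂ < E₂`.
  obtain ⟨m, hm⟩ : ∃ m, 2 * m = E₁ + √(E₁ ^ 2 - 4 * c₁) := ⟨_, mul_div_cancel₀ _ two_ne_zero⟩
  have hR : √(E₁ ^ 2 - 4 * c₁) = 2 * m - E₁ := by linarith
  rw [hR] at hR₁ q₁ s1 ⊢
  have hm0 : 0 < m := by linarith
  have hmE : m * E₁ = m ^ 2 + c₁ := by linarith
  have hsc : √c₂ ^ 2 = c₂ := Real.sq_sqrt (by linarith)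
  have hsc0 : 0 ≤ √c₂ := Real.sqrt_nonneg _
  rcases le_or_gt (m ^ 2) c₂ with hle | hlt
  · have hms : m ≤ √c₂ := Real.le_sqrt_of_sq_le hle
    constructor <;> linarith
  · have hsm : √c₂ < m := (Real.sqrt_lt' hm0).2 hlt
    -- Now `m + n` is the level of the same height `m` for the parameter `c₂`. At this level the
    -- boundary function for `c₂` is still below its target, so by monotonicity `m + n < E₂`.
    obtain ⟨n, hn⟩ : ∃ n, m * n = c₂ := ⟨_, mul_div_cancel₀ _ hm0.ne'⟩
    have hnm : n < m := lt_of_mul_lt_mul_left (by linarith : m * n < m * m) hm0.le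
    have hn0 : 0 < n := pos_of_mul_pos_right (by linarith : 0 < m * n) hm0.le
    obtain ⟨k, hk⟩ : ∃ k, k = E₁ - m := ⟨_, rfl⟩
    have hmk : m * k = c₁ := by rw [hk]; linarith
    have hk0 : 0 ≤ k := nonneg_of_mul_nonneg_right (hmk ▸ hc₁) hm0
    have hkn : k < n := lt_of_mul_lt_mul_left (by linarith : m * k < m * n) hm0.le
    have hEE : E₁ < m + n := by linarith
    have hR' : √((m + n) ^ 2 - 4 * c₂) = m - n := by
      rw [← hn, show (m + n) ^ 2 - 4 * (m * n) = (m - n) ^ 2 by ring, Real.sqrt_sq (by linarith)]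
    have hE'c : 2 * √c₂ < m + n := by
      have h3 := pow_pos (sub_pos.2 hsm) 2
      refine lt_of_mul_lt_mul_left ?_ hm0.le
      linarith
    have hCC : Real.cosh (2 * h / (m + n)) ≤ Real.cosh (2 * h / E₁) := by
      rw [Real.cosh_le_cosh, abs_of_pos (by positivity), abs_of_pos (by positivity)]
      gcongr
    have hC1 : 1 < Real.cosh (2 * h / E₁) := Real.one_lt_cosh.2 (by positivity)
    have hlt' : (m + n) * √((m + n) ^ 2 - 4 * c₂) * Real.cosh (2 * h / (m + n)) + (m + n) ^ 2 <
        E₂ * √(E₂ ^ 2 - 4 * c₂) * Real.cosh (2 * h / E₂) + E₂ ^ 2 := by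
      rw [q₂, hR']
      have g1 : (m - n) * (m + n) * Real.cosh (2 * h / (m + n)) ≤
          (m - n) * (m + n) * Real.cosh (2 * h / E₁) := by
        have : 0 ≤ (m - n) * (m + n) := mul_nonneg (by linarith) (by linarith)
        gcongr
      have hkn2 : k ^ 2 < n ^ 2 := by gcongr
      have g2 : (n ^ 2 - k ^ 2) * (Real.cosh (2 * h / E₁) - 1) > 0 :=
        mul_pos (by linarith) (by linarith)
      have hE₁k : E₁ = m + k := by linarith
      have q₁' : (m ^ 2 - k ^ 2) * Real.cosh (2 * h / E₁) + (m + k) ^ 2 =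
          2 * r ^ 2 + 2 * (m * k) := by
        rw [hmk, ← q₁]
        have : (2 * m - E₁) = m - k := by linarith
        rw [this]
        have : E₁ * (m - k) = m ^ 2 - k ^ 2 := by rw [hE₁k]; ring
        rw [this, ← hE₁k]
      linarith
    have hM := (strictMonoOn_convexEq (h := h) (c := c₂) (M := max h (2 * √c₂)) hh
      (by linarith) (le_max_left _ _) (le_max_right _ _)).lt_iff_lt
      (a := m + n) (b := E₂) (max_le (by linarith) hE'c.le) (max_le h₂ hE₂.le)
    have hlt₂ : m + n < E₂ := hM.1 hlt'
    have hRlt : √((m + n) ^ 2 - 4 * c₂) < √(E₂ ^ 2 - 4 * c₂) := by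
      apply Real.sqrt_lt_sqrt
      · rw [← hn]; linarith [sq_nonneg (m - n)]
      · have : (m + n) ^ 2 < E₂ ^ 2 := by gcongr
        linarith
    rw [hR'] at hRlt
    constructor <;> linarith

/-- At `x = 0` the squared profile is the square of the vertex height, which increases with `c`; as
the frequency `2 / E` decreases, the comparison normalized at the origin carries the inequality to
every `x`. Allowing `c₁ = 0` covers the stable catenary. -/
theorem convex_comparison {h r c₁ c₂ E₁ E₂ : ℝ} (hh : 0 < h) (hc₁ : 0 ≤ c₁) (hc : c₁ < c₂)
    (h₁ : h ≤ E₁) (h₂ : h ≤ E₂) (hE₁ : 2 * √c₁ < E₁) (hE₂ : 2 * √c₂ < E₂)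
    (q₁ : E₁ * √(E₁ ^ 2 - 4 * c₁) * Real.cosh (2 * h / E₁) + E₁ ^ 2 = 2 * r ^ 2 + 2 * c₁)
    (q₂ : E₂ * √(E₂ ^ 2 - 4 * c₂) * Real.cosh (2 * h / E₂) + E₂ ^ 2 = 2 * r ^ 2 + 2 * c₂)
    {x : ℝ} (hx : x ∈ Ioo (-h) h) :
    E₁ / 2 * √(E₁ ^ 2 - 4 * c₁) * Real.cosh (2 * x / E₁) + E₁ ^ 2 / 2 - c₁ <
      E₂ / 2 * √(E₂ ^ 2 - 4 * c₂) * Real.cosh (2 * x / E₂) + E₂ ^ 2 / 2 - c₂ := by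
  obtain ⟨hEE, hmm⟩ := convex_vertex_lt hh hc₁ hc h₁ h₂ hE₁ hE₂ q₁ q₂
  obtain ⟨p1, s1, l1⟩ := sqrt_sq_sub_pos hc₁ hE₁
  obtain ⟨p2, s2, l2⟩ := sqrt_sq_sub_pos (hc₁.trans hc.le) hE₂
  have hR₁ : √(E₁ ^ 2 - 4 * c₁) ^ 2 = E₁ ^ 2 - 4 * c₁ := Real.sq_sqrt (by linarith)
  have hR₂ : √(E₂ ^ 2 - 4 * c₂) ^ 2 = E₂ ^ 2 - 4 * c₂ := Real.sq_sqrt (by linarith)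
  have hxa : |x| < h := abs_lt.2 hx
  have hx0 := abs_nonneg x
  have key := Real.cosh_sub_cosh_comparison_origin (d₁ := 2 / E₁) (d₂ := 2 / E₂) (h := h)
    (x := |x|) (by positivity) (by gcongr) hx0 hxa.le
  rw [Real.cosh_two_mul_div_eq p1, Real.cosh_two_mul_div_eq p2] at *
  rw [abs_of_pos hh] at q₁ q₂
  have hK₁ : 1 < Real.cosh (2 / E₁ * h) := Real.one_lt_cosh.2 (by positivity)
  have hK₂ : 1 < Real.cosh (2 / E₂ * h) := Real.one_lt_cosh.2 (by positivity)
  have hD₁ : Real.cosh (2 / E₁ * |x|) < Real.cosh (2 / E₁ * h) := by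
    rw [Real.cosh_lt_cosh, abs_of_nonneg (show 0 ≤ 2 / E₁ * |x| by positivity),
      abs_of_pos (show 0 < 2 / E₁ * h by positivity)]
    gcongr
  have hm : (E₁ + √(E₁ ^ 2 - 4 * c₁)) ^ 2 < (E₂ + √(E₂ ^ 2 - 4 * c₂)) ^ 2 := by gcongr
  generalize √(E₁ ^ 2 - 4 * c₁) = R₁ at *
  generalize √(E₂ ^ 2 - 4 * c₂) = R₂ at *
  generalize Real.cosh (2 / E₁ * h) = C₁ at *
  generalize Real.cosh (2 / E₂ * h) = C₂ at *
  generalize Real.cosh (2 / E₁ * |x|) = D₁ at *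
  generalize Real.cosh (2 / E₂ * |x|) = D₂ at *
  have hA : E₂ / 2 * R₂ * (C₂ - 1) < E₁ / 2 * R₁ * (C₁ - 1) := by linarith
  have hA₂ : 0 ≤ E₂ / 2 * R₂ := by positivity
  have k1 := mul_le_mul_of_nonneg_left key hA₂
  have k2 := mul_lt_mul_of_pos_right hA (sub_pos.2 hD₁)
  have k3 : E₂ / 2 * R₂ * (C₂ - D₂) < E₁ / 2 * R₁ * (C₁ - D₁) := by
    refine lt_of_mul_lt_mul_right ?_ (sub_pos.2 hK₁).le
    linarith
  linarith

/-- Here the normalization is at `h`: the endpoint slope `√(p² - 1)` increases with `c`, and the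
comparison normalized at `h` carries this inwards. -/
theorem concave_comparison {h r c₁ c₂ E₁ E₂ : ℝ} (hh : 0 < h) (hr : 0 < r) (hc₁ : r ^ 2 < c₁)
    (hc : c₁ < c₂) (S₁ : SolvesConcaveEq h r c₁ E₁) (S₂ : SolvesConcaveEq h r c₂ E₂) {x : ℝ}
    (hx : x ∈ Ioo (-h) h) :
    E₁ / 2 * √(E₁ ^ 2 - 4 * c₁) * (Real.cosh (2 * h / E₁) - Real.cosh (2 * x / E₁)) <
      E₂ / 2 * √(E₂ ^ 2 - 4 * c₂) * (Real.cosh (2 * h / E₂) - Real.cosh (2 * x / E₂)) := by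
  obtain ⟨hEE, hpp⟩ := (S₁.comparison hh hr hc₁ hc.le S₂).2 hc
  have p1 := S₁.pos hc₁
  have p2 := S₂.pos (hc₁.trans hc)
  obtain ⟨a1, a2, -⟩ := S₁.slope_relation hh hr hc₁
  obtain ⟨b1, b2, -⟩ := S₂.slope_relation hh hr (hc₁.trans hc)
  have hR : √(E₁ ^ 2 - 4 * c₁) * Real.sinh (2 * h / E₁) <
      √(E₂ ^ 2 - 4 * c₂) * Real.sinh (2 * h / E₂) := by
    rw [a2, b2]
    have : √(((r ^ 2 + c₁) / (r * E₁)) ^ 2 - 1) < √(((r ^ 2 + c₂) / (r * E₂)) ^ 2 - 1) := by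
      apply Real.sqrt_lt_sqrt
      · nlinarith
      · nlinarith
    gcongr
  have hxa : |x| < h := abs_lt.2 hx
  have hx0 := abs_nonneg x
  have key := Real.cosh_sub_cosh_comparison_end (d₁ := 2 / E₁) (d₂ := 2 / E₂) (h := h)
    (x := |x|) (by positivity) (by gcongr) hx0 hxa.le
  have hS₂ : 0 < 2 / E₂ * Real.sinh (2 / E₂ * h) := by
    have := Real.sinh_pos_iff.2 (show 0 < 2 / E₂ * h by positivity)
    positivity
  rw [Real.cosh_two_mul_div_eq p1, Real.cosh_two_mul_div_eq p2, Real.cosh_two_mul_div_eq p1,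
    Real.cosh_two_mul_div_eq p2, abs_of_pos hh]
  rw [show 2 * h / E₁ = 2 / E₁ * h by ring, show 2 * h / E₂ = 2 / E₂ * h by ring] at hR
  have hD₂ : Real.cosh (2 / E₂ * |x|) < Real.cosh (2 / E₂ * h) := by
    rw [Real.cosh_lt_cosh, abs_of_nonneg (show 0 ≤ 2 / E₂ * |x| by positivity),
      abs_of_pos (show 0 < 2 / E₂ * h by positivity)]
    gcongr
  have t1 : E₁ / 2 * √(E₁ ^ 2 - 4 * c₁) * (2 / E₁ * Real.sinh (2 / E₁ * h)) =
    √(E₁ ^ 2 - 4 * c₁) * Real.sinh (2 / E₁ * h) := by field_simp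
  have t2 : E₂ / 2 * √(E₂ ^ 2 - 4 * c₂) * (2 / E₂ * Real.sinh (2 / E₂ * h)) =
    √(E₂ ^ 2 - 4 * c₂) * Real.sinh (2 / E₂ * h) := by field_simp
  rw [← t1, ← t2] at hR
  have hA₁ : 0 ≤ E₁ / 2 * √(E₁ ^ 2 - 4 * c₁) := by positivity
  generalize E₁ / 2 * √(E₁ ^ 2 - 4 * c₁) = A₁ at *
  generalize E₂ / 2 * √(E₂ ^ 2 - 4 * c₂) = A₂ at *
  refine lt_of_mul_lt_mul_right ?_ hS₂.le
  have k1 := mul_le_mul_of_nonneg_left key hA₁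
  have k2 := mul_lt_mul_of_pos_right hR (sub_pos.2 hD₂)
  linarith

/-- Bounds for the squared concave profile relative to the circular arc. -/
theorem SolvesConcaveEq.arc_bounds {h r c E : ℝ} (hh : 0 < h) (hr : 0 < r) (hcr : r ^ 2 < c)
    (hS : SolvesConcaveEq h r c E) {x : ℝ} (hx : x ∈ Icc (-h) h) :
    (x ∈ Ioo (-h) h → E / 2 * √(E ^ 2 - 4 * c) * (Real.cosh (2 * h / E) - Real.cosh (2 * x / E)) <
      h ^ 2 - x ^ 2) ∧
    h ^ 2 - x ^ 2 - E / 2 * √(E ^ 2 - 4 * c) * (Real.cosh (2 * h / E) - Real.cosh (2 * x / E)) ≤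
      h ^ 2 * (4 * (r ^ 2 + h ^ 2) / c) := by
  have hE0 := hS.pos hcr
  have hc : 0 < c := lt_of_le_of_lt (sq_nonneg r) hcr
  obtain ⟨a1, a2, a3⟩ := hS.slope_relation hh hr hcr
  have hRsq : √(E ^ 2 - 4 * c) ^ 2 = E ^ 2 - 4 * c := Real.sq_sqrt (by linarith [hS.2.1])
  have hs0 : 0 < 2 * h / E := by positivity
  have hsp := Real.sinh_pos_iff.2 hs0
  -- Since `s coth s > 1` and the other term of the slope relation is positive, the endpoint slope
  -- stays below `h / r`, which is the slope of the circular arc.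
  have hp : √(((r ^ 2 + c) / (r * E)) ^ 2 - 1) < h / r := by
    have h1 : 1 < 2 * h / E * Real.cosh (2 * h / E) / Real.sinh (2 * h / E) := by
      rw [one_lt_div hsp]; exact Real.sinh_lt_mul_cosh hs0
    have h2 := mul_le_mul_of_nonneg_left h1.le (Real.sqrt_nonneg (((r ^ 2 + c) / (r * E)) ^ 2 - 1))
    have h3 : 0 < (r ^ 2 + c) / (r * E) * (2 * h / E) := by positivity
    linarith
  rw [Real.cosh_two_mul_div_eq hE0, Real.cosh_two_mul_div_eq hE0, abs_of_pos hh]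
  rw [show 2 * h / E = 2 / E * h by ring] at a2 hsp
  have hx0 := abs_nonneg x
  have hRp := Real.sqrt_nonneg (E ^ 2 - 4 * c)
  constructor
  · intro hx
    have hxa : |x| < h := abs_lt.2 hx
    have key := Real.cosh_sub_cosh_lt (d := 2 / E) (by positivity) hx0 hxa
    rw [sq_abs] at key
    have hxx : 0 < h ^ 2 - x ^ 2 := by nlinarith [hx.1, hx.2]
    have hRs : √(E ^ 2 - 4 * c) * Real.sinh (2 / E * h) < 2 * h := by
      rw [a2]
      have := mul_lt_mul_of_pos_left hp (show 0 < 2 * r by positivity)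
      rwa [show 2 * r * (h / r) = 2 * h by field_simp] at this
    have k1 := mul_le_mul_of_nonneg_left key.le (show 0 ≤ E / 2 * √(E ^ 2 - 4 * c) by positivity)
    have k2 : E / 2 * √(E ^ 2 - 4 * c) * ((h ^ 2 - x ^ 2) * (2 / E * Real.sinh (2 / E * h))) =
        (h ^ 2 - x ^ 2) * (√(E ^ 2 - 4 * c) * Real.sinh (2 / E * h)) := by field_simp
    have k3 := mul_lt_mul_of_pos_left hRs hxx
    refine lt_of_mul_lt_mul_left ?_ (show 0 ≤ 2 * h by positivity)
    linarith
  · have hxa : |x| ≤ h := abs_le.2 hx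
    have key := Real.le_cosh_sub_cosh (d := 2 / E) (by positivity) hx0 hxa
    rw [sq_abs] at key
    have k1 := mul_le_mul_of_nonneg_left key (show 0 ≤ E / 2 * √(E ^ 2 - 4 * c) by positivity)
    have k2 : E / 2 * √(E ^ 2 - 4 * c) * ((2 / E) ^ 2 * (h ^ 2 - x ^ 2) / 2) =
        √(E ^ 2 - 4 * c) / E * (h ^ 2 - x ^ 2) := by field_simp
    rw [k2] at k1
    have hxx : 0 ≤ h ^ 2 - x ^ 2 := by nlinarith [hx.1, hx.2]
    -- `1 - t ≤ 1 - t² = 4c / E²`, and the slope bound gives `E² (r² + h²) > (r² + c)² ≥ c²`, so the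
    -- error is of order `1 / c`.
    obtain ⟨t, ht⟩ : ∃ t, t = √(E ^ 2 - 4 * c) / E := ⟨_, rfl⟩
    have ht0 : 0 ≤ t := by rw [ht]; positivity
    have htE : t ^ 2 = 1 - 4 * c / E ^ 2 := by
      rw [ht, div_pow, hRsq]; field_simp
    have hcE : 4 * c / E ^ 2 ≤ 4 * (r ^ 2 + h ^ 2) / c := by
      have h1 : ((r ^ 2 + c) / (r * E)) ^ 2 - 1 < (h / r) ^ 2 :=
        (Real.sqrt_lt' (by positivity)).1 hp
      have h2 : (r ^ 2 + c) ^ 2 < E ^ 2 * (r ^ 2 + h ^ 2) := by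
        rw [div_pow, div_pow, sub_lt_iff_lt_add, div_lt_iff₀ (by positivity)] at h1
        have : (h ^ 2 / r ^ 2 + 1) * (r * E) ^ 2 = E ^ 2 * (r ^ 2 + h ^ 2) := by
          field_simp; ring
        linarith
      have h3 : c ^ 2 ≤ (r ^ 2 + c) ^ 2 := by
        have := sq_nonneg r
        gcongr
        linarith
      rw [div_le_div_iff₀ (by positivity) hc]
      linarith
    have ht1 : t ≤ 1 := by
      have : 0 < 4 * c / E ^ 2 := by positivity
      nlinarith
    have h3 : 1 - t ≤ 4 * (r ^ 2 + h ^ 2) / c := by nlinarith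
    rw [← ht] at k1
    have h4 : (h ^ 2 - x ^ 2) * (1 - t) ≤ h ^ 2 * (4 * (r ^ 2 + h ^ 2) / c) :=
      mul_le_mul (by nlinarith [sq_nonneg x]) h3 (by linarith) (by positivity)
    linarith

theorem catenary_eq_sqrt {P x : ℝ} (hP : 0 < P) :
    P * Real.cosh (x / P) =
      √(P / 2 * √(P ^ 2 - 4 * 0) * Real.cosh (2 * x / P) + P ^ 2 / 2 - 0) := by
  rw [mul_zero, sub_zero, sub_zero, Real.sqrt_sq hP.le, mul_div_assoc, Real.cosh_two_mul_eq,
    show P / 2 * P * (2 * Real.cosh (x / P) ^ 2 - 1) + P ^ 2 / 2 = (P * Real.cosh (x / P)) ^ 2 by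
      ring, Real.sqrt_sq (mul_pos hP (Real.cosh_pos _)).le]

namespace IsExtremal

variable {h r c c₁ c₂ E E₁ E₂ : ℝ}

theorem convexProfile_lt (H₁ : IsExtremal h r c₁ 1 E₁) (H₂ : IsExtremal h r c₂ 1 E₂)
    (hc : c₁ < c₂) (h₁ : h ≤ E₁) (h₂ : h ≤ E₂) {x : ℝ} (hx : x ∈ Ioo (-h) h) :
    profile 1 c₁ E₁ x < profile 1 c₂ E₂ x := by
  have q₁ := H₁.heq
  have q₂ := H₂.heq
  rw [one_mul] at q₁ q₂
  refine lt_of_pow_lt_pow_left₀ 2 (Real.sqrt_nonneg _) ?_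
  rw [H₁.profile_sq (Ioo_subset_Icc_self hx), H₂.profile_sq (Ioo_subset_Icc_self hx), one_mul,
    one_mul]
  exact convex_comparison H₁.hh H₁.hc.le hc h₁ h₂ H₁.hE H₂.hE q₁ q₂ hx

theorem catenary_lt_profile {P : ℝ} (H : IsExtremal h r c 1 E) (hP : h ≤ P) (hPE : P < E)
    (hrP : r = P * Real.cosh (h / P)) {x : ℝ} (hx : x ∈ Ioo (-h) h) :
    P * Real.cosh (x / P) < profile 1 c E x := by
  have hP0 : 0 < P := H.hh.trans_le hP
  have q := H.heq
  rw [one_mul] at q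
  have := convex_comparison (c₁ := 0) (E₁ := P) H.hh le_rfl H.hc hP (hP.trans hPE.le)
    (by simpa using hP0) H.hE (by
      rw [mul_zero, sub_zero, mul_zero, add_zero, Real.sqrt_sq hP0.le, hrP, mul_div_assoc,
        Real.cosh_two_mul_eq]
      ring) q hx
  rw [catenary_eq_sqrt hP0, profile, one_mul]
  refine Real.sqrt_lt_sqrt ?_ this
  rw [mul_zero, sub_zero, sub_zero, Real.sqrt_sq hP0.le]
  have := Real.cosh_pos (2 * x / P)
  positivity

theorem concaveProfile_lt (H₁ : IsExtremal h r c₁ (-1) E₁) (H₂ : IsExtremal h r c₂ (-1) E₂)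
    (hc₁ : r ^ 2 < c₁) (hc : c₁ < c₂) (S₁ : SolvesConcaveEq h r c₁ E₁)
    (S₂ : SolvesConcaveEq h r c₂ E₂) {x : ℝ} (hx : x ∈ Ioo (-h) h) :
    profile (-1) c₁ E₁ x < profile (-1) c₂ E₂ x := by
  refine lt_of_pow_lt_pow_left₀ 2 (Real.sqrt_nonneg _) ?_
  rw [H₁.profile_sq (Ioo_subset_Icc_self hx), H₂.profile_sq (Ioo_subset_Icc_self hx),
    H₁.radicand_eq, H₂.radicand_eq]
  linarith [concave_comparison H₁.hh H₁.hr hc₁ hc S₁ S₂ hx]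

theorem profile_lt_circleArc (H : IsExtremal h r c (-1) E) (hcr : r ^ 2 < c)
    (S : SolvesConcaveEq h r c E) {x : ℝ} (hx : x ∈ Ioo (-h) h) :
    profile (-1) c E x < circleArc h r x := by
  have hxm := Ioo_subset_Icc_self hx
  refine Real.lt_sqrt_of_sq_lt ?_
  rw [H.profile_sq hxm, H.radicand_eq]
  linarith [(S.arc_bounds H.hh H.hr hcr hxm).1 hx]

/-- The difference of the squares is controlled by `arc_bounds`, and the sum of the two functions is
at least `r`. -/
theorem dist_circleArc_profile_le (H : IsExtremal h r c (-1) E) (hcr : r ^ 2 < c)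
    (S : SolvesConcaveEq h r c E) {x : ℝ} (hx : x ∈ Icc (-h) h) :
    dist (circleArc h r x) (profile (-1) c E x) ≤ h ^ 2 * (4 * (r ^ 2 + h ^ 2) / c) / r := by
  have hr := H.hr
  have hh := H.hh
  have hp := H.profile_pos hx
  have hps := H.profile_sq hx
  rw [H.radicand_eq] at hps
  obtain ⟨b1, b2⟩ := S.arc_bounds hh hr hcr hx
  have hle : profile (-1) c E x ≤ circleArc h r x := by
    rcases eq_or_ne x h with rfl | hxh
    · rw [H.profile_h, circleArc, add_sub_cancel_left, Real.sqrt_sq hr.le]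
    · rcases eq_or_ne x (-h) with rfl | hxh'
      · rw [profile_neg, H.profile_h, circleArc, neg_sq, add_sub_cancel_left, Real.sqrt_sq hr.le]
      · exact (H.profile_lt_circleArc hcr S
          ⟨lt_of_le_of_ne hx.1 hxh'.symm, lt_of_le_of_ne hx.2 hxh⟩).le
  have hxx : x ^ 2 ≤ h ^ 2 := sq_le_sq' hx.1 hx.2
  have has : circleArc h r x ^ 2 = h ^ 2 + r ^ 2 - x ^ 2 :=
    Real.sq_sqrt (by linarith [sq_nonneg r])
  have har : r ≤ circleArc h r x := Real.le_sqrt_of_sq_le (by linarith)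
  rw [Real.dist_eq, abs_of_nonneg (by linarith), le_div_iff₀ hr]
  have h1 : (circleArc h r x - profile (-1) c E x) * r ≤
      (circleArc h r x - profile (-1) c E x) * (circleArc h r x + profile (-1) c E x) := by
    have : 0 ≤ circleArc h r x - profile (-1) c E x := by linarith
    gcongr
    linarith
  linarith

end IsExtremal

/-! ### The main theorem -/

theorem theorem1p1 (h r : ℝ) (hh : 0 < h) (hr : 0 < r) (hω : h / r ≤ omegaConst) :
    ∃ P₀ P₁ : ℝ,
      -- `P₀ > P₁` are precisely the two positive solutions of `r = P cosh (h / P)`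
      0 < P₁ ∧ P₁ < P₀ ∧
      (∀ P : ℝ, 0 < P → (r = P * Real.cosh (h / P) ↔ P = P₀ ∨ P = P₁)) ∧
      ∃ ρ : ℝ → ℝ → ℝ,
        -- existence and uniqueness of the minimizer `ρ c`
        (∀ c : ℝ, 0 < c → IsMinimizer h r c (ρ c) ∧
          ∀ σ : ℝ → ℝ, IsMinimizer h r c σ → EqOn σ (ρ c) (Icc (-h) h)) ∧
        -- case `c < r²`
        (∀ c : ℝ, 0 < c → c < r ^ 2 →
          (∃ E : ℝ, P₀ < E ∧ SolvesConvexEq h r c E ∧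
            (∀ E' : ℝ, P₀ < E' → SolvesConvexEq h r c E' → E' = E) ∧
            ∀ x ∈ Icc (-h) h, ρ c x = convexProfile c E x) ∧
          ContDiffOn ℝ (⊤ : ℕ∞) (ρ c) (Icc (-h) h) ∧
          (∀ x ∈ Icc (-h) h, ρ c (-x) = ρ c x) ∧
          StrictConvexOn ℝ (Icc (-h) h) (ρ c) ∧
          ∀ x ∈ Ioo (-h) h, P₀ * Real.cosh (x / P₀) < ρ c x ∧ ρ c x < r) ∧
        -- case `c = r²`
        (∀ x ∈ Icc (-h) h, ρ (r ^ 2) x = r) ∧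
        -- case `c > r²`
        (∀ c : ℝ, r ^ 2 < c →
          (∃ E : ℝ, 0 < E ∧ SolvesConcaveEq h r c E ∧
            (∀ E' : ℝ, SolvesConcaveEq h r c E' → E' = E) ∧
            ∀ x ∈ Icc (-h) h, ρ c x = concaveProfile c E x) ∧
          ContDiffOn ℝ (⊤ : ℕ∞) (ρ c) (Icc (-h) h) ∧
          (∀ x ∈ Icc (-h) h, ρ c (-x) = ρ c x) ∧
          StrictConcaveOn ℝ (Icc (-h) h) (ρ c) ∧
          ∀ x ∈ Ioo (-h) h, r < ρ c x ∧ ρ c x < circleArc h r x) ∧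
        -- uniform convergence to the circular arc as `c → ∞`
        TendstoUniformlyOn ρ (circleArc h r) atTop (Icc (-h) h) ∧
        -- strict monotonicity in `c`
        (∀ c₁ c₂ : ℝ, 0 < c₁ → c₁ < c₂ → ∀ x ∈ Ioo (-h) h, ρ c₁ x < ρ c₂ x) := by
  obtain ⟨P₀, P₁, hP₁, hP, hiff, hξ, hlt, hgt⟩ := exists_catenaries hh hr hω
  refine ⟨P₀, P₁, hP₁, hP, hiff, ?_⟩
  have hP₀ : 0 < P₀ := hP₁.trans hP
  have hhP : h ≤ P₀ := by
    have := hξ.trans_lt inv_xiConst_lt_one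
    rw [div_lt_one hP₀] at this
    exact this.le
  have hrP := (hiff P₀ hP₀).2 (Or.inl rfl)
  choose! e e1 e2 e3 e4 e5 e6 using fun (c : ℝ) (hc : 0 < c ∧ c < r ^ 2) =>
    exists_convex_minimum hh hr hP₁ hP hrP hξ hlt hgt hc.1 hc.2
  choose! k k1 k2 k3 k4 k5 using fun (c : ℝ) (hc : r ^ 2 < c) => exists_concave_minimum hh hr hc
  have Hx : ∀ c, 0 < c → c < r ^ 2 → IsExtremal h r c 1 (e c) := fun c h0 h1 =>
    .of_convex hh hr h0 h1 (e2 c ⟨h0, h1⟩) (e3 c ⟨h0, h1⟩) (e4 c ⟨h0, h1⟩)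
  have Hv : ∀ c, r ^ 2 < c → IsExtremal h r c (-1) (k c) := fun c h1 =>
    .of_concave hh hr h1 (k1 c h1) (k2 c h1) (k3 c h1)
  -- For `c ≤ 0` the choice of `e c`, and so of `ρ c`, is arbitrary; no conclusion concerns these
  -- parameters.
  obtain ⟨ρ, hρx, hρ, hρv⟩ : ∃ ρ : ℝ → ℝ → ℝ, (∀ c, c < r ^ 2 → ρ c = profile 1 c (e c)) ∧
      ρ (r ^ 2) = (fun _ => r) ∧ ∀ c, r ^ 2 < c → ρ c = profile (-1) c (k c) := by
    refine ⟨fun c => if c < r ^ 2 then profile 1 c (e c) else if r ^ 2 < c then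
      profile (-1) c (k c) else fun _ => r, fun c hc => if_pos hc, by simp, fun c hc => ?_⟩
    simp only [if_neg hc.not_gt, if_pos hc]
  have below : ∀ c, 0 < c → c < r ^ 2 → ∀ x ∈ Ioo (-h) h, ρ c x < r := fun c h0 h1 x hx => by
    rw [hρx c h1]
    linarith [(Hx c h0 h1).eps_mul_sub_profile_pos hx]
  have above : ∀ c, r ^ 2 < c → ∀ x ∈ Ioo (-h) h, r < ρ c x := fun c h1 x hx => by
    rw [hρv c h1]
    linarith [(Hv c h1).eps_mul_sub_profile_pos hx]
  refine ⟨ρ, fun c hc => ?_, fun c h0 h1 => ⟨⟨e c, e1 c ⟨h0, h1⟩, e4 c ⟨h0, h1⟩, e5 c ⟨h0, h1⟩,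
    fun x _ => by rw [hρx c h1, convexProfile_eq_profile]⟩, ?_⟩, fun x _ => by rw [hρ],
    fun c h1 => ⟨⟨k c, (Hv c h1).E_pos, k3 c h1, k4 c h1,
    fun x _ => by rw [hρv c h1, concaveProfile_eq_profile]⟩, ?_⟩, ?_, ?_⟩
  · rcases lt_trichotomy c (r ^ 2) with h1 | rfl | h1
    · rw [hρx c h1]
      exact (Hx c hc h1).isMinimizer_profile (e6 c ⟨hc, h1⟩)
    · rw [hρ]
      exact isMinimizer_const hh hr
    · rw [hρv c h1]
      exact (Hv c h1).isMinimizer_profile (k5 c h1)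
  · refine ⟨?_, ?_, ?_, fun x hx => ⟨?_, below c h0 h1 x hx⟩⟩ <;> rw [hρx c h1]
    · exact (Hx c h0 h1).contDiffOn_profile
    · exact fun x _ => profile_neg _ _ _ _
    · exact (Hx c h0 h1).strictConvexOn_profile
    · exact (Hx c h0 h1).catenary_lt_profile hhP (e1 c ⟨h0, h1⟩) hrP hx
  · refine ⟨?_, ?_, ?_, fun x hx => ⟨above c h1 x hx, ?_⟩⟩ <;> rw [hρv c h1]
    · exact (Hv c h1).contDiffOn_profile
    · exact fun x _ => profile_neg _ _ _ _
    · exact (Hv c h1).strictConcaveOn_profile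
    · exact (Hv c h1).profile_lt_circleArc h1 (k3 c h1) hx
  · rw [Metric.tendstoUniformlyOn_iff]
    intro δ hδ
    filter_upwards [eventually_gt_atTop (r ^ 2),
      eventually_gt_atTop (h ^ 2 * (4 * (r ^ 2 + h ^ 2)) / (δ * r))] with c h1 h2 x hx
    have hc : 0 < c := (sq_nonneg r).trans_lt h1
    rw [hρv c h1]
    refine ((Hv c h1).dist_circleArc_profile_le h1 (k3 c h1) hx).trans_lt ?_
    rw [div_lt_iff₀ (by positivity)] at h2
    rw [div_lt_iff₀ hr, mul_div_assoc', div_lt_iff₀ hc]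
    linarith
  · intro c₁ c₂ h0 h12 x hx
    rcases lt_trichotomy c₁ (r ^ 2) with h1 | h1 | h1
    · rcases lt_trichotomy c₂ (r ^ 2) with h2 | h2 | h2
      · rw [hρx c₁ h1, hρx c₂ h2]
        exact (Hx c₁ h0 h1).convexProfile_lt (Hx c₂ (h0.trans h12) h2) h12
          (hhP.trans (e1 c₁ ⟨h0, h1⟩).le) (hhP.trans (e1 c₂ ⟨h0.trans h12, h2⟩).le) hx
      · rw [h2, hρ]
        exact below c₁ h0 h1 x hx
      · exact (below c₁ h0 h1 x hx).trans (above c₂ h2 x hx)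
    · rw [h1, hρ]
      exact above c₂ (h1 ▸ h12) x hx
    · have h2 := h1.trans h12
      rw [hρv c₁ h1, hρv c₂ h2]
      exact (Hv c₁ h1).concaveProfile_lt (Hv c₂ h2) h1 h12 (k3 c₁ h1) (k3 c₂ h2) hx
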